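/- Let $n\ge 2$ and let $\Omega\subset\mathbb{R}^n$ be an admissible domain, that is, a bounded non-empty connected open set for which there is a bounded linear extension operator $\mathrm{E}_\Omega:H^1(\Omega)\to H^1(\mathbb{R}^n)$ (so $\mathrm{E}_\Omega u|_\Omega=u$) and whose boundary $\partial\Omega$ has positive capacity with respect to $H^1(\mathbb{R}^n)$. All functions are real-valued. Let $\mathcal{B}(\partial\Omega)$ be the space of quasi-everywhere equivalence classes of the restrictions $\tilde w|_{\partial\Omega}$ of quasi-continuous representatives $\tilde w$ of $w\in H^1(\mathbb{R}^n)$. Fix an extension operator $\mathrm{E}_\Omega$ as above, let $\operatorname{Tr}:H^1(\Omega)\to\mathcal{B}(\partial\Omega)$, $\operatorname{Tr}u=[(\mathrm{E}_\Omega u)^\sim|_{\partial\Omega}]$, and endow $\mathcal{B}(\partial\Omega)$ with the norm $\|f\|_{\mathcal{B}(\partial\Omega)}=\inf\{\|v\|_{H^1(\Omega)}: \operatorname{Tr}v=f\}$ and its dual $\mathcal{B}'(\partial\Omega)$ with the subordinate norm. Let $\mathcal{T}(\Omega)$ be the set of $\gamma\in L^\infty(\Omega)$ with $\operatorname{ess\,inf}\gamma>0$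 which are continuous on some neighbourhood of $\partial\Omega$ in $\Omega$. For $\gamma\in\mathcal{T}(\Omega)$, a weak solution of $\nabla\cdot(\gamma\nabla u)=0$ on $\Omega$ is a $u\in H^1(\Omega)$ with $\int_\Omega\gamma\nabla u\cdot\nabla\varphi\,\mathrm{d}x=0$ for all $\varphi\in C_0^\infty(\Omega)$; its weak conormal derivative $\gamma\,\partial_\nu u$ is the $\psi\in\mathcal{B}'(\partial\Omega)$ such that $\langle\psi,\operatorname{Tr}v\rangle=\int_\Omega\gamma\nabla u\cdot\nabla v\,\mathrm{d}x$ for all $v\in H^1(\Omega)$. The Poincaré–Steklov operator $\Lambda^\gamma:\mathcal{B}(\partial\Omega)\to\mathcal{B}'(\partial\Omega)$ is defined by $\Lambda^\gamma(\operatorname{Tr}u)=\gamma\,\partial_\nu u$ for weak solutions $u$ of $\nabla\cdot(\gamma\nabla u)=0$ on $\Omega$. Then: (i) For every $\gamma\in\mathcal{T}(\Omega)$, the operator $\Lambda^\gamma$ is well defined (every $f\in\mathcal{B}(\partial\Omega)$ is the trace of exactly one weak solution $u$, and $\gamma\,\partial_\nu u$ exists and is unique), linear, bounded, and coincides with its adjoint: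 $\langle\Lambda^\gamma f,g\rangle=\langle\Lambda^\gamma g,f\rangle$ for all $f,g\in\mathcal{B}(\partial\Omega)$. (ii) If $\gamma_1,\gamma_2\in\mathcal{T}(\Omega)$ and $u_1,u_2\in H^1(\Omega)$ satisfy $\nabla\cdot(\gamma_i\nabla u_i)=0$ weakly on $\Omega$, $i\in\{1,2\}$, then $$\langle(\Lambda^{\gamma_1}-\Lambda^{\gamma_2})\operatorname{Tr}u_1,\operatorname{Tr}u_2\rangle_{\mathcal{B}'(\partial\Omega),\mathcal{B}(\partial\Omega)}=\int_\Omega(\gamma_1-\gamma_2)\nabla u_1\cdot\nabla u_2\,\mathrm{d}x.$$ -/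

import Mathlib

open MeasureTheory Set
open scoped ENNReal ContDiff

noncomputable section

namespace Steklov

/-- Euclidean space `ℝⁿ`. -/
abbrev Eu (n : ℕ) : Type := EuclideanSpace ℝ (Fin n)

/-- Smooth real functions on `ℝⁿ` with compact support contained in `U`. -/
structure IsTest {n : ℕ} (U : Set (Eu n)) (φ : Eu n → ℝ) : Prop where
  smooth : ContDiff ℝ ∞ φ
  compact : HasCompactSupport φ
  supp : tsupport φ ⊆ U

/-- `L²(U) × L²(U; ℝⁿ)` with the Hilbertian product norm. -/
abbrev L2Pair {n : ℕ} (U : Set (Eu n)) : Type :=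
  WithLp 2 (Lp ℝ 2 (volume.restrict U) × Lp (Eu n) 2 (volume.restrict U))

theorem IsTest.memLp {n : ℕ} {U : Set (Eu n)} {φ : Eu n → ℝ} (h : IsTest U φ) :
    MemLp φ 2 (volume.restrict U) :=
  (h.smooth.continuous.memLp_of_hasCompactSupport h.compact)

theorem IsTest.memLp_deriv {n : ℕ} {U : Set (Eu n)} {φ : Eu n → ℝ} (h : IsTest U φ)
    (e : Eu n) : MemLp (fun x => fderiv ℝ φ x e) 2 (volume.restrict U) := by
  have hc : Continuous (fun x => fderiv ℝ φ x e) :=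
    (h.smooth.continuous_fderiv (by simp)).clm_apply continuous_const
  exact hc.memLp_of_hasCompactSupport (h.compact.fderiv_apply ℝ e)

theorem memLp_coord {n : ℕ} {U : Set (Eu n)} (g : Lp (Eu n) 2 (volume.restrict U)) (i : Fin n) :
    MemLp (fun x => g x i) 2 (volume.restrict U) :=
  (Lp.memLp g).continuousLinearMap_comp (EuclideanSpace.proj (𝕜 := ℝ) i)

/-- `(u, g)` with `g` the weak gradient of `u` on `U`:
`∫_U u ∂ᵢφ = - ∫_U gᵢ φ` for all test functions `φ` on `U` and all `i`. -/
def HasWeakGradient {n : ℕ} {U : Set (Eu n)} (u : Lp ℝ 2 (volume.restrict U))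
    (g : Lp (Eu n) 2 (volume.restrict U)) : Prop :=
  ∀ φ : Eu n → ℝ, IsTest U φ → ∀ i : Fin n,
    ∫ x in U, u x * fderiv ℝ φ x (EuclideanSpace.single i 1) = - ∫ x in U, g x i * φ x

/-- The Sobolev space `H¹(U)`: an element is a function `u ∈ L²(U)` together with its weak
gradient `∇u ∈ L²(U; ℝⁿ)` (which is determined by `u` when `U` is open). The inherited norm is
`‖u‖² = ‖u‖²_{L²} + ‖∇u‖²_{L²}`. -/
def H1 {n : ℕ} (U : Set (Eu n)) : Submodule ℝ (L2Pair U) where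
  carrier := {p | HasWeakGradient p.fst p.snd}
  zero_mem' := by
    intro φ hφ i
    have h1 : ∫ x in U, (0 : Lp ℝ 2 (volume.restrict U)) x *
        fderiv ℝ φ x (EuclideanSpace.single i 1) = ∫ x in U, (0 : ℝ) := by
      refine integral_congr_ae ?_
      filter_upwards [Lp.coeFn_zero ℝ 2 (volume.restrict U)] with x hx
      rw [hx]; simp
    have h2 : ∫ x in U, (0 : Lp (Eu n) 2 (volume.restrict U)) x i * φ x
        = ∫ x in U, (0 : ℝ) := by
      refine integral_congr_ae ?_
      filter_upwards [Lp.coeFn_zero (Eu n) 2 (volume.restrict U)] with x hx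
      rw [hx]; simp
    change ∫ x in U, (0 : Lp ℝ 2 (volume.restrict U)) x * _ =
      - ∫ x in U, (0 : Lp (Eu n) 2 (volume.restrict U)) x i * φ x
    rw [h1, h2]; simp
  add_mem' := by
    intro p q hp hq φ hφ i
    have h1 : ∫ x in U, (p.fst + q.fst : Lp ℝ 2 (volume.restrict U)) x *
        fderiv ℝ φ x (EuclideanSpace.single i 1) =
        ∫ x in U, (p.fst x * fderiv ℝ φ x (EuclideanSpace.single i 1) +
          q.fst x * fderiv ℝ φ x (EuclideanSpace.single i 1)) := by
      refine integral_congr_ae ?_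
      filter_upwards [Lp.coeFn_add p.fst q.fst] with x hx
      rw [hx]; simp [add_mul]
    have h2 : ∫ x in U, (p.snd + q.snd : Lp (Eu n) 2 (volume.restrict U)) x i * φ x
        = ∫ x in U, (p.snd x i * φ x + q.snd x i * φ x) := by
      refine integral_congr_ae ?_
      filter_upwards [Lp.coeFn_add p.snd q.snd] with x hx
      rw [hx]; simp [add_mul]
    change ∫ x in U, (p.fst + q.fst : Lp ℝ 2 (volume.restrict U)) x * _ =
      - ∫ x in U, (p.snd + q.snd : Lp (Eu n) 2 (volume.restrict U)) x i * φ x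
    rw [h1, h2, integral_add, integral_add, hp φ hφ i, hq φ hφ i]
    · ring
    · exact (memLp_coord p.snd i).integrable_mul hφ.memLp
    · exact (memLp_coord q.snd i).integrable_mul hφ.memLp
    · exact (Lp.memLp p.fst).integrable_mul (hφ.memLp_deriv _)
    · exact (Lp.memLp q.fst).integrable_mul (hφ.memLp_deriv _)
  smul_mem' := by
    intro c p hp φ hφ i
    have h1 : ∫ x in U, (c • p.fst : Lp ℝ 2 (volume.restrict U)) x *
        fderiv ℝ φ x (EuclideanSpace.single i 1) =
        ∫ x in U, c * (p.fst x * fderiv ℝ φ x (EuclideanSpace.single i 1)) := by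
      refine integral_congr_ae ?_
      filter_upwards [Lp.coeFn_smul c p.fst] with x hx
      rw [hx]; simp [mul_assoc]
    have h2 : ∫ x in U, (c • p.snd : Lp (Eu n) 2 (volume.restrict U)) x i * φ x
        = ∫ x in U, c * (p.snd x i * φ x) := by
      refine integral_congr_ae ?_
      filter_upwards [Lp.coeFn_smul c p.snd] with x hx
      rw [hx]; simp [mul_assoc]
    change ∫ x in U, (c • p.fst : Lp ℝ 2 (volume.restrict U)) x * _ =
      - ∫ x in U, (c • p.snd : Lp (Eu n) 2 (volume.restrict U)) x i * φ x
    rw [h1, h2, integral_const_mul, integral_const_mul, hp φ hφ i]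
    ring

/-- The underlying `L²` function of an element of `H¹(U)`. -/
abbrev fn {n : ℕ} {U : Set (Eu n)} (u : H1 U) : Lp ℝ 2 (volume.restrict U) :=
  (u : L2Pair U).fst

/-- The weak gradient of an element of `H¹(U)`. -/
abbrev grad {n : ℕ} {U : Set (Eu n)} (u : H1 U) : Lp (Eu n) 2 (volume.restrict U) :=
  (u : L2Pair U).snd

theorem ae_univ {n : ℕ} {p : Eu n → Prop}
    (h : ∀ᵐ x ∂(volume.restrict (univ : Set (Eu n))), p x) : ∀ᵐ x ∂volume, p x :=
  h.filter_mono (by rw [Measure.restrict_univ])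

theorem fn_zero_ae {n : ℕ} : ∀ᵐ x ∂volume, fn (0 : H1 (univ : Set (Eu n))) x = 0 :=
  ae_univ (Lp.coeFn_zero ℝ 2 (volume.restrict (univ : Set (Eu n))))

theorem fn_add_ae {n : ℕ} (v w : H1 (univ : Set (Eu n))) :
    ∀ᵐ x ∂volume, fn (v + w) x = fn v x + fn w x :=
  ae_univ (Lp.coeFn_add (fn v) (fn w))

theorem fn_smul_ae {n : ℕ} (c : ℝ) (w : H1 (univ : Set (Eu n))) :
    ∀ᵐ x ∂volume, fn (c • w) x = c * fn w x :=
  ae_univ (Lp.coeFn_smul c (fn w))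

/-! ### Capacity -/

/-- `w ∈ H¹(ℝⁿ)` is a competitor for the capacity of `A`: `w ≥ 0` a.e. on `ℝⁿ` and
`w ≥ 1` a.e. on an open neighbourhood of `A`. -/
def IsCapCompetitor {n : ℕ} (A : Set (Eu n)) (w : H1 (univ : Set (Eu n))) : Prop :=
  (∀ᵐ x ∂volume, 0 ≤ fn w x) ∧
    ∃ G : Set (Eu n), IsOpen G ∧ A ⊆ G ∧ ∀ᵐ x ∂volume, x ∈ G → 1 ≤ fn w x

/-- The capacity of `A ⊆ ℝⁿ` with respect to `H¹(ℝⁿ)`, the infimum of `‖w‖²_{H¹(ℝⁿ)}` over the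
competitors (`∞` if there is none). Since truncation at `0` does not increase the norm, the
restriction to `w ≥ 0` does not change the value. -/
def capacity {n : ℕ} (A : Set (Eu n)) : ℝ≥0∞ :=
  ⨅ (w : H1 (univ : Set (Eu n))) (_ : IsCapCompetitor A w), ENNReal.ofReal (‖w‖ ^ 2)

theorem capacity_mono {n : ℕ} {A B : Set (Eu n)} (h : A ⊆ B) : capacity A ≤ capacity B := by
  refine le_iInf₂ fun w hw => iInf₂_le w ?_
  obtain ⟨h0, G, hG, hBG, h1⟩ := hw
  exact ⟨h0, G, hG, h.trans hBG, h1⟩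

theorem capacity_empty {n : ℕ} : capacity (∅ : Set (Eu n)) = 0 := by
  refine le_antisymm ((iInf₂_le (0 : H1 (univ : Set (Eu n))) ?_).trans (by simp)) zero_le
  refine ⟨?_, ∅, isOpen_empty, subset_rfl, by simp⟩
  filter_upwards [fn_zero_ae] with x hx
  exact hx.ge

theorem capacity_union_le {n : ℕ} (A B : Set (Eu n)) :
    capacity (A ∪ B) ≤ 2 * capacity A + 2 * capacity B := by
  have key : ∀ v, IsCapCompetitor A v → ∀ w, IsCapCompetitor B w →
      capacity (A ∪ B) ≤ 2 * ENNReal.ofReal (‖v‖ ^ 2) + 2 * ENNReal.ofReal (‖w‖ ^ 2) := by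
    rintro v ⟨hv0, G, hG, hAG, hv1⟩ w ⟨hw0, G', hG', hBG', hw1⟩
    have hadd := fn_add_ae v w
    have hc : IsCapCompetitor (A ∪ B) (v + w) := by
      refine ⟨?_, G ∪ G', hG.union hG', union_subset_union hAG hBG', ?_⟩
      · filter_upwards [hadd, hv0, hw0] with x hx h1 h2
        rw [hx]; exact add_nonneg h1 h2
      · filter_upwards [hadd, hv0, hw0, hv1, hw1] with x hx h1 h2 h3 h4 hxG
        rw [hx]
        rcases hxG with hxG | hxG
        · linarith [h3 hxG]
        · linarith [h4 hxG]
    refine (iInf₂_le (v + w) hc).trans ?_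
    have h2 : ∀ r : ℝ, 2 * ENNReal.ofReal r = ENNReal.ofReal (2 * r) := fun r => by
      rw [ENNReal.ofReal_mul (by norm_num)]; simp
    rw [h2, h2, ← ENNReal.ofReal_add (by positivity) (by positivity)]
    refine ENNReal.ofReal_le_ofReal ?_
    have := norm_add_le v w
    nlinarith [sq_nonneg (‖v‖ - ‖w‖), norm_nonneg (v + w), norm_nonneg v, norm_nonneg w]
  refine le_of_forall_gt fun c hc => ?_
  obtain ⟨a, ha⟩ : ∃ a, a = capacity A := ⟨_, rfl⟩
  obtain ⟨b, hb⟩ : ∃ b, b = capacity B := ⟨_, rfl⟩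
  rw [← ha, ← hb] at hc
  have ha' : a ≠ ⊤ := by rintro rfl; simp at hc
  have hb' : b ≠ ⊤ := by rintro rfl; simp at hc
  have hT : Filter.Tendsto (fun ε : ℝ≥0∞ => 2 * (a + ε) + 2 * (b + ε)) (nhds 0)
      (nhds (2 * (a + 0) + 2 * (b + 0))) := by
    have : Continuous (fun ε : ℝ≥0∞ => 2 * (a + ε) + 2 * (b + ε)) := by
      refine Continuous.add ?_ ?_ <;>
        exact (ENNReal.continuous_const_mul (by simp)).comp (continuous_const.add continuous_id)
    exact this.tendsto 0
  simp only [add_zero] at hT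
  have hev := (hT.eventually (eventually_lt_nhds hc)).filter_mono
    (nhdsWithin_le_nhds (s := Ioi 0))
  obtain ⟨ε, hε, hεpos⟩ := (hev.and self_mem_nhdsWithin).exists
  have hεpos : ε ≠ 0 := (ne_of_gt hεpos)
  have hA : capacity A < a + ε := ha ▸ ENNReal.lt_add_right ha' hεpos
  have hB : capacity B < b + ε := hb ▸ ENNReal.lt_add_right hb' hεpos
  simp only [capacity, iInf_lt_iff] at hA hB
  obtain ⟨v, hv, hv'⟩ := hA
  obtain ⟨w, hw, hw'⟩ := hB
  exact (key v hv w hw).trans_lt (lt_of_le_of_lt (by gcongr) hε)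

/-- `f` is quasi-continuous on `ℝⁿ`: it is continuous off open sets of arbitrarily small
capacity. -/
def QuasiContinuous {n : ℕ} (f : Eu n → ℝ) : Prop :=
  ∀ ε : ℝ≥0∞, 0 < ε → ∃ G : Set (Eu n), IsOpen G ∧ capacity G < ε ∧ ContinuousOn f Gᶜ

theorem QuasiContinuous.add {n : ℕ} {f g : Eu n → ℝ} (hf : QuasiContinuous f)
    (hg : QuasiContinuous g) : QuasiContinuous (f + g) := by
  intro ε hε
  have h4 : 0 < ε / 4 := ENNReal.div_pos hε.ne' (by simp)
  obtain ⟨G, hG, hGε, hfG⟩ := hf (ε / 4) h4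
  obtain ⟨G', hG', hGε', hgG⟩ := hg (ε / 4) h4
  refine ⟨G ∪ G', hG.union hG', (capacity_union_le G G').trans_lt ?_,
    (hfG.mono (compl_subset_compl.2 subset_union_left)).add
      (hgG.mono (compl_subset_compl.2 subset_union_right))⟩
  have e : 2 * (ε / 4) + 2 * (ε / 4) = ε := by
    rw [← add_mul]
    norm_num
    exact ENNReal.mul_div_cancel (by simp) (by simp)
  calc 2 * capacity G + 2 * capacity G' < 2 * (ε / 4) + 2 * (ε / 4) :=
        ENNReal.add_lt_add ((ENNReal.mul_lt_mul_iff_right (by simp) (by simp)).2 hGε)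
          ((ENNReal.mul_lt_mul_iff_right (by simp) (by simp)).2 hGε')
    _ = ε := e

/-- `f` is a quasi-continuous representative of `w ∈ H¹(ℝⁿ)`. -/
def IsQuasiContRep {n : ℕ} (f : Eu n → ℝ) (w : H1 (univ : Set (Eu n))) : Prop :=
  QuasiContinuous f ∧ ∀ᵐ x ∂volume, f x = fn w x

/-! ### Admissible domains -/

/-- `T` is an extension operator `H¹(Ω) → H¹(ℝⁿ)` (linear and bounded by its type). -/
def IsExtensionOperator {n : ℕ} {Ω : Set (Eu n)}
    (T : H1 Ω →L[ℝ] H1 (univ : Set (Eu n))) : Prop :=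
  ∀ u : H1 Ω, ∀ᵐ x ∂(volume.restrict Ω), fn (T u) x = fn u x

/-- Admissible domains: bounded, non-empty, open and connected `H¹`-extension domains whose
boundary has positive capacity. -/
structure IsAdmissible {n : ℕ} (Ω : Set (Eu n)) : Prop where
  isOpen : IsOpen Ω
  isConnected : IsConnected Ω
  isBounded : Bornology.IsBounded Ω
  extension : ∃ T : H1 Ω →L[ℝ] H1 (univ : Set (Eu n)), IsExtensionOperator T
  capacity_pos : 0 < capacity (frontier Ω)

/-! ### The trace space and the trace operator -/

/-- The functions on `∂Ω` that vanish quasi-everywhere. -/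
def qeZero {n : ℕ} (Ω : Set (Eu n)) : Submodule ℝ (frontier Ω → ℝ) where
  carrier := {f | capacity (Subtype.val '' {x : frontier Ω | f x ≠ 0}) = 0}
  zero_mem' := by simp [capacity_empty]
  add_mem' := by
    intro f g hf hg
    have hs : Subtype.val '' {x : frontier Ω | (f + g) x ≠ 0} ⊆
        Subtype.val '' {x : frontier Ω | f x ≠ 0} ∪ Subtype.val '' {x : frontier Ω | g x ≠ 0} := by
      rw [← image_union]
      refine image_mono fun x hx => ?_
      by_contra hc
      simp only [mem_union, mem_ofPred_eq, not_or, not_not] at hc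
      exact hx (by simp [hc.1, hc.2])
    refine le_antisymm ((capacity_mono hs).trans ((capacity_union_le _ _).trans ?_)) zero_le
    rw [mem_ofPred_eq] at hf hg
    rw [hf, hg]; simp
  smul_mem' := by
    intro c f hf
    refine le_antisymm ((capacity_mono (image_mono fun x hx => ?_)).trans (le_of_eq hf)) zero_le
    rw [mem_ofPred_eq] at hx ⊢
    intro h0
    exact hx (by simp [h0])

/-- Quasi-everywhere equivalence classes of real functions on `∂Ω`. -/
abbrev QEClass {n : ℕ} (Ω : Set (Eu n)) : Type := (frontier Ω → ℝ) ⧸ qeZero Ω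

/-- The q.e. equivalence class of the pointwise restriction to `∂Ω`. -/
def restrictBoundary {n : ℕ} (Ω : Set (Eu n)) (f : Eu n → ℝ) : QEClass Ω :=
  Submodule.Quotient.mk (p := qeZero Ω) (fun x : frontier Ω => f x)

/-- The trace space `ℬ(∂Ω)`: the q.e. classes of the restrictions to `∂Ω` of quasi-continuous
representatives of elements of `H¹(ℝⁿ)`. -/
def TraceSpace {n : ℕ} (Ω : Set (Eu n)) : Submodule ℝ (QEClass Ω) where
  carrier := {c | ∃ w : H1 (univ : Set (Eu n)), ∃ f : Eu n → ℝ,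
    IsQuasiContRep f w ∧ restrictBoundary Ω f = c}
  zero_mem' := by
    refine ⟨0, 0, ⟨fun ε hε => ⟨∅, isOpen_empty, by simpa [capacity_empty] using hε,
      continuousOn_const⟩, ?_⟩, rfl⟩
    filter_upwards [fn_zero_ae] with x hx
    exact hx.symm
  add_mem' := by
    rintro _ _ ⟨v, f, ⟨hf, hfv⟩, rfl⟩ ⟨w, g, ⟨hg, hgw⟩, rfl⟩
    refine ⟨v + w, f + g, ⟨hf.add hg, ?_⟩, rfl⟩
    filter_upwards [fn_add_ae v w, hfv, hgw] with x hx h1 h2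
    rw [hx, Pi.add_apply, h1, h2]
  smul_mem' := by
    rintro c _ ⟨w, f, ⟨hf, hfw⟩, rfl⟩
    refine ⟨c • w, c • f, ⟨fun ε hε => ?_, ?_⟩, rfl⟩
    · obtain ⟨G, hG, hGε, hc⟩ := hf ε hε
      exact ⟨G, hG, hGε, hc.const_smul c⟩
    · filter_upwards [fn_smul_ae c w, hfw] with x hx h1
      rw [hx, Pi.smul_apply, smul_eq_mul, h1]

open Classical in
/-- The trace operator `Tr : H¹(Ω) → ℬ(∂Ω)` built on the extension operator `T`: the class on `∂Ω`
of a quasi-continuous representative of `T u`. -/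
def trace {n : ℕ} {Ω : Set (Eu n)} (T : H1 Ω →L[ℝ] H1 (univ : Set (Eu n)))
    (u : H1 Ω) : TraceSpace Ω :=
  if h : ∃ f : Eu n → ℝ, IsQuasiContRep f (T u) then
    ⟨restrictBoundary Ω h.choose, T u, h.choose, h.choose_spec, rfl⟩
  else 0

/-- The norm of `ℬ(∂Ω)`: `‖f‖ = inf {‖v‖_{H¹(Ω)} | Tr v = f}`. -/
def traceNorm {n : ℕ} {Ω : Set (Eu n)} (T : H1 Ω →L[ℝ] H1 (univ : Set (Eu n)))
    (f : TraceSpace Ω) : ℝ :=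
  sInf {r : ℝ | ∃ v : H1 Ω, trace T v = f ∧ r = ‖v‖}

/-- The dual `ℬ'(∂Ω)`: the linear functionals on `ℬ(∂Ω)` that are bounded for `traceNorm`. -/
def TraceDual {n : ℕ} {Ω : Set (Eu n)} (T : H1 Ω →L[ℝ] H1 (univ : Set (Eu n))) :
    Submodule ℝ (Module.Dual ℝ (TraceSpace Ω)) where
  carrier := {ψ | ∃ C : ℝ, ∀ f, |ψ f| ≤ C * traceNorm T f}
  zero_mem' := ⟨0, fun f => by simp⟩
  add_mem' := by
    rintro ψ χ ⟨C, hC⟩ ⟨D, hD⟩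
    refine ⟨C + D, fun f => ?_⟩
    rw [LinearMap.add_apply, add_mul]
    exact (abs_add_le _ _).trans (add_le_add (hC f) (hD f))
  smul_mem' := by
    rintro c ψ ⟨C, hC⟩
    refine ⟨|c| * C, fun f => ?_⟩
    rw [LinearMap.smul_apply, smul_eq_mul, abs_mul, mul_assoc]
    exact mul_le_mul_of_nonneg_left (hC f) (abs_nonneg c)

/-- The duality pairing between `ℬ'(∂Ω)` and `ℬ(∂Ω)`. -/
def pairing {n : ℕ} {Ω : Set (Eu n)} {T : H1 Ω →L[ℝ] H1 (univ : Set (Eu n))}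
    (ψ : TraceDual T) (f : TraceSpace Ω) : ℝ :=
  (ψ : Module.Dual ℝ (TraceSpace Ω)) f

/-- The norm of `ℬ'(∂Ω)` subordinate to `traceNorm`. -/
def traceDualNorm {n : ℕ} {Ω : Set (Eu n)} {T : H1 Ω →L[ℝ] H1 (univ : Set (Eu n))}
    (ψ : TraceDual T) : ℝ :=
  sInf {C : ℝ | 0 ≤ C ∧ ∀ f, |pairing ψ f| ≤ C * traceNorm T f}

/-! ### Conductivities and the Poincaré–Steklov operator -/

/-- The class `𝒯(Ω)` of conductivities: `γ ∈ L^∞(Ω)`, bounded below by a positive constant almost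
everywhere, and (almost everywhere equal to a function which is) continuous on `Ω ∩ W` for some
open neighbourhood `W` of `∂Ω`. -/
structure IsConductivity {n : ℕ} (Ω : Set (Eu n)) (γ : Eu n → ℝ) : Prop where
  memLp_top : MemLp γ ∞ (volume.restrict Ω)
  pos : ∃ c : ℝ, 0 < c ∧ ∀ᵐ x ∂(volume.restrict Ω), c ≤ γ x
  continuous_near : ∃ W : Set (Eu n), IsOpen W ∧ frontier Ω ⊆ W ∧
    ∃ γ' : Eu n → ℝ, (∀ᵐ x ∂(volume.restrict (Ω ∩ W)), γ' x = γ x) ∧ ContinuousOn γ' (Ω ∩ W)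

/-- `∇ · (γ ∇u) = 0` weakly on `Ω`. -/
def IsWeakSolution {n : ℕ} {Ω : Set (Eu n)} (γ : Eu n → ℝ) (u : H1 Ω) : Prop :=
  ∀ φ : Eu n → ℝ, IsTest Ω φ → ∫ x in Ω, γ x * inner ℝ (grad u x) (gradient φ x) = 0

/-- `ψ ∈ ℬ'(∂Ω)` is the weak conormal derivative `γ ∂u/∂ν` on `∂Ω` of a solution `u` of
`∇ · (γ ∇u) = 0`, defined through Green's formula. -/
def IsConormalDerivative {n : ℕ} {Ω : Set (Eu n)} (T : H1 Ω →L[ℝ] H1 (univ : Set (Eu n)))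
    (γ : Eu n → ℝ) (u : H1 Ω) (ψ : TraceDual T) : Prop :=
  ∀ v : H1 Ω, pairing ψ (trace T v) = ∫ x in Ω, γ x * inner ℝ (grad u x) (grad v x)

open Classical in
/-- The Poincaré–Steklov operator `Λ^γ : ℬ(∂Ω) → ℬ'(∂Ω)`, `Tr u ↦ γ ∂u/∂ν`, where `u ∈ H¹(Ω)` solves
`∇ · (γ ∇u) = 0` weakly on `Ω`. -/
def poincareSteklov {n : ℕ} {Ω : Set (Eu n)} (T : H1 Ω →L[ℝ] H1 (univ : Set (Eu n)))
    (γ : Eu n → ℝ) (f : TraceSpace Ω) : TraceDual T :=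
  if h : ∃ ψ : TraceDual T, ∃ u : H1 Ω,
      IsWeakSolution γ u ∧ trace T u = f ∧ IsConormalDerivative T γ u ψ then
    h.choose
  else 0

end Steklov

end

open Steklov

noncomputable section

namespace Steklov

open Filter Topology

variable {n : ℕ}

/-! ### Square-integrable functions -/

/-! Everything rests on one fact about the trace: it is linear, surjective onto `TraceSpace Ω`, and
its kernel is the closure `H10 Ω` of the test functions. Weak solutions are the `u` whose energy
form `E(u, ·) = ∫ γ ∇u · ∇(·)` vanishes on `H10 Ω` (`isWeakSolution_iff`). Friedrichs' inequality
makes `E` coercive there, so Lax–Milgram gives exactly one solution for each trace. For a solution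
`u`, `E(u, ·)` factors through the trace and is the conormal derivative. Hence `⟨Λ Tr u, Tr v⟩ =
E(u, v)` (`pairing_poincareSteklov`); symmetry of `E` gives self-adjointness, and linearity,
boundedness and the identity in (ii) follow.

The hard point is that the trace does not depend on the chosen extension: a function of `H¹(ℝⁿ)`
that vanishes on `Ω` has a quasi-continuous representative that vanishes quasi-everywhere on `∂Ω`
(`capacity_frontier_ne_zero_eq_zero`). This comes from the measure density of extension domains, `|Ω
∩ B(x, r)| ≥ c rⁿ` for `x` in the closure and `r ≤ 1` (`exists_ballMeas_ge`). Extending a cutoff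
function from `Ω` to `ℝⁿ` bounds its energy by the measure of `Ω` in a ball; an inequality of
Poincaré type, proved by mollification, turns this into a De Giorgi iteration that would force `Ω`
to be null near `x` if the density were too small. With density at hand, mollifications of a
function which is at most `1` and vanishes on `Ω` stay away from `1` at boundary points, while they
converge quasi-everywhere to the quasi-continuous representative.

Test functions have zero trace because quasi-everywhere limits retain zeros
(`trace_eq_zero_of_mem_h10`). Conversely, a function vanishing quasi-everywhere on `∂Ω` is truncated
near `0` and near infinity and multiplied by `1 - S(e)`, where `S` is the smooth transition function
and `e` is a small competitor for the capacity of the bad set. The product vanishes off a compact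
subset of `Ω`, and mollification gives test functions (`restrictH1_mem_h10`). -/

theorem _root_.MeasureTheory.MemLp.integrable_norm_sq {α E : Type*} [MeasurableSpace α]
    {μ : Measure α} [NormedAddCommGroup E] {f : α → E} (hf : MemLp f 2 μ) :
    Integrable (fun x => ‖f x‖ ^ 2) μ :=
  (memLp_two_iff_integrable_sq_norm hf.1).1 hf

section L2

variable {α E : Type*} [MeasurableSpace α] {μ : Measure α} [NormedAddCommGroup E]
  [InnerProductSpace ℝ E]

theorem norm_sq_lp_eq_integral (f : Lp E 2 μ) : ‖f‖ ^ 2 = ∫ x, ‖f x‖ ^ 2 ∂μ := by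
  rw [← real_inner_self_eq_norm_sq, L2.inner_def]
  simp only [real_inner_self_eq_norm_sq]

theorem eLpNorm_two_toReal_sq {f : α → E} (hf : MemLp f 2 μ) :
    (eLpNorm f 2 μ).toReal ^ 2 = ∫ x, ‖f x‖ ^ 2 ∂μ := by
  rw [← Lp.norm_toLp f hf, norm_sq_lp_eq_integral]
  refine integral_congr_ae ?_
  filter_upwards [hf.coeFn_toLp] with x hx
  rw [hx]

theorem continuous_integral_inner {g : α → E} (hg : MemLp g 2 μ) :
    Continuous fun f : Lp E 2 μ => ∫ x, inner ℝ (g x) (f x) ∂μ := by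
  have : (fun f : Lp E 2 μ => ∫ x, inner ℝ (g x) (f x) ∂μ) =
      fun f : Lp E 2 μ => inner ℝ (hg.toLp g) f := by
    funext f
    rw [L2.inner_def]
    refine integral_congr_ae ?_
    filter_upwards [hg.coeFn_toLp] with x hx
    rw [hx]
  rw [this]
  exact continuous_const.inner continuous_id

end L2

/-! ### Functions with a square-integrable weak gradient -/

variable {U : Set (Eu n)}

/-- `u ∈ L²(U)` has the weak gradient `g ∈ L²(U; ℝⁿ)`, for functions instead of classes. -/
structure HasL2Gradient (U : Set (Eu n)) (u : Eu n → ℝ) (g : Eu n → Eu n) : Prop where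
  memLp : MemLp u 2 (volume.restrict U)
  memLp_grad : MemLp g 2 (volume.restrict U)
  parts : ∀ φ : Eu n → ℝ, IsTest U φ → ∀ i : Fin n,
    ∫ x in U, u x * fderiv ℝ φ x (EuclideanSpace.single i 1) = - ∫ x in U, g x i * φ x

namespace HasL2Gradient

variable {u v : Eu n → ℝ} {g k : Eu n → Eu n}

/-- The element of `H¹(U)` given by a function and its weak gradient. -/
def toH1 (h : HasL2Gradient U u g) : H1 U :=
  ⟨WithLp.toLp 2 (h.memLp.toLp u, h.memLp_grad.toLp g), by
    intro φ hφ i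
    have h1 : ∫ x in U, (h.memLp.toLp u) x * fderiv ℝ φ x (EuclideanSpace.single i 1) =
        ∫ x in U, u x * fderiv ℝ φ x (EuclideanSpace.single i 1) := by
      refine integral_congr_ae ?_
      filter_upwards [h.memLp.coeFn_toLp] with x hx
      rw [hx]
    have h2 : ∫ x in U, (h.memLp_grad.toLp g) x i * φ x = ∫ x in U, g x i * φ x := by
      refine integral_congr_ae ?_
      filter_upwards [h.memLp_grad.coeFn_toLp] with x hx
      rw [hx]
    exact h1.trans ((h.parts φ hφ i).trans (congrArg Neg.neg h2.symm))⟩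

theorem fn_toH1 (h : HasL2Gradient U u g) : fn h.toH1 =ᵐ[volume.restrict U] u :=
  h.memLp.coeFn_toLp

theorem grad_toH1 (h : HasL2Gradient U u g) : grad h.toH1 =ᵐ[volume.restrict U] g :=
  h.memLp_grad.coeFn_toLp

theorem congr (h : HasL2Gradient U u g) (hu : u =ᵐ[volume.restrict U] v)
    (hg : g =ᵐ[volume.restrict U] k) : HasL2Gradient U v k where
  memLp := h.memLp.ae_eq hu
  memLp_grad := h.memLp_grad.ae_eq hg
  parts φ hφ i := by
    have h1 : ∫ x in U, v x * fderiv ℝ φ x (EuclideanSpace.single i 1) =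
        ∫ x in U, u x * fderiv ℝ φ x (EuclideanSpace.single i 1) := by
      refine integral_congr_ae ?_
      filter_upwards [hu] with x hx
      rw [hx]
    have h2 : ∫ x in U, k x i * φ x = ∫ x in U, g x i * φ x := by
      refine integral_congr_ae ?_
      filter_upwards [hg] with x hx
      rw [hx]
    rw [h1, h2, h.parts φ hφ i]

theorem mono {V : Set (Eu n)} (hV : MeasurableSet V) (hUV : U ⊆ V) (h : HasL2Gradient V u g) :
    HasL2Gradient U u g where
  memLp := h.memLp.mono_measure (Measure.restrict_mono_set _ hUV)
  memLp_grad := h.memLp_grad.mono_measure (Measure.restrict_mono_set _ hUV)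
  parts φ hφ i := by
    have hz : ∀ x, x ∉ U → φ x = 0 := fun x hx =>
      image_eq_zero_of_notMem_tsupport fun hx' => hx (hφ.supp hx')
    have hz' : ∀ x, x ∉ U → fderiv ℝ φ x = 0 := fun x hx =>
      image_eq_zero_of_notMem_tsupport fun hx' => hx (hφ.supp (tsupport_fderiv_subset ℝ hx'))
    have h1 := h.parts φ ⟨hφ.smooth, hφ.compact, hφ.supp.trans hUV⟩ i
    rw [setIntegral_eq_of_subset_of_forall_sdiff_eq_zero hV hUV,
      setIntegral_eq_of_subset_of_forall_sdiff_eq_zero hV hUV] at h1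
    · exact h1
    · intro x hx; simp [hz x hx.2]
    · intro x hx; simp [hz' x hx.2]

end HasL2Gradient

theorem hasL2Gradient (w : H1 U) : HasL2Gradient U (fn w) (grad w) :=
  ⟨Lp.memLp _, Lp.memLp _, w.2⟩

theorem h1_ext {v w : H1 U} (h1 : fn v =ᵐ[volume.restrict U] fn w)
    (h2 : grad v =ᵐ[volume.restrict U] grad w) : v = w := by
  refine Subtype.ext ?_
  refine (WithLp.equiv 2 _).injective ?_
  exact Prod.ext (Lp.ext h1) (Lp.ext h2)

theorem h1_norm_sq (w : H1 U) : ‖w‖ ^ 2 = ‖fn w‖ ^ 2 + ‖grad w‖ ^ 2 :=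
  WithLp.prod_norm_sq_eq_of_L2 (w : L2Pair U)

theorem h1_norm_sq_integral (w : H1 U) :
    ‖w‖ ^ 2 = (∫ x in U, ‖fn w x‖ ^ 2) + ∫ x in U, ‖grad w x‖ ^ 2 := by
  rw [h1_norm_sq, norm_sq_lp_eq_integral, norm_sq_lp_eq_integral]

theorem HasL2Gradient.norm_sq_toH1 {u : Eu n → ℝ} {g : Eu n → Eu n} (h : HasL2Gradient U u g) :
    ‖h.toH1‖ ^ 2 = (∫ x in U, ‖u x‖ ^ 2) + ∫ x in U, ‖g x‖ ^ 2 := by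
  rw [h1_norm_sq_integral]
  congr 1 <;> refine integral_congr_ae ?_
  · filter_upwards [h.fn_toH1] with x hx
    rw [hx]
  · filter_upwards [h.grad_toH1] with x hx
    rw [hx]

theorem norm_fn_le (w : H1 U) : ‖fn w‖ ≤ ‖w‖ := by
  refine le_of_sq_le_sq ?_ (norm_nonneg _)
  rw [h1_norm_sq]; nlinarith [sq_nonneg ‖grad w‖]

theorem norm_grad_le (w : H1 U) : ‖grad w‖ ≤ ‖w‖ := by
  refine le_of_sq_le_sq ?_ (norm_nonneg _)
  rw [h1_norm_sq]; nlinarith [sq_nonneg ‖fn w‖]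

theorem coeFn_fn_add (v w : H1 U) : fn (v + w) =ᵐ[volume.restrict U] fun x => fn v x + fn w x :=
  Lp.coeFn_add (fn v) (fn w)

theorem coeFn_fn_sub (v w : H1 U) : fn (v - w) =ᵐ[volume.restrict U] fun x => fn v x - fn w x :=
  Lp.coeFn_sub (fn v) (fn w)

theorem coeFn_fn_smul (c : ℝ) (v : H1 U) : fn (c • v) =ᵐ[volume.restrict U] fun x => c * fn v x :=
  Lp.coeFn_smul c (fn v)

theorem coeFn_grad_add (v w : H1 U) :
    grad (v + w) =ᵐ[volume.restrict U] fun x => grad v x + grad w x :=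
  Lp.coeFn_add (grad v) (grad w)

theorem coeFn_grad_sub (v w : H1 U) :
    grad (v - w) =ᵐ[volume.restrict U] fun x => grad v x - grad w x :=
  Lp.coeFn_sub (grad v) (grad w)

theorem coeFn_grad_smul (c : ℝ) (v : H1 U) :
    grad (c • v) =ᵐ[volume.restrict U] fun x => c • grad v x :=
  Lp.coeFn_smul c (grad v)

theorem continuous_fn : Continuous (fun w : H1 U => fn w) :=
  (LipschitzWith.of_dist_le_mul (K := 1) fun v w => by
    rw [dist_eq_norm, dist_eq_norm, NNReal.coe_one, one_mul]
    exact norm_fn_le (v - w)).continuous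

theorem continuous_grad : Continuous (fun w : H1 U => grad w) :=
  (LipschitzWith.of_dist_le_mul (K := 1) fun v w => by
    rw [dist_eq_norm, dist_eq_norm, NNReal.coe_one, one_mul]
    exact norm_grad_le (v - w)).continuous

/-- Each equation that defines a weak gradient pairs an `L²` class with a fixed `L²` function, so it
is a closed condition. Completeness of `H1 U` follows, as does the stability of weak gradients under
`L²` limits. -/
theorem isClosed_h1 : IsClosed (H1 U : Set (L2Pair U)) := by
  have : (H1 U : Set (L2Pair U)) = ⋂ (φ : Eu n → ℝ) (_ : IsTest U φ) (i : Fin n),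
      {p : L2Pair U | ∫ x in U, p.fst x * fderiv ℝ φ x (EuclideanSpace.single i 1) =
        - ∫ x in U, p.snd x i * φ x} := by
    ext p
    simp only [mem_iInter]
    rfl
  rw [this]
  refine isClosed_iInter fun φ => isClosed_iInter fun hφ => isClosed_iInter fun i => ?_
  have c1 : Continuous fun p : L2Pair U => p.fst := by fun_prop
  have c2 : Continuous fun p : L2Pair U => p.snd := by fun_prop
  refine isClosed_eq ?_ (Continuous.neg ?_)
  · have := (continuous_integral_inner (hφ.memLp_deriv (EuclideanSpace.single i 1))).comp c1
    simpa [Function.comp_def] using this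
  · have hm : MemLp (fun x => φ x • (EuclideanSpace.single i (1 : ℝ) : Eu n)) 2
        (volume.restrict U) :=
      hφ.memLp.continuousLinearMap_comp
        ((ContinuousLinearMap.id ℝ ℝ).smulRight (EuclideanSpace.single i (1 : ℝ) : Eu n))
    have := (continuous_integral_inner hm).comp c2
    simpa [Function.comp_def, real_inner_smul_left, EuclideanSpace.inner_single_left, mul_comm]
      using this

instance : CompleteSpace (H1 U) := isClosed_h1.completeSpace_coe

/-- Weak gradients on open sets are unique. -/
theorem grad_ae_eq_of_fn_ae_eq (hU : IsOpen U) {v w : H1 U}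
    (h : fn v =ᵐ[volume.restrict U] fn w) : grad v =ᵐ[volume.restrict U] grad w := by
  have key : ∀ i : Fin n, ∀ᵐ x ∂volume, x ∈ U → grad v x i - grad w x i = 0 := by
    intro i
    have m : MemLp (fun x => grad v x i - grad w x i) 2 (volume.restrict U) :=
      (memLp_coord (grad v) i).sub (memLp_coord (grad w) i)
    refine hU.ae_eq_zero_of_integral_contDiff_smul_eq_zero
      (f := fun x => grad v x i - grad w x i) ?_ ?_
    · exact locallyIntegrableOn_of_locallyIntegrable_restrict (m.locallyIntegrable (by norm_num))
    · intro φ h1 h2 h3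
      have hφ : IsTest U φ := ⟨h1, h2, h3⟩
      rw [← setIntegral_eq_integral_of_forall_compl_eq_zero (s := U)]
      · have e1 := v.2 φ hφ i
        have e2 := w.2 φ hφ i
        have e3 : ∫ x in U, fn v x * fderiv ℝ φ x (EuclideanSpace.single i 1) =
            ∫ x in U, fn w x * fderiv ℝ φ x (EuclideanSpace.single i 1) := by
          refine integral_congr_ae ?_
          filter_upwards [h] with x hx
          rw [hx]
        have e4 : ∫ x in U, φ x • (grad v x i - grad w x i) =
            (∫ x in U, grad v x i * φ x) - ∫ x in U, grad w x i * φ x := by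
          rw [← integral_sub]
          · refine integral_congr_ae (ae_of_all _ fun x => ?_)
            simp only [smul_eq_mul]; ring
          · exact (memLp_coord (grad v) i).integrable_mul hφ.memLp
          · exact (memLp_coord (grad w) i).integrable_mul hφ.memLp
        rw [e4]
        linarith
      · intro x hx
        rw [image_eq_zero_of_notMem_tsupport fun hx' => hx (h3 hx'), zero_smul]
  rw [EventuallyEq, ae_restrict_iff' hU.measurableSet]
  filter_upwards [ae_all_iff.2 key] with x hx hxU
  ext i
  have := hx i hxU
  linarith

theorem h1_ext_of_isOpen (hU : IsOpen U) {v w : H1 U}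
    (h : fn v =ᵐ[volume.restrict U] fn w) : v = w :=
  h1_ext h (grad_ae_eq_of_fn_ae_eq hU h)

/-! ### Classically differentiable functions as elements of `H¹(U)`. -/

theorem gradient_coord (φ : Eu n → ℝ) (x : Eu n) (i : Fin n) :
    gradient φ x i = fderiv ℝ φ x (EuclideanSpace.single i 1) := by
  rw [← inner_gradient_left, EuclideanSpace.inner_single_right]
  simp

theorem continuous_gradient {φ : Eu n → ℝ} (h : ContDiff ℝ 1 φ) : Continuous (gradient φ) :=
  (InnerProductSpace.toDual ℝ (Eu n)).symm.continuous.comp (h.continuous_fderiv one_ne_zero)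

theorem norm_gradient (φ : Eu n → ℝ) (x : Eu n) : ‖gradient φ x‖ = ‖fderiv ℝ φ x‖ :=
  LinearIsometryEquiv.norm_map _ _

/-- A `C¹` function with square-integrable value and gradient belongs to `H¹(U)`. -/
theorem hasL2Gradient_of_contDiff {φ : Eu n → ℝ} (h : ContDiff ℝ 1 φ)
    (h0 : MemLp φ 2 (volume.restrict U)) (h1 : MemLp (gradient φ) 2 (volume.restrict U)) :
    HasL2Gradient U φ (gradient φ) where
  memLp := h0
  memLp_grad := h1
  parts ψ hψ i := by
    have hz : ∀ x, x ∉ U → ψ x = 0 := fun x hx =>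
      image_eq_zero_of_notMem_tsupport fun hx' => hx (hψ.supp hx')
    have hz' : ∀ x, x ∉ U → fderiv ℝ ψ x = 0 := fun x hx =>
      image_eq_zero_of_notMem_tsupport fun hx' => hx (hψ.supp (tsupport_fderiv_subset ℝ hx'))
    rw [setIntegral_eq_integral_of_forall_compl_eq_zero (fun x hx => by simp [hz' x hx]),
      setIntegral_eq_integral_of_forall_compl_eq_zero (fun x hx => by simp [hz x hx])]
    simp only [gradient_coord]
    have c1 := h.continuous
    have c2 : Continuous (fun x => fderiv ℝ φ x (EuclideanSpace.single i 1)) :=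
      (h.continuous_fderiv one_ne_zero).clm_apply continuous_const
    have c3 : Continuous (fun x => fderiv ℝ ψ x (EuclideanSpace.single i 1)) :=
      (hψ.smooth.continuous_fderiv (by simp)).clm_apply continuous_const
    have s3 := hψ.compact.fderiv_apply ℝ (EuclideanSpace.single i 1)
    refine integral_mul_fderiv_eq_neg_fderiv_mul_of_integrable ?_ ?_ ?_
      (fun x _ => h.differentiable one_ne_zero x)
      (fun x _ => hψ.smooth.differentiable (by simp) x)
    · exact (c2.mul hψ.smooth.continuous).integrable_of_hasCompactSupport hψ.compact.mul_left
    · exact (c1.mul c3).integrable_of_hasCompactSupport s3.mul_left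
    · exact (c1.mul hψ.smooth.continuous).integrable_of_hasCompactSupport hψ.compact.mul_left

theorem hasCompactSupport_gradient {φ : Eu n → ℝ} (h : HasCompactSupport φ) :
    HasCompactSupport (gradient φ) := by
  refine (h.fderiv ℝ).mono fun x hx => ?_
  rw [Function.mem_support] at hx ⊢
  rw [← norm_ne_zero_iff] at hx ⊢
  rwa [← norm_gradient]

theorem hasL2Gradient_of_hasCompactSupport {φ : Eu n → ℝ} (h : ContDiff ℝ 1 φ)
    (hc : HasCompactSupport φ) : HasL2Gradient U φ (gradient φ) :=
  hasL2Gradient_of_contDiff h (h.continuous.memLp_of_hasCompactSupport hc)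
    ((continuous_gradient h).memLp_of_hasCompactSupport (hasCompactSupport_gradient hc))

theorem IsTest.hasL2Gradient {V : Set (Eu n)} {φ : Eu n → ℝ} (h : IsTest V φ) :
    HasL2Gradient U φ (gradient φ) :=
  hasL2Gradient_of_hasCompactSupport (h.smooth.of_le (by simp)) h.compact

/-! ### Restriction -/

theorem ae_restrict_of_ae_univ {p : Eu n → Prop}
    (h : ∀ᵐ x ∂(volume.restrict (univ : Set (Eu n))), p x) : ∀ᵐ x ∂(volume.restrict U), p x :=
  ae_restrict_of_ae (ae_univ h)

/-- The restriction to `U` of a Sobolev function on `ℝⁿ`. -/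
def restrictFun (U : Set (Eu n)) (w : H1 (univ : Set (Eu n))) : H1 U :=
  ((hasL2Gradient w).mono MeasurableSet.univ (subset_univ U)).toH1

theorem fn_restrictFun (w : H1 (univ : Set (Eu n))) :
    fn (restrictFun U w) =ᵐ[volume.restrict U] fn w :=
  HasL2Gradient.fn_toH1 _

theorem grad_restrictFun (w : H1 (univ : Set (Eu n))) :
    grad (restrictFun U w) =ᵐ[volume.restrict U] grad w :=
  HasL2Gradient.grad_toH1 _

theorem norm_restrictFun_le (w : H1 (univ : Set (Eu n))) : ‖restrictFun U w‖ ≤ ‖w‖ := by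
  refine le_of_sq_le_sq ?_ (norm_nonneg _)
  rw [restrictFun, HasL2Gradient.norm_sq_toH1, h1_norm_sq_integral]
  refine add_le_add ?_ ?_
  · exact setIntegral_mono_set (hasL2Gradient w).memLp.integrable_norm_sq
      (ae_of_all _ fun x => by positivity) (ae_of_all _ fun x _ => mem_univ x)
  · exact setIntegral_mono_set (hasL2Gradient w).memLp_grad.integrable_norm_sq
      (ae_of_all _ fun x => by positivity) (ae_of_all _ fun x _ => mem_univ x)

theorem restrictFun_add (v w : H1 (univ : Set (Eu n))) :
    restrictFun U (v + w) = restrictFun U v + restrictFun U w := by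
  refine h1_ext ?_ ?_
  · filter_upwards [fn_restrictFun (U := U) v, fn_restrictFun (U := U) w,
      fn_restrictFun (U := U) (v + w), ae_restrict_of_ae_univ (coeFn_fn_add v w),
      coeFn_fn_add (restrictFun U v) (restrictFun U w)] with x h1 h2 h3 h4 h5
    rw [h3, h5, h1, h2, h4]
  · filter_upwards [grad_restrictFun (U := U) v, grad_restrictFun (U := U) w,
      grad_restrictFun (U := U) (v + w), ae_restrict_of_ae_univ (coeFn_grad_add v w),
      coeFn_grad_add (restrictFun U v) (restrictFun U w)] with x h1 h2 h3 h4 h5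
    rw [h3, h5, h1, h2, h4]

theorem restrictFun_smul (c : ℝ) (v : H1 (univ : Set (Eu n))) :
    restrictFun U (c • v) = c • restrictFun U v := by
  refine h1_ext ?_ ?_
  · filter_upwards [fn_restrictFun (U := U) v, fn_restrictFun (U := U) (c • v),
      ae_restrict_of_ae_univ (coeFn_fn_smul c v), coeFn_fn_smul c (restrictFun U v)]
      with x h1 h2 h3 h4
    rw [h2, h4, h1, h3]
  · filter_upwards [grad_restrictFun (U := U) v, grad_restrictFun (U := U) (c • v),
      ae_restrict_of_ae_univ (coeFn_grad_smul c v), coeFn_grad_smul c (restrictFun U v)]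
      with x h1 h2 h3 h4
    rw [h2, h4, h1, h3]

/-- Restriction of Sobolev functions from `ℝⁿ` to `U`. -/
def restrictH1 (U : Set (Eu n)) : H1 (univ : Set (Eu n)) →L[ℝ] H1 U :=
  LinearMap.mkContinuous
    { toFun := restrictFun U, map_add' := restrictFun_add, map_smul' := restrictFun_smul } 1
    fun w => (norm_restrictFun_le w).trans (one_mul _).ge

theorem fn_restrictH1 (w : H1 (univ : Set (Eu n))) :
    fn (restrictH1 U w) =ᵐ[volume.restrict U] fn w :=
  fn_restrictFun w

theorem grad_restrictH1 (w : H1 (univ : Set (Eu n))) :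
    grad (restrictH1 U w) =ᵐ[volume.restrict U] grad w :=
  grad_restrictFun w

/-! ### Mollification -/

/-- Jensen's inequality for the square: `L^p` norms increase with the exponent on a probability
space. -/
theorem lintegral_sq_le_of_isProbabilityMeasure {α : Type*} [MeasurableSpace α] {ν : Measure α}
    [IsProbabilityMeasure ν] {f : α → ℝ≥0∞} (hf : AEMeasurable f ν) :
    (∫⁻ x, f x ∂ν) ^ 2 ≤ ∫⁻ x, f x ^ 2 ∂ν := by
  have h := eLpNorm_le_eLpNorm_of_exponent_le (μ := ν) (f := f) (p := 1) (q := 2)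
    (by norm_num) hf.aestronglyMeasurable
  rw [eLpNorm_one_eq_lintegral_enorm,
    eLpNorm_eq_lintegral_rpow_enorm_toReal (by norm_num) (by norm_num)] at h
  simp only [enorm_eq_self, ENNReal.toReal_ofNat, ENNReal.rpow_ofNat] at h
  have h2 := pow_le_pow_left' h 2
  rwa [← ENNReal.rpow_natCast (_ ^ _), ← ENNReal.rpow_mul, Nat.cast_ofNat,
    one_div_mul_cancel (by norm_num), ENNReal.rpow_one] at h2

theorem eLpNorm_two_sq {α E : Type*} [MeasurableSpace α] {μ : Measure α} [NormedAddCommGroup E]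
    (f : α → E) : eLpNorm f 2 μ ^ 2 = ∫⁻ x, ‖f x‖ₑ ^ 2 ∂μ := by
  rw [eLpNorm_eq_lintegral_rpow_enorm_toReal (by norm_num) (by norm_num), ENNReal.toReal_ofNat,
    ← ENNReal.rpow_natCast (_ ^ _), ← ENNReal.rpow_mul, Nat.cast_ofNat,
    one_div_mul_cancel (by norm_num), ENNReal.rpow_one]
  simp

theorem memLp_translate {F : Type*} [NormedAddCommGroup F] {f : Eu n → F}
    (hf : MemLp f 2 volume) (y : Eu n) :
    MemLp (fun x => f (x - y)) 2 volume :=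
  hf.comp_measurePreserving (measurePreserving_sub_right volume y)

/-- Continuity of translations in `L²`, the source of the convergence of mollifications. -/
theorem tendsto_eLpNorm_translate_sub {F : Type*} [NormedAddCommGroup F] {f : Eu n → F}
    (hf : MemLp f 2 volume) :
    Tendsto (fun y => eLpNorm (fun x => f (x - y) - f x) 2 volume) (𝓝 0) (𝓝 0) := by
  have hc : Continuous fun p : Eu n × Eu n => p.2 - p.1 := by fun_prop
  let T : C(Eu n, C(Eu n, Eu n)) := (ContinuousMap.mk _ hc).curry
  have hT : ∀ y, MeasurePreserving (T y) (volume : Measure (Eu n)) volume :=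
    fun y => measurePreserving_sub_right volume y
  have h := (continuous_const (y := hf.toLp f)).compMeasurePreservingLp T.continuous hT
    (by norm_num)
  have h0 := h.tendsto 0
  have e : ∀ y, Lp.compMeasurePreserving (T y) (hT y) (hf.toLp f) =
      (memLp_translate hf y).toLp _ := fun y => Lp.toLp_compMeasurePreserving hf (hT y)
  simp only [e] at h0
  have h1 := (Lp.tendsto_Lp_iff_tendsto_eLpNorm'' (fun y x => f (x - y))
    (fun y => memLp_translate hf y) (fun x => f (x - 0)) (memLp_translate hf 0)).1 h0
  simpa [Pi.sub_def] using h1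

section Mollify

variable {F : Type*} [NormedAddCommGroup F] [NormedSpace ℝ F]

/-- The mollification of `f` by the normalised bump function `φ`. -/
def mollify (φ : ContDiffBump (0 : Eu n)) (f : Eu n → F) : Eu n → F :=
  convolution (φ.normed volume) f (ContinuousLinearMap.lsmul ℝ ℝ) volume

theorem mollify_apply (φ : ContDiffBump (0 : Eu n)) (f : Eu n → F) (x : Eu n) :
    mollify φ f x = ∫ y, φ.normed volume y • f (x - y) :=
  convolution_lsmul

theorem mollify_apply_swap (φ : ContDiffBump (0 : Eu n)) (f : Eu n → F) (x : Eu n) :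
    mollify φ f x = ∫ y, φ.normed volume (x - y) • f y := by
  rw [mollify, convolution_eq_swap]
  rfl

theorem mollify_congr (φ : ContDiffBump (0 : Eu n)) {f g : Eu n → F} (h : f =ᵐ[volume] g) :
    mollify φ f = mollify φ g :=
  convolution_congr _ (ae_eq_refl _) h

theorem integrable_mollify (φ : ContDiffBump (0 : Eu n)) {f : Eu n → F}
    (hf : LocallyIntegrable f volume) (x : Eu n) :
    Integrable fun y => φ.normed volume y • f (x - y) :=
  φ.hasCompactSupport_normed.convolutionExists_left (ContinuousLinearMap.lsmul ℝ ℝ)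
    φ.continuous_normed hf x

theorem contDiff_mollify (φ : ContDiffBump (0 : Eu n)) {f : Eu n → F}
    (hf : LocallyIntegrable f volume) : ContDiff ℝ ∞ (mollify φ f) :=
  φ.hasCompactSupport_normed.contDiff_convolution_left _ φ.contDiff_normed hf

/-- The probability measure with density `φ.normed`. -/
def bumpMeasure (φ : ContDiffBump (0 : Eu n)) : Measure (Eu n) :=
  volume.withDensity fun y => ENNReal.ofReal (φ.normed volume y)

theorem measurable_ofReal_normed (φ : ContDiffBump (0 : Eu n)) :
    Measurable fun y => ENNReal.ofReal (φ.normed volume y) :=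
  φ.continuous_normed.measurable.ennreal_ofReal

instance (φ : ContDiffBump (0 : Eu n)) : IsProbabilityMeasure (bumpMeasure φ) := by
  refine ⟨?_⟩
  rw [bumpMeasure, withDensity_apply _ .univ, Measure.restrict_univ,
    ← ofReal_integral_eq_lintegral_ofReal φ.integrable_normed
      (ae_of_all _ fun x => φ.nonneg_normed x), φ.integral_normed, ENNReal.ofReal_one]

variable [CompleteSpace F]

theorem mollify_sub_apply (φ : ContDiffBump (0 : Eu n)) {f : Eu n → F}
    (hf : LocallyIntegrable f volume) (x : Eu n) :
    mollify φ f x - f x = ∫ y, φ.normed volume y • (f (x - y) - f x) := by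
  simp only [smul_sub]
  rw [integral_sub (integrable_mollify φ hf x) (φ.integrable_normed.smul_const _),
    φ.integral_normed_smul, mollify_apply]

/-- The error `mollify φ f - f` is the average of translation differences against the probability
measure `bumpMeasure φ`. Jensen and Tonelli bound its `L²` norm by the largest `L²` norm of a
translation difference over the support of the bump. -/
theorem lintegral_mollify_sub_sq_le (φ : ContDiffBump (0 : Eu n)) {f : Eu n → F}
    (hf : LocallyIntegrable f volume) {M : ℝ≥0∞}
    (hM : ∀ y, ‖y‖ < φ.rOut → ∫⁻ x, ‖f (x - y) - f x‖ₑ ^ 2 ≤ M) :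
    ∫⁻ x, ‖mollify φ f x - f x‖ₑ ^ 2 ≤ M := by
  -- Tonelli needs joint measurability of `(x, y) ↦ f (x - y) - f x`, so `f` is replaced by a
  -- strongly measurable version.
  wlog hsm : StronglyMeasurable f generalizing f
  · have hae := hf.aestronglyMeasurable.ae_eq_mk
    have := this (f := hf.aestronglyMeasurable.mk f) (hf.congr hae) ?_
      hf.aestronglyMeasurable.stronglyMeasurable_mk
    · refine le_trans (le_of_eq ?_) this
      rw [mollify_congr φ hae]
      refine lintegral_congr_ae ?_
      filter_upwards [hae] with x hx
      rw [hx]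
    · intro y hy
      refine le_trans (le_of_eq ?_) (hM y hy)
      refine lintegral_congr_ae ?_
      filter_upwards [hae,
        (measurePreserving_sub_right volume y).quasiMeasurePreserving.ae_eq_comp hae] with x h1 h2
      simp only [Function.comp_apply] at h2
      rw [← h1, ← h2]
  have hmeas : Measurable (fun p : Eu n × Eu n => ‖f (p.1 - p.2) - f p.1‖ₑ) :=
    ((hsm.comp_measurable (measurable_fst.sub measurable_snd)).sub
      (hsm.comp_measurable measurable_fst)).enorm
  calc ∫⁻ x, ‖mollify φ f x - f x‖ₑ ^ 2
      ≤ ∫⁻ x, (∫⁻ y, ‖f (x - y) - f x‖ₑ ∂(bumpMeasure φ)) ^ 2 := by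
        refine lintegral_mono fun x => pow_le_pow_left' ?_ 2
        rw [mollify_sub_apply φ hf]
        refine (enorm_integral_le_lintegral_enorm _).trans (le_of_eq ?_)
        have hx : Measurable fun y => ‖f (x - y) - f x‖ₑ := hmeas.comp measurable_prodMk_left
        rw [bumpMeasure, lintegral_withDensity_eq_lintegral_mul _ (measurable_ofReal_normed φ) hx]
        refine lintegral_congr fun y => ?_
        rw [enorm_smul, Pi.mul_apply, Real.enorm_eq_ofReal (φ.nonneg_normed y)]
    _ ≤ ∫⁻ x, ∫⁻ y, ‖f (x - y) - f x‖ₑ ^ 2 ∂(bumpMeasure φ) :=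
        lintegral_mono fun x => lintegral_sq_le_of_isProbabilityMeasure
          (hmeas.comp measurable_prodMk_left).aemeasurable
    _ = ∫⁻ y, (∫⁻ x, ‖f (x - y) - f x‖ₑ ^ 2) ∂(bumpMeasure φ) :=
        lintegral_lintegral_swap (hmeas.pow_const 2).aemeasurable
    _ ≤ ∫⁻ y, M ∂(bumpMeasure φ) := by
        refine lintegral_mono_ae ?_
        rw [bumpMeasure, ae_withDensity_iff (measurable_ofReal_normed φ)]
        refine ae_of_all _ fun y hy => hM y ?_
        have : y ∈ Function.support (φ.normed (volume : Measure (Eu n))) := fun h => by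
          simp [h] at hy
        rw [φ.support_normed_eq] at this
        simpa using this
    _ = M := by simp

theorem eLpNorm_mollify_sub_le (φ : ContDiffBump (0 : Eu n)) {f : Eu n → F}
    (hf : LocallyIntegrable f volume) {M : ℝ≥0∞}
    (hM : ∀ y, ‖y‖ < φ.rOut → eLpNorm (fun x => f (x - y) - f x) 2 volume ≤ M) :
    eLpNorm (fun x => mollify φ f x - f x) 2 volume ≤ M := by
  refine (ENNReal.pow_le_pow_left_iff two_ne_zero).1 ?_
  rw [eLpNorm_two_sq]
  refine lintegral_mollify_sub_sq_le φ hf fun y hy => ?_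
  rw [← eLpNorm_two_sq]
  exact pow_le_pow_left' (hM y hy) 2

theorem memLp_mollify (φ : ContDiffBump (0 : Eu n)) {f : Eu n → F} (hf : MemLp f 2 volume) :
    MemLp (mollify φ f) 2 volume := by
  have hl : LocallyIntegrable f volume := hf.locallyIntegrable (by norm_num)
  have h1 : MemLp (fun x => mollify φ f x - f x) 2 volume := by
    refine ⟨(contDiff_mollify φ hl).continuous.aestronglyMeasurable.sub hf.1, ?_⟩
    -- The crude bound `2‖f‖` for a translation difference is enough: it places the error, hence the
    -- mollification, in `L²`.
    refine (eLpNorm_mollify_sub_le φ hl (M := eLpNorm f 2 volume + eLpNorm f 2 volume)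
      fun y _ => ?_).trans_lt (ENNReal.add_lt_top.2 ⟨hf.2, hf.2⟩)
    refine (eLpNorm_sub_le (memLp_translate hf y).1 hf.1 (by norm_num)).trans ?_
    gcongr
    exact (eLpNorm_comp_measurePreserving hf.1 (measurePreserving_sub_right volume y)).le
  convert h1.add hf using 1
  ext x
  simp

theorem tendsto_eLpNorm_mollify_sub {ι : Type*} {l : Filter ι} {φ : ι → ContDiffBump (0 : Eu n)}
    (hφ : Tendsto (fun i => (φ i).rOut) l (𝓝 0)) {f : Eu n → F} (hf : MemLp f 2 volume) :
    Tendsto (fun i => eLpNorm (fun x => mollify (φ i) f x - f x) 2 volume) l (𝓝 0) := by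
  rw [ENNReal.tendsto_nhds_zero]
  intro ε hε
  obtain ⟨δ, hδ, h⟩ := Metric.eventually_nhds_iff.1
    ((ENNReal.tendsto_nhds_zero.1 (tendsto_eLpNorm_translate_sub hf)) ε hε)
  filter_upwards [hφ.eventually (eventually_lt_nhds hδ)] with i hi
  refine eLpNorm_mollify_sub_le _ (hf.locallyIntegrable (by norm_num)) fun y hy => h ?_
  simpa using hy.trans hi

end Mollify

theorem memLp_univ_iff {F : Type*} [NormedAddCommGroup F] {f : Eu n → F} :
    MemLp f 2 (volume.restrict (univ : Set (Eu n))) ↔ MemLp f 2 volume := by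
  rw [Measure.restrict_univ]

theorem eLpNorm_restrict_univ {F : Type*} [NormedAddCommGroup F] (f : Eu n → F) :
    eLpNorm f 2 (volume.restrict (univ : Set (Eu n))) = eLpNorm f 2 volume := by
  rw [Measure.restrict_univ]

/-- The derivative falls on the bump `η`, and the weak gradient is tested against `t ↦ η (x - t)`.
The sign from differentiating `x - t` cancels the sign from integration by parts. -/
theorem fderiv_mollify (φ : ContDiffBump (0 : Eu n)) {u : Eu n → ℝ} {g : Eu n → Eu n}
    (h : HasL2Gradient univ u g) (x : Eu n) (i : Fin n) :
    fderiv ℝ (mollify φ u) x (EuclideanSpace.single i 1) = mollify φ g x i := by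
  have hu := (memLp_univ_iff.1 h.memLp).locallyIntegrable (by norm_num)
  have hg := (memLp_univ_iff.1 h.memLp_grad).locallyIntegrable (by norm_num)
  set η : Eu n → ℝ := φ.normed volume with hη
  have hηs : ContDiff ℝ ∞ η := φ.contDiff_normed
  have hηc : HasCompactSupport η := φ.hasCompactSupport_normed
  have hd := hηc.hasFDerivAt_convolution_left (ContinuousLinearMap.lsmul ℝ ℝ)
    (hηs.of_le (by simp)) hu x
  rw [mollify, hd.fderiv, convolution_eq_swap]
  have hint : Integrable fun t => ((ContinuousLinearMap.precompL (Eu n)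
      (ContinuousLinearMap.lsmul ℝ ℝ)) (fderiv ℝ η (x - t))) (u t) := by
    have := (hηc.fderiv ℝ).convolutionExists_left (ContinuousLinearMap.precompL (Eu n)
      (ContinuousLinearMap.lsmul ℝ ℝ)) (hηs.continuous_fderiv (by simp)) hu x
    exact this.integrable_swap
  rw [ContinuousLinearMap.integral_apply hint]
  simp only [ContinuousLinearMap.precompL_apply, ContinuousLinearMap.lsmul_apply, smul_eq_mul]
  -- the test function `t ↦ η (x - t)`
  have hψs : ContDiff ℝ ∞ fun t => η (x - t) := hηs.comp (contDiff_const.sub contDiff_id)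
  have hψc : HasCompactSupport fun t => η (x - t) :=
    hηc.comp_homeomorph (Homeomorph.subLeft x)
  have hd' : ∀ t, fderiv ℝ (fun t => η (x - t)) t (EuclideanSpace.single i 1) =
      - fderiv ℝ η (x - t) (EuclideanSpace.single i 1) := by
    intro t
    have h1 : HasFDerivAt (fun t => x - t) (-ContinuousLinearMap.id ℝ (Eu n)) t := by
      simpa using (hasFDerivAt_id t).const_sub x
    have h2 := ((hηs.differentiable (by simp)) (x - t)).hasFDerivAt.comp t h1
    have h3 : fderiv ℝ (fun t => η (x - t)) t = _ := h2.fderiv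
    rw [h3]
    simp
  have hp := h.parts _ ⟨hψs, hψc, subset_univ _⟩ i
  simp only [hd', Measure.restrict_univ, mul_neg, integral_neg, neg_inj] at hp
  have e : (fun a => fderiv ℝ η (x - a) (EuclideanSpace.single i 1) * u a) =
      fun a => u a * fderiv ℝ η (x - a) (EuclideanSpace.single i 1) := by
    ext a; ring
  rw [e, hp, mollify_apply_swap]
  have hint2 : Integrable fun y => η (x - y) • g y :=
    (hηc.convolutionExists_left (ContinuousLinearMap.lsmul ℝ ℝ) hηs.continuous hg x).integrable_swap
  have := ((EuclideanSpace.proj (𝕜 := ℝ) i).integral_comp_comm hint2)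
  change (∫ y, η (x - y) * g y i) = (∫ y, η (x - y) • g y) i at this
  rw [← this]
  refine integral_congr_ae (ae_of_all _ fun a => ?_)
  simp only; ring

theorem gradient_mollify (φ : ContDiffBump (0 : Eu n)) {u : Eu n → ℝ} {g : Eu n → Eu n}
    (h : HasL2Gradient univ u g) : gradient (mollify φ u) = mollify φ g := by
  funext x
  ext i
  rw [gradient_coord, fderiv_mollify φ h]

theorem HasL2Gradient.mollify (φ : ContDiffBump (0 : Eu n)) {u : Eu n → ℝ} {g : Eu n → Eu n}
    (h : HasL2Gradient univ u g) :
    HasL2Gradient univ (mollify φ u) (Steklov.mollify φ g) := by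
  have hu := memLp_univ_iff.1 h.memLp
  have hg := memLp_univ_iff.1 h.memLp_grad
  have := hasL2Gradient_of_contDiff (U := univ) ((contDiff_mollify φ
    (hu.locallyIntegrable (by norm_num))).of_le (by simp))
    (memLp_univ_iff.2 (memLp_mollify φ hu))
    (by rw [gradient_mollify φ h]; exact memLp_univ_iff.2 (memLp_mollify φ hg))
  rwa [gradient_mollify φ h] at this

theorem tendsto_toH1 {U : Set (Eu n)} {ι : Type*} {l : Filter ι} {u : ι → Eu n → ℝ}
    {g : ι → Eu n → Eu n}
    {u₀ : Eu n → ℝ} {g₀ : Eu n → Eu n} (h : ∀ i, HasL2Gradient U (u i) (g i))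
    (h₀ : HasL2Gradient U u₀ g₀)
    (hu : Tendsto (fun i => eLpNorm (fun x => u i x - u₀ x) 2 (volume.restrict U)) l (𝓝 0))
    (hg : Tendsto (fun i => eLpNorm (fun x => g i x - g₀ x) 2 (volume.restrict U)) l (𝓝 0)) :
    Tendsto (fun i => (h i).toH1) l (𝓝 h₀.toH1) := by
  have h1 := (Lp.tendsto_Lp_iff_tendsto_eLpNorm'' u (fun i => (h i).memLp) u₀ h₀.memLp).2 hu
  have h2 := (Lp.tendsto_Lp_iff_tendsto_eLpNorm'' g (fun i => (h i).memLp_grad) g₀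
    h₀.memLp_grad).2 hg
  rw [tendsto_subtype_rng]
  exact (WithLp.prod_continuous_toLp 2 _ _).tendsto _ |>.comp (h1.prodMk_nhds h2)

/-- A sequence of bump functions with shrinking supports. -/
def bumpSeq (n : ℕ) (k : ℕ) : ContDiffBump (0 : Eu n) where
  rIn := 1 / (2 * ((k : ℝ) + 1))
  rOut := 1 / ((k : ℝ) + 1)
  rIn_pos := by positivity
  rIn_lt_rOut := by
    refine one_div_lt_one_div_of_lt (by positivity) ?_
    have : (0 : ℝ) ≤ k := k.cast_nonneg
    linarith

theorem tendsto_bumpSeq_rOut : Tendsto (fun k => (bumpSeq n k).rOut) atTop (𝓝 0) :=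
  tendsto_one_div_add_atTop_nhds_zero_nat

/-- Mollification as a map of `H¹(ℝⁿ)`. -/
def mollifyH1 (φ : ContDiffBump (0 : Eu n)) (w : H1 (univ : Set (Eu n))) :
    H1 (univ : Set (Eu n)) :=
  ((hasL2Gradient w).mollify φ).toH1

theorem toH1_self {U : Set (Eu n)} (w : H1 U) : (hasL2Gradient w).toH1 = w :=
  h1_ext (HasL2Gradient.fn_toH1 _) (HasL2Gradient.grad_toH1 _)

theorem tendsto_mollifyH1 (w : H1 (univ : Set (Eu n))) {ι : Type*} {l : Filter ι}
    {φ : ι → ContDiffBump (0 : Eu n)} (hφ : Tendsto (fun i => (φ i).rOut) l (𝓝 0)) :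
    Tendsto (fun i => mollifyH1 (φ i) w) l (𝓝 w) := by
  have h := tendsto_toH1 (l := l) (fun i => (hasL2Gradient w).mollify (φ i)) (hasL2Gradient w)
    ?_ ?_
  · rwa [toH1_self] at h
  · exact (tendsto_eLpNorm_mollify_sub hφ (memLp_univ_iff.1 (hasL2Gradient w).memLp)).congr
      fun i => (eLpNorm_restrict_univ _).symm
  · exact (tendsto_eLpNorm_mollify_sub hφ (memLp_univ_iff.1 (hasL2Gradient w).memLp_grad)).congr
      fun i => (eLpNorm_restrict_univ _).symm

/-! ### Quantitative mollification -/

/-- The difference is the integral of the directional derivative along the segment from `x` to `x -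
y`. Jensen in the segment parameter, Tonelli and translation invariance give the bound. -/
theorem lintegral_translate_sub_sq_le_of_contDiff {u : Eu n → ℝ} (hu : ContDiff ℝ 1 u) (y : Eu n) :
    ∫⁻ x, ‖u (x - y) - u x‖ₑ ^ 2 ≤ ‖y‖ₑ ^ 2 * ∫⁻ x, ‖gradient u x‖ₑ ^ 2 := by
  have hg : Continuous (gradient u) := continuous_gradient hu
  have hν : IsProbabilityMeasure (volume.restrict (Ioc (0 : ℝ) 1)) := ⟨by simp⟩
  have hmeas : Measurable (fun p : Eu n × ℝ => ‖gradient u (p.1 - p.2 • y)‖ₑ) := by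
    have : Continuous (fun p : Eu n × ℝ => gradient u (p.1 - p.2 • y)) := by fun_prop
    exact this.enorm.measurable
  have h1 : ∀ x, ‖u (x - y) - u x‖ₑ ≤
      ‖y‖ₑ * ∫⁻ θ in Ioc (0 : ℝ) 1, ‖gradient u (x - θ • y)‖ₑ := by
    intro x
    have hd : ∀ θ : ℝ, HasDerivAt (fun θ : ℝ => u (x - θ • y))
        (fderiv ℝ u (x - θ • y) (-y)) θ := by
      intro θ
      have h2 : HasDerivAt (fun θ : ℝ => x - θ • y) (-y) θ := by
        simpa using ((hasDerivAt_id θ).smul_const y).const_sub x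
      exact ((hu.differentiable one_ne_zero) (x - θ • y)).hasFDerivAt.comp_hasDerivAt θ h2
    have hc : Continuous fun θ : ℝ => fderiv ℝ u (x - θ • y) (-y) :=
      ((hu.continuous_fderiv one_ne_zero).comp (by fun_prop)).clm_apply continuous_const
    have h3 := intervalIntegral.integral_eq_sub_of_hasDerivAt (a := 0) (b := 1)
      (fun θ _ => hd θ) (hc.intervalIntegrable 0 1)
    simp only [one_smul, zero_smul, sub_zero] at h3
    rw [← h3, intervalIntegral.integral_of_le zero_le_one]
    refine (enorm_integral_le_lintegral_enorm _).trans ?_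
    have hmx : Measurable fun θ : ℝ => ‖gradient u (x - θ • y)‖ₑ :=
      (hg.comp (by fun_prop : Continuous fun θ : ℝ => x - θ • y)).enorm.measurable
    refine le_trans ?_ (lintegral_const_mul ‖y‖ₑ hmx).le
    refine lintegral_mono fun θ => ?_
    rw [← inner_gradient_left, mul_comm, ← ofReal_norm, ← ofReal_norm, ← ofReal_norm,
      ← ENNReal.ofReal_mul (norm_nonneg _), ← norm_neg y]
    exact ENNReal.ofReal_le_ofReal (norm_inner_le_norm _ _)
  calc ∫⁻ x, ‖u (x - y) - u x‖ₑ ^ 2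
      ≤ ∫⁻ x, ‖y‖ₑ ^ 2 * ∫⁻ θ in Ioc (0 : ℝ) 1, ‖gradient u (x - θ • y)‖ₑ ^ 2 := by
        refine lintegral_mono fun x => (pow_le_pow_left' (h1 x) 2).trans ?_
        rw [mul_pow]
        gcongr
        exact lintegral_sq_le_of_isProbabilityMeasure
          (hg.comp (by fun_prop : Continuous fun θ : ℝ => x - θ • y)).enorm.measurable.aemeasurable
    _ = ‖y‖ₑ ^ 2 * ∫⁻ θ in Ioc (0 : ℝ) 1, (∫⁻ x, ‖gradient u (x - θ • y)‖ₑ ^ 2) := by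
        rw [lintegral_const_mul' _ _ (by simp),
          lintegral_lintegral_swap (hmeas.pow_const 2).aemeasurable]
    _ = ‖y‖ₑ ^ 2 * ∫⁻ x, ‖gradient u x‖ₑ ^ 2 := by
        have : ∀ θ : ℝ, ∫⁻ x, ‖gradient u (x - θ • y)‖ₑ ^ 2 = ∫⁻ x, ‖gradient u x‖ₑ ^ 2 :=
          fun θ => lintegral_sub_right_eq_self (fun x => ‖gradient u x‖ₑ ^ 2) (θ • y)
        simp [this]

/-- Passage to the limit in the smooth case along mollifications. -/
theorem eLpNorm_translate_sub_le {u : Eu n → ℝ} {g : Eu n → Eu n}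
    (h : HasL2Gradient univ u g) (y : Eu n) :
    eLpNorm (fun x => u (x - y) - u x) 2 volume ≤ ‖y‖ₑ * eLpNorm g 2 volume := by
  have hu := memLp_univ_iff.1 h.memLp
  have hg := memLp_univ_iff.1 h.memLp_grad
  have hul := hu.locallyIntegrable (by norm_num)
  set uk : ℕ → Eu n → ℝ := fun k => mollify (bumpSeq n k) u with huk
  set gk : ℕ → Eu n → Eu n := fun k => mollify (bumpSeq n k) g with hgk
  have hukm : ∀ k, MemLp (uk k) 2 volume := fun k => memLp_mollify _ hu
  have hgkm : ∀ k, MemLp (gk k) 2 volume := fun k => memLp_mollify _ hg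
  have hsm : ∀ k, eLpNorm (fun x => uk k (x - y) - uk k x) 2 volume ≤
      ‖y‖ₑ * eLpNorm (gk k) 2 volume := by
    intro k
    refine (ENNReal.pow_le_pow_left_iff two_ne_zero).1 ?_
    rw [mul_pow, eLpNorm_two_sq, eLpNorm_two_sq]
    have := lintegral_translate_sub_sq_le_of_contDiff
      ((contDiff_mollify (bumpSeq n k) hul).of_le (by simp)) y
    rwa [gradient_mollify _ h] at this
  have hbound : ∀ k, eLpNorm (fun x => u (x - y) - u x) 2 volume ≤
      eLpNorm (fun x => uk k x - u x) 2 volume + (‖y‖ₑ * (eLpNorm (fun x => gk k x - g x) 2 volume +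
        eLpNorm g 2 volume) + eLpNorm (fun x => uk k x - u x) 2 volume) := by
    intro k
    have e : (fun x => u (x - y) - u x) = (fun x => u (x - y) - uk k (x - y)) +
        ((fun x => uk k (x - y) - uk k x) + fun x => uk k x - u x) := by
      funext x; simp
    have m1 : MemLp (fun x => uk k x - u x) 2 volume := (hukm k).sub hu
    have m2 : MemLp (fun x => u x - uk k x) 2 volume := hu.sub (hukm k)
    rw [e]
    refine (eLpNorm_add_le (memLp_translate m2 y).1
      (((memLp_translate (hukm k) y).sub (hukm k)).add m1).1 (by norm_num)).trans ?_
    refine add_le_add (le_of_eq ?_) ?_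
    · have := eLpNorm_comp_measurePreserving (p := 2) m2.1
        (measurePreserving_sub_right (volume : Measure (Eu n)) y)
      refine Eq.trans this ?_
      exact eLpNorm_sub_comm u (uk k) 2 volume
    · refine (eLpNorm_add_le ((memLp_translate (hukm k) y).sub (hukm k)).1 m1.1
        (by norm_num)).trans ?_
      gcongr
      refine (hsm k).trans ?_
      gcongr
      have e2 : gk k = (fun x => gk k x - g x) + g := by funext x; simp
      have m3 : MemLp (fun x => gk k x - g x) 2 volume := (hgkm k).sub hg
      calc eLpNorm (gk k) 2 volume = eLpNorm ((fun x => gk k x - g x) + g) 2 volume := by rw [← e2]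
        _ ≤ _ := eLpNorm_add_le m3.1 hg.1 (by norm_num)
  have t1 := tendsto_eLpNorm_mollify_sub (l := atTop) tendsto_bumpSeq_rOut hu
  have t2 := tendsto_eLpNorm_mollify_sub (l := atTop) tendsto_bumpSeq_rOut hg
  have ht := t1.add ((ENNReal.Tendsto.const_mul (a := ‖y‖ₑ)
    (t2.add (tendsto_const_nhds (x := eLpNorm g 2 volume))) (Or.inr (by simp))).add t1)
  simp only [zero_add, add_zero] at ht
  exact ge_of_tendsto' ht hbound

/-- `‖u_φ - u‖_{L²} ≤ s ‖∇u‖_{L²}` for a bump function `φ` supported in the ball of radius `s`. -/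
theorem integral_mollify_sub_sq_le (φ : ContDiffBump (0 : Eu n)) {u : Eu n → ℝ} {g : Eu n → Eu n}
    (h : HasL2Gradient univ u g) :
    ∫ x, ‖mollify φ u x - u x‖ ^ 2 ≤ φ.rOut ^ 2 * ∫ x, ‖g x‖ ^ 2 := by
  have hu := memLp_univ_iff.1 h.memLp
  have hg := memLp_univ_iff.1 h.memLp_grad
  have h1 := eLpNorm_mollify_sub_le φ (hu.locallyIntegrable (by norm_num))
    (M := ENNReal.ofReal φ.rOut * eLpNorm g 2 volume) fun y hy => by
      refine (eLpNorm_translate_sub_le h y).trans ?_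
      gcongr
      rw [← ofReal_norm]
      exact ENNReal.ofReal_le_ofReal hy.le
  have h2 := ENNReal.toReal_mono (ENNReal.mul_ne_top (by simp) hg.2.ne) h1
  rw [ENNReal.toReal_mul, ENNReal.toReal_ofReal φ.rOut_pos.le] at h2
  have h3 := pow_le_pow_left₀ ENNReal.toReal_nonneg h2 2
  have h4 : MemLp (fun x => mollify φ u x - u x) 2 volume := (memLp_mollify φ hu).sub hu
  rwa [mul_pow, eLpNorm_two_toReal_sq hg, eLpNorm_two_toReal_sq h4] at h3

theorem normed_le (φ : ContDiffBump (0 : Eu n)) (y : Eu n) :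
    φ.normed volume y ≤ 1 / (φ.rIn ^ n * volume.real (Metric.ball (0 : Eu n) 1)) := by
  refine (φ.normed_le_div_measure_closedBall_rIn volume y).trans (le_of_eq ?_)
  rw [Measure.real, Measure.addHaar_closedBall _ _ φ.rIn_pos.le, ENNReal.toReal_mul,
    ENNReal.toReal_ofReal (by have := φ.rIn_pos; positivity)]
  simp [Measure.real]

/-- A bound from `L²` to `L^∞`: Jensen for `bumpMeasure φ`, after which its density is replaced by
its upper bound. Applied to a gradient it makes mollifications Lipschitz. -/
theorem norm_mollify_sq_le {F : Type*} [NormedAddCommGroup F] [InnerProductSpace ℝ F]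
    (φ : ContDiffBump (0 : Eu n)) {f : Eu n → F} (hf : MemLp f 2 volume) (x : Eu n) :
    ‖mollify φ f x‖ ^ 2 ≤
      1 / (φ.rIn ^ n * volume.real (Metric.ball (0 : Eu n) 1)) * ∫ y, ‖f y‖ ^ 2 := by
  set B := 1 / (φ.rIn ^ n * volume.real (Metric.ball (0 : Eu n) 1)) with hB
  have hB0 : 0 ≤ B := by have := φ.rIn_pos; positivity
  have hae : AEStronglyMeasurable (fun y => f (x - y)) volume :=
    hf.1.comp_measurePreserving (Measure.measurePreserving_sub_left volume x)
  have hle : ‖mollify φ f x‖ₑ ^ 2 ≤ ENNReal.ofReal B * ∫⁻ y, ‖f y‖ₑ ^ 2 := by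
    calc ‖mollify φ f x‖ₑ ^ 2 ≤ (∫⁻ y, ‖f (x - y)‖ₑ ∂(bumpMeasure φ)) ^ 2 := by
          refine pow_le_pow_left' ?_ 2
          rw [mollify_apply]
          refine (enorm_integral_le_lintegral_enorm _).trans (le_of_eq ?_)
          rw [bumpMeasure, lintegral_withDensity_eq_lintegral_mul₀
            (measurable_ofReal_normed φ).aemeasurable hae.enorm]
          refine lintegral_congr fun y => ?_
          rw [enorm_smul, Pi.mul_apply, Real.enorm_eq_ofReal (φ.nonneg_normed y)]
      _ ≤ ∫⁻ y, ‖f (x - y)‖ₑ ^ 2 ∂(bumpMeasure φ) :=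
          lintegral_sq_le_of_isProbabilityMeasure
            (hae.enorm.mono_ac (withDensity_absolutelyContinuous _ _))
      _ = ∫⁻ y, ENNReal.ofReal (φ.normed volume y) * ‖f (x - y)‖ₑ ^ 2 := by
          rw [bumpMeasure, lintegral_withDensity_eq_lintegral_mul₀
            (measurable_ofReal_normed φ).aemeasurable (hae.enorm.pow_const 2)]
          rfl
      _ ≤ ∫⁻ y, ENNReal.ofReal B * ‖f (x - y)‖ₑ ^ 2 := by
          refine lintegral_mono fun y => ?_
          gcongr
          exact normed_le φ y
      _ = ENNReal.ofReal B * ∫⁻ y, ‖f y‖ₑ ^ 2 := by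
          rw [lintegral_const_mul' _ _ (by simp)]
          congr 1
          exact lintegral_sub_left_eq_self (fun y => ‖f y‖ₑ ^ 2) x
  rw [← eLpNorm_two_sq] at hle
  have h2 := ENNReal.toReal_mono (ENNReal.mul_ne_top (by simp) (ENNReal.pow_ne_top hf.2.ne)) hle
  rwa [ENNReal.toReal_mul, ENNReal.toReal_ofReal hB0, ENNReal.toReal_pow, ENNReal.toReal_pow,
    toReal_enorm, eLpNorm_two_toReal_sq hf] at h2

theorem abs_mollify_sub_le (φ : ContDiffBump (0 : Eu n)) {u : Eu n → ℝ} {g : Eu n → Eu n}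
    (h : HasL2Gradient univ u g) {B : ℝ} (hB0 : 0 ≤ B)
    (hB : 1 / (φ.rIn ^ n * volume.real (Metric.ball (0 : Eu n) 1)) * ∫ y, ‖g y‖ ^ 2 ≤ B ^ 2)
    (x y : Eu n) : |mollify φ u x - mollify φ u y| ≤ B * ‖x - y‖ := by
  have hu := (memLp_univ_iff.1 h.memLp).locallyIntegrable (by norm_num)
  refine Convex.norm_image_sub_le_of_norm_fderiv_le (𝕜 := ℝ) (s := univ)
    (fun z _ => (contDiff_mollify φ hu).differentiable (by simp) z) (fun z _ => ?_)
    convex_univ (mem_univ _) (mem_univ _)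
  rw [← norm_gradient, gradient_mollify φ h]
  refine le_of_sq_le_sq ?_ hB0
  exact (norm_mollify_sq_le φ (memLp_univ_iff.1 h.memLp_grad) z).trans hB

/-- If `u` takes the values `0` and `1` on two subsets of measure at least `m` of a ball of
radius `R`, then `m ≤ 16 s² ‖∇u‖²`, provided that mollifications of `u` at scale `s` oscillate
little on the ball. -/
theorem measure_le_of_mollify_oscillation (φ : ContDiffBump (0 : Eu n)) {u : Eu n → ℝ}
    {g : Eu n → Eu n} (h : HasL2Gradient univ u g) {R : ℝ} (hR : 0 < R) (x₀ : Eu n)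
    (hosc : R ^ 2 * (1 / (φ.rIn ^ n * volume.real (Metric.ball (0 : Eu n) 1)) * ∫ y, ‖g y‖ ^ 2)
      ≤ 1 / 16) {E₀ E₁ : Set (Eu n)} (hE₀ : MeasurableSet E₀) (hE₁ : MeasurableSet E₁)
    (hE₀R : E₀ ⊆ Metric.closedBall x₀ R) (hE₁R : E₁ ⊆ Metric.closedBall x₀ R)
    (h₀ : ∀ᵐ x, x ∈ E₀ → u x = 0) (h₁ : ∀ᵐ x, x ∈ E₁ → u x = 1) {m : ℝ}
    (hm₀ : m ≤ volume.real E₀) (hm₁ : m ≤ volume.real E₁) :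
    m ≤ 16 * φ.rOut ^ 2 * ∫ y, ‖g y‖ ^ 2 := by
  have hu := memLp_univ_iff.1 h.memLp
  set c := mollify φ u x₀ with hc
  have hosc' : ∀ x ∈ Metric.closedBall x₀ R, |mollify φ u x - c| ≤ 1 / 4 := by
    intro x hx
    -- The Lipschitz constant `1 / (4 * R)` is what `hosc` provides; over the distance `R` from the
    -- centre it allows a deviation of `1 / 4`.
    refine (abs_mollify_sub_le φ h (B := 1 / (4 * R)) (by positivity) ?_ x x₀).trans ?_
    · rw [div_pow, le_div_iff₀ (by positivity)]
      nlinarith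
    · rw [← dist_eq_norm]
      have := Metric.mem_closedBall.1 hx
      calc 1 / (4 * R) * dist x x₀ ≤ 1 / (4 * R) * R := by gcongr
        _ = 1 / 4 := by field_simp
  -- On a set where `u = b` with `b` at distance at least `1/2` from the central value `c`, the
  -- mollification error is at least `1/4`. Integrating its square compares `m / 16` with `φ.rOut ^
  -- 2 * ‖∇u‖²`.
  have key : ∀ (E : Set (Eu n)) (b : ℝ), MeasurableSet E → E ⊆ Metric.closedBall x₀ R →
      (∀ᵐ x, x ∈ E → u x = b) → m ≤ volume.real E → 1 / 2 ≤ |b - c| →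
      m ≤ 16 * φ.rOut ^ 2 * ∫ y, ‖g y‖ ^ 2 := by
    intro E b hE hER hb hm hbc
    have hi : Integrable fun x => ‖mollify φ u x - u x‖ ^ 2 :=
      ((memLp_mollify φ hu).sub hu).integrable_norm_sq
    have hfin : volume E ≠ ⊤ := (measure_mono hER).trans_lt measure_closedBall_lt_top |>.ne
    have h1 : ∫ x in E, (1 / 16 : ℝ) ≤ ∫ x in E, ‖mollify φ u x - u x‖ ^ 2 := by
      refine setIntegral_mono_on_ae (integrableOn_const hfin) hi.integrableOn hE ?_
      filter_upwards [hb] with x hx hxE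
      have h3 := hosc' x (hER hxE)
      rw [hx hxE, Real.norm_eq_abs, sq_abs]
      have h4 : 1 / 4 ≤ |mollify φ u x - b| := by
        have : |b - c| ≤ |mollify φ u x - b| + |mollify φ u x - c| := by
          have := abs_sub_le b (mollify φ u x) c
          rwa [abs_sub_comm b (mollify φ u x)] at this
        linarith
      rw [← sq_abs]
      nlinarith
    have h2 : ∫ x in E, ‖mollify φ u x - u x‖ ^ 2 ≤ ∫ x, ‖mollify φ u x - u x‖ ^ 2 :=
      setIntegral_le_integral hi (ae_of_all _ fun x => by positivity)
    have h5 := integral_mollify_sub_sq_le φ h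
    rw [setIntegral_const, smul_eq_mul] at h1
    linarith
  -- At least one of the two values `0` and `1` is at distance at least `1/2` from `c`.
  rcases le_total (1 / 2) |0 - c| with h3 | h3
  · exact key E₀ 0 hE₀ hE₀R h₀ hm₀ h3
  · refine key E₁ 1 hE₁ hE₁R h₁ hm₁ ?_
    have := abs_sub_le (1 : ℝ) c 0
    rw [abs_sub_comm c 0, sub_zero, abs_one] at this
    linarith

/-! ### Chain and product rules -/

section Lp

variable {α E : Type*} [MeasurableSpace α] {μ : Measure α} [NormedAddCommGroup E]

theorem tendsto_eLpNorm_of_dominated {f : ℕ → α → E} {b : α → ℝ} (hb : MemLp b 2 μ)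
    (hf : ∀ j, AEStronglyMeasurable (f j) μ) (hle : ∀ j, ∀ᵐ x ∂μ, ‖f j x‖ ≤ b x)
    (hlim : ∀ᵐ x ∂μ, Tendsto (fun j => f j x) atTop (𝓝 0)) :
    Tendsto (fun j => eLpNorm (f j) 2 μ) atTop (𝓝 0) := by
  have h := tendsto_lintegral_of_dominated_convergence' (μ := μ)
    (F := fun j x => ‖f j x‖ₑ ^ 2) (f := fun _ => 0) (fun x => ‖b x‖ₑ ^ 2)
    (fun j => (hf j).enorm.pow_const 2) (fun j => ?_) ?_ ?_
  · simp only [← eLpNorm_two_sq, lintegral_zero] at h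
    have h2 := (ENNReal.continuous_rpow_const (y := (1 / 2 : ℝ))).tendsto 0 |>.comp h
    simp only [ENNReal.zero_rpow_of_pos (show (0 : ℝ) < 1 / 2 by norm_num)] at h2
    refine h2.congr fun j => ?_
    simp only [Function.comp_apply]
    rw [← ENNReal.rpow_natCast, ← ENNReal.rpow_mul]
    norm_num
  · filter_upwards [hle j] with x hx
    refine pow_le_pow_left' ?_ 2
    rw [← ofReal_norm, ← ofReal_norm]
    exact ENNReal.ofReal_le_ofReal (hx.trans (le_abs_self _))
  · rw [← eLpNorm_two_sq]
    exact ENNReal.pow_ne_top hb.2.ne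
  · filter_upwards [hlim] with x hx
    have := (ENNReal.continuous_pow 2).tendsto _ |>.comp hx.enorm
    simpa [Function.comp_def] using this

theorem tendsto_eLpNorm_smul_sub [NormedSpace ℝ E] {a : ℕ → α → ℝ} {a₀ : α → ℝ} {g : α → E}
    {C : ℝ}
    (hg : MemLp g 2 μ) (ha : ∀ j, AEStronglyMeasurable (a j) μ) (hb : ∀ j, ∀ᵐ x ∂μ, |a j x| ≤ C)
    (hlim : ∀ᵐ x ∂μ, Tendsto (fun j => a j x) atTop (𝓝 (a₀ x))) :
    Tendsto (fun j => eLpNorm (fun x => a j x • g x - a₀ x • g x) 2 μ) atTop (𝓝 0) := by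
  have ha₀ : AEStronglyMeasurable a₀ μ := aestronglyMeasurable_of_tendsto_ae atTop ha hlim
  refine tendsto_eLpNorm_of_dominated (b := fun x => (2 * C) * ‖g x‖) (hg.norm.const_mul _)
    (fun j => ((ha j).smul hg.1).sub (ha₀.smul hg.1)) (fun j => ?_) ?_
  · have hall := ae_all_iff.2 hb
    filter_upwards [hall, hlim] with x h1 h2
    have h3 : |a₀ x| ≤ C := le_of_tendsto' h2.abs h1
    rw [← sub_smul, norm_smul]
    gcongr
    calc ‖a j x - a₀ x‖ ≤ |a j x| + |a₀ x| := abs_sub _ _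
      _ ≤ 2 * C := by linarith [h1 j]
  · filter_upwards [hlim] with x hx
    have := (hx.smul_const (g x)).sub_const (a₀ x • g x)
    simpa using this

theorem exists_subseq_tendsto_ae {f : ℕ → α → E} {g : α → E}
    (hf : ∀ j, AEStronglyMeasurable (f j) μ) (hg : AEStronglyMeasurable g μ)
    (h : Tendsto (fun j => eLpNorm (fun x => f j x - g x) 2 μ) atTop (𝓝 0)) :
    ∃ ns : ℕ → ℕ, StrictMono ns ∧
      ∀ᵐ x ∂μ, Tendsto (fun j => f (ns j) x) atTop (𝓝 (g x)) :=
  (tendstoInMeasure_of_tendsto_eLpNorm (by norm_num) hf hg h).exists_seq_tendsto_ae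

end Lp

/-- Closedness of the weak gradient, stated for functions so that limits of explicit formulas can be
identified. -/
theorem hasL2Gradient_of_tendsto {U : Set (Eu n)} {u : ℕ → Eu n → ℝ} {g : ℕ → Eu n → Eu n}
    {u₀ : Eu n → ℝ} {g₀ : Eu n → Eu n} (h : ∀ i, HasL2Gradient U (u i) (g i))
    (hu₀ : MemLp u₀ 2 (volume.restrict U)) (hg₀ : MemLp g₀ 2 (volume.restrict U))
    (hu : Tendsto (fun i => eLpNorm (fun x => u i x - u₀ x) 2 (volume.restrict U)) atTop (𝓝 0))
    (hg : Tendsto (fun i => eLpNorm (fun x => g i x - g₀ x) 2 (volume.restrict U)) atTop (𝓝 0)) :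
    HasL2Gradient U u₀ g₀ := by
  have h1 := (Lp.tendsto_Lp_iff_tendsto_eLpNorm'' u (fun i => (h i).memLp) u₀ hu₀).2 hu
  have h2 := (Lp.tendsto_Lp_iff_tendsto_eLpNorm'' g (fun i => (h i).memLp_grad) g₀ hg₀).2 hg
  have h3 : Tendsto (fun i => ((h i).toH1 : L2Pair U)) atTop
      (𝓝 (WithLp.toLp 2 (hu₀.toLp u₀, hg₀.toLp g₀))) :=
    (WithLp.prod_continuous_toLp 2 _ _).tendsto _ |>.comp (h1.prodMk_nhds h2)
  have h4 := isClosed_h1.mem_of_tendsto h3 (Eventually.of_forall fun i => (h i).toH1.2)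
  exact (hasL2Gradient (⟨_, h4⟩ : H1 U)).congr hu₀.coeFn_toLp hg₀.coeFn_toLp

/-- A `C¹` function on `ℝ²`, zero at the origin, with partial derivatives `Fa`, `Fb` bounded
by `C`. -/
structure IsC1Bounded (F Fa Fb : ℝ × ℝ → ℝ) (C : ℝ) : Prop where
  hasFDerivAt : ∀ p, HasFDerivAt F
    (Fa p • ContinuousLinearMap.fst ℝ ℝ ℝ + Fb p • ContinuousLinearMap.snd ℝ ℝ ℝ) p
  continuous_fst : Continuous Fa
  continuous_snd : Continuous Fb
  bound_fst : ∀ p, |Fa p| ≤ C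
  bound_snd : ∀ p, |Fb p| ≤ C
  zero : F 0 = 0

namespace IsC1Bounded

variable {F Fa Fb : ℝ × ℝ → ℝ} {C : ℝ}

theorem contDiff (hF : IsC1Bounded F Fa Fb C) : ContDiff ℝ 1 F :=
  contDiff_one_iff_hasFDerivAt.2 ⟨_, (hF.continuous_fst.smul continuous_const).add
    (hF.continuous_snd.smul continuous_const), hF.hasFDerivAt⟩

theorem abs_sub_le (hF : IsC1Bounded F Fa Fb C) (p q : ℝ × ℝ) :
    |F p - F q| ≤ 2 * C * (|p.1 - q.1| + |p.2 - q.2|) := by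
  have hC : 0 ≤ C := (abs_nonneg _).trans (hF.bound_fst 0)
  have h := Convex.norm_image_sub_le_of_norm_hasFDerivWithin_le (𝕜 := ℝ) (f := F) (C := 2 * C)
    (s := univ) (x := q) (y := p) (fun z _ => (hF.hasFDerivAt z).hasFDerivWithinAt) (fun z _ => ?_)
    convex_univ (mem_univ _) (mem_univ _)
  · refine h.trans ?_
    gcongr
    rw [Prod.norm_def]
    exact max_le (le_add_of_nonneg_right (abs_nonneg _)) (le_add_of_nonneg_left (abs_nonneg _))
  · refine (norm_add_le _ _).trans ?_
    rw [norm_smul, norm_smul]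
    have h1 : ‖Fa z‖ * ‖ContinuousLinearMap.fst ℝ ℝ ℝ‖ ≤ C * 1 :=
      mul_le_mul (hF.bound_fst z) (ContinuousLinearMap.norm_fst_le ℝ ℝ ℝ) (norm_nonneg _) hC
    have h2 : ‖Fb z‖ * ‖ContinuousLinearMap.snd ℝ ℝ ℝ‖ ≤ C * 1 :=
      mul_le_mul (hF.bound_snd z) (ContinuousLinearMap.norm_snd_le ℝ ℝ ℝ) (norm_nonneg _) hC
    linarith

theorem gradient_comp (hF : IsC1Bounded F Fa Fb C) {u v : Eu n → ℝ} (hu : ContDiff ℝ 1 u)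
    (hv : ContDiff ℝ 1 v) (x : Eu n) : gradient (fun x => F (u x, v x)) x =
      Fa (u x, v x) • gradient u x + Fb (u x, v x) • gradient v x := by
  have h1 := (hF.hasFDerivAt (u x, v x)).comp x
    (((hu.differentiable one_ne_zero) x).hasFDerivAt.prodMk
      ((hv.differentiable one_ne_zero) x).hasFDerivAt)
  have h2 : fderiv ℝ (fun x => F (u x, v x)) x = _ := h1.fderiv
  ext i
  rw [gradient_coord, h2]
  simp [gradient_coord]

variable {α : Type*} [MeasurableSpace α] {μ : Measure α} {u v : α → ℝ}

theorem memLp_comp (hF : IsC1Bounded F Fa Fb C) (hu : MemLp u 2 μ) (hv : MemLp v 2 μ) :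
    MemLp (fun x => F (u x, v x)) 2 μ := by
  refine ((hu.norm.add hv.norm).of_le_mul (c := 2 * C)) ?_ (ae_of_all _ fun x => ?_)
  · exact hF.contDiff.continuous.comp_aestronglyMeasurable (hu.1.prodMk hv.1)
  · have := hF.abs_sub_le (u x, v x) 0
    rw [hF.zero] at this
    simp only [sub_zero, Prod.fst_zero, Prod.snd_zero] at this
    refine this.trans (le_of_eq ?_)
    rw [Pi.add_apply, Real.norm_of_nonneg (by positivity)]
    rfl

theorem memLp_grad_comp {E : Type*} [NormedAddCommGroup E] [NormedSpace ℝ E]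
    (hF : IsC1Bounded F Fa Fb C) {g k : α → E}
    (hu : AEStronglyMeasurable u μ) (hv : AEStronglyMeasurable v μ)
    (hg : MemLp g 2 μ) (hk : MemLp k 2 μ) :
    MemLp (fun x => Fa (u x, v x) • g x + Fb (u x, v x) • k x) 2 μ := by
  have h1 : MemLp (fun x => Fa (u x, v x) • g x) 2 μ := by
    refine hg.of_le_mul (c := C)
      ((hF.continuous_fst.comp_aestronglyMeasurable (hu.prodMk hv)).smul hg.1)
      (ae_of_all _ fun x => ?_)
    rw [norm_smul]
    gcongr
    exact hF.bound_fst _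
  have h2 : MemLp (fun x => Fb (u x, v x) • k x) 2 μ := by
    refine hk.of_le_mul (c := C)
      ((hF.continuous_snd.comp_aestronglyMeasurable (hu.prodMk hv)).smul hk.1)
      (ae_of_all _ fun x => ?_)
    rw [norm_smul]
    gcongr
    exact hF.bound_snd _
  exact h1.add h2

end IsC1Bounded

theorem tendsto_eLpNorm_coeff_smul {α E : Type*} [MeasurableSpace α] {μ : Measure α}
    [NormedAddCommGroup E] [NormedSpace ℝ E] {a : ℕ → α → ℝ} {a₀ : α → ℝ} {g : ℕ → α → E}
    {g₀ : α → E} {C : ℝ} (hg : ∀ j, MemLp (g j) 2 μ)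
    (hg₀ : MemLp g₀ 2 μ) (ha : ∀ j, AEStronglyMeasurable (a j) μ) (hb : ∀ j x, |a j x| ≤ C)
    (hlim : ∀ᵐ x ∂μ, Tendsto (fun j => a j x) atTop (𝓝 (a₀ x)))
    (hgl : Tendsto (fun j => eLpNorm (fun x => g j x - g₀ x) 2 μ) atTop (𝓝 0)) :
    Tendsto (fun j => eLpNorm (fun x => a j x • g j x - a₀ x • g₀ x) 2 μ) atTop (𝓝 0) := by
  have ha₀ : AEStronglyMeasurable a₀ μ := aestronglyMeasurable_of_tendsto_ae atTop ha hlim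
  have t1 := tendsto_eLpNorm_smul_sub hg₀ ha (fun j => ae_of_all _ (hb j)) hlim
  have t2 : Tendsto (fun j => ENNReal.ofReal C * eLpNorm (fun x => g j x - g₀ x) 2 μ) atTop
      (𝓝 0) := by
    simpa using ENNReal.Tendsto.const_mul (a := ENNReal.ofReal C) hgl (Or.inr (by simp))
  have t3 := t2.add t1
  rw [add_zero] at t3
  refine tendsto_of_tendsto_of_tendsto_of_le_of_le tendsto_const_nhds t3 (fun _ => zero_le)
    fun j => ?_
  have e : (fun x => a j x • g j x - a₀ x • g₀ x) =
      (fun x => a j x • (g j x - g₀ x)) + fun x => a j x • g₀ x - a₀ x • g₀ x := by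
    funext x
    simp [smul_sub]
  rw [e]
  refine (eLpNorm_add_le ((ha j).smul ((hg j).sub hg₀).1)
    (((ha j).smul hg₀.1).sub (ha₀.smul hg₀.1)) (by norm_num)).trans ?_
  refine add_le_add ?_ le_rfl
  refine eLpNorm_le_mul_eLpNorm_of_ae_le_mul (ae_of_all _ fun x => ?_) 2
  refine (norm_smul_le (a j x) (g j x - g₀ x)).trans ?_
  gcongr
  exact hb j x

/-- Chain rule in `H¹(ℝⁿ)` for a function of two variables with bounded derivatives. -/
theorem IsC1Bounded.hasL2Gradient_comp {F Fa Fb : ℝ × ℝ → ℝ} {C : ℝ}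
    (hF : IsC1Bounded F Fa Fb C)
    {u v : Eu n → ℝ} {g k : Eu n → Eu n} (h₁ : HasL2Gradient univ u g)
    (h₂ : HasL2Gradient univ v k) :
    HasL2Gradient univ (fun x => F (u x, v x))
      (fun x => Fa (u x, v x) • g x + Fb (u x, v x) • k x) := by
  have hu := memLp_univ_iff.1 h₁.memLp
  have hg := memLp_univ_iff.1 h₁.memLp_grad
  have hv := memLp_univ_iff.1 h₂.memLp
  have hk := memLp_univ_iff.1 h₂.memLp_grad
  have hul := hu.locallyIntegrable (by norm_num)
  have hvl := hv.locallyIntegrable (by norm_num)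
  have tφ := tendsto_bumpSeq_rOut (n := n)
  -- Almost everywhere convergence is extracted for `u` and then, along that subsequence, for `v`;
  -- it serves the coefficients `Fa` and `Fb`, which are bounded and continuous. The `L²`
  -- convergence needs no extraction.
  obtain ⟨ns, hns, hnsu⟩ := exists_subseq_tendsto_ae
    (fun j => (memLp_mollify (bumpSeq n j) hu).1) hu.1
    (tendsto_eLpNorm_mollify_sub tφ hu)
  have tφ' := tφ.comp hns.tendsto_atTop
  obtain ⟨ms, hms, hmsv⟩ := exists_subseq_tendsto_ae
    (fun j => (memLp_mollify (bumpSeq n (ns j)) hv).1) hv.1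
    (tendsto_eLpNorm_mollify_sub tφ' hv)
  have tφ'' := tφ'.comp hms.tendsto_atTop
  set φ : ℕ → ContDiffBump (0 : Eu n) := fun j => bumpSeq n (ns (ms j)) with hφ
  have tφ3 : Tendsto (fun j => (φ j).rOut) atTop (𝓝 0) := tφ''
  have cu : ∀ j, ContDiff ℝ 1 (mollify (φ j) u) := fun j =>
    (contDiff_mollify _ hul).of_le (by simp)
  have cv : ∀ j, ContDiff ℝ 1 (mollify (φ j) v) := fun j =>
    (contDiff_mollify _ hvl).of_le (by simp)
  have mu : ∀ j, MemLp (mollify (φ j) u) 2 volume := fun j => memLp_mollify _ hu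
  have mv : ∀ j, MemLp (mollify (φ j) v) 2 volume := fun j => memLp_mollify _ hv
  have mg : ∀ j, MemLp (mollify (φ j) g) 2 volume := fun j => memLp_mollify _ hg
  have mk : ∀ j, MemLp (mollify (φ j) k) 2 volume := fun j => memLp_mollify _ hk
  have tu := tendsto_eLpNorm_mollify_sub tφ3 hu
  have tv := tendsto_eLpNorm_mollify_sub tφ3 hv
  have tg := tendsto_eLpNorm_mollify_sub tφ3 hg
  have tk := tendsto_eLpNorm_mollify_sub tφ3 hk
  have hlim : ∀ᵐ x, Tendsto (fun j => (mollify (φ j) u x, mollify (φ j) v x)) atTop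
      (𝓝 (u x, v x)) := by
    filter_upwards [hnsu, hmsv] with x h1 h2
    exact (h1.comp hms.tendsto_atTop).prodMk_nhds h2
  refine hasL2Gradient_of_tendsto
    (u := fun j x => F (mollify (φ j) u x, mollify (φ j) v x))
    (g := fun j x => Fa (mollify (φ j) u x, mollify (φ j) v x) • mollify (φ j) g x +
      Fb (mollify (φ j) u x, mollify (φ j) v x) • mollify (φ j) k x)
    (fun j => ?_) (memLp_univ_iff.2 (hF.memLp_comp hu hv))
    (memLp_univ_iff.2 (hF.memLp_grad_comp hu.1 hv.1 hg hk)) ?_ ?_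
  · have hgr : gradient (fun x => F (mollify (φ j) u x, mollify (φ j) v x)) =
        fun x => Fa (mollify (φ j) u x, mollify (φ j) v x) • mollify (φ j) g x +
          Fb (mollify (φ j) u x, mollify (φ j) v x) • mollify (φ j) k x := by
      funext x
      rw [hF.gradient_comp (cu j) (cv j), gradient_mollify _ h₁, gradient_mollify _ h₂]
    rw [← hgr]
    refine hasL2Gradient_of_contDiff (hF.contDiff.comp ((cu j).prodMk (cv j)))
      (memLp_univ_iff.2 (hF.memLp_comp (mu j) (mv j))) ?_
    rw [hgr]
    exact memLp_univ_iff.2 (hF.memLp_grad_comp (mu j).1 (mv j).1 (mg j) (mk j))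
  · simp only [eLpNorm_restrict_univ]
    have t : Tendsto (fun j => ENNReal.ofReal (2 * C) *
        (eLpNorm (fun x => mollify (φ j) u x - u x) 2 volume +
          eLpNorm (fun x => mollify (φ j) v x - v x) 2 volume)) atTop (𝓝 0) := by
      simpa using ENNReal.Tendsto.const_mul (a := ENNReal.ofReal (2 * C)) (tu.add tv)
        (Or.inr ENNReal.ofReal_ne_top)
    refine tendsto_of_tendsto_of_tendsto_of_le_of_le tendsto_const_nhds t (fun _ => zero_le)
      fun j => ?_
    have m1 : MemLp (fun x => mollify (φ j) u x - u x) 2 volume := (mu j).sub hu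
    have m2 : MemLp (fun x => mollify (φ j) v x - v x) 2 volume := (mv j).sub hv
    refine (eLpNorm_le_mul_eLpNorm_of_ae_le_mul (c := 2 * C)
      (g := (fun x => ‖mollify (φ j) u x - u x‖) + fun x => ‖mollify (φ j) v x - v x‖)
      (ae_of_all _ fun x => ?_) 2).trans ?_
    · refine (hF.abs_sub_le _ _).trans (le_of_eq ?_)
      rw [Pi.add_apply, Real.norm_of_nonneg (by positivity)]
      rfl
    · gcongr
      refine (eLpNorm_add_le m1.1.norm m2.1.norm (by norm_num)).trans ?_
      rw [eLpNorm_norm (fun x => mollify (φ j) u x - u x),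
        eLpNorm_norm (fun x => mollify (φ j) v x - v x)]
  · simp only [eLpNorm_restrict_univ]
    have t1 := tendsto_eLpNorm_coeff_smul (μ := volume)
      (a := fun j x => Fa (mollify (φ j) u x, mollify (φ j) v x))
      (a₀ := fun x => Fa (u x, v x)) mg hg
      (fun j => hF.continuous_fst.comp_aestronglyMeasurable ((mu j).1.prodMk (mv j).1))
      (fun j x => hF.bound_fst _)
      (hlim.mono fun x hx => (hF.continuous_fst.tendsto _).comp hx) tg
    have t2 := tendsto_eLpNorm_coeff_smul (μ := volume)
      (a := fun j x => Fb (mollify (φ j) u x, mollify (φ j) v x))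
      (a₀ := fun x => Fb (u x, v x)) mk hk
      (fun j => hF.continuous_snd.comp_aestronglyMeasurable ((mu j).1.prodMk (mv j).1))
      (fun j x => hF.bound_snd _)
      (hlim.mono fun x hx => (hF.continuous_snd.tendsto _).comp hx) tk
    have t3 := t1.add t2
    rw [add_zero] at t3
    refine tendsto_of_tendsto_of_tendsto_of_le_of_le tendsto_const_nhds t3 (fun _ => zero_le)
      fun j => ?_
    have ma : ∀ j, AEStronglyMeasurable (fun x => Fa (mollify (φ j) u x, mollify (φ j) v x))
      volume := fun j =>
        hF.continuous_fst.comp_aestronglyMeasurable ((mu j).1.prodMk (mv j).1)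
    have mb : ∀ j, AEStronglyMeasurable (fun x => Fb (mollify (φ j) u x, mollify (φ j) v x))
      volume := fun j =>
        hF.continuous_snd.comp_aestronglyMeasurable ((mu j).1.prodMk (mv j).1)
    refine le_trans (le_of_eq ?_) (eLpNorm_add_le
      (((ma j).smul (mg j).1).sub
        ((hF.continuous_fst.comp_aestronglyMeasurable (hu.1.prodMk hv.1)).smul hg.1))
      (((mb j).smul (mk j).1).sub
        ((hF.continuous_snd.comp_aestronglyMeasurable (hu.1.prodMk hv.1)).smul hk.1))
      (by norm_num))
    congr 1
    funext x
    exact add_sub_add_comm _ _ _ _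

/-- Chain rule in `H¹(ℝⁿ)` for a function of one variable with bounded derivative. -/
theorem HasL2Gradient.comp {h : ℝ → ℝ} (hh : ContDiff ℝ 1 h) {C : ℝ} (hC : ∀ t, |deriv h t| ≤ C)
    (h0 : h 0 = 0) {u : Eu n → ℝ} {g : Eu n → Eu n} (hu : HasL2Gradient univ u g) :
    HasL2Gradient univ (fun x => h (u x)) (fun x => deriv h (u x) • g x) := by
  -- The two-variable rule is applied to the pair `(u, u)` with a function that ignores its second
  -- argument.
  have hF : IsC1Bounded (fun p => h p.1) (fun p => deriv h p.1) (fun _ => 0) C :=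
    { hasFDerivAt := fun p => by
        have := ((hh.differentiable one_ne_zero) p.1).hasDerivAt.comp_hasFDerivAt p
          (ContinuousLinearMap.fst ℝ ℝ ℝ).hasFDerivAt
        rw [zero_smul, add_zero]
        exact this
      continuous_fst := (hh.continuous_deriv le_rfl).comp continuous_fst
      continuous_snd := continuous_const
      bound_fst := fun p => hC _
      bound_snd := fun p => by simpa using (abs_nonneg _).trans (hC 0)
      zero := h0 }
  simpa using hF.hasL2Gradient_comp hu hu

/-! ### Capacity estimates -/

theorem capacity_le_of_isCapCompetitor {A : Set (Eu n)} {w : H1 (univ : Set (Eu n))}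
    (h : IsCapCompetitor A w) : capacity A ≤ ENNReal.ofReal (‖w‖ ^ 2) :=
  iInf₂_le w h

theorem exists_isCapCompetitor_of_capacity_lt {A : Set (Eu n)} {ε : ℝ} (hε : 0 < ε)
    (h : capacity A < ENNReal.ofReal (ε ^ 2)) :
    ∃ w : H1 (univ : Set (Eu n)), IsCapCompetitor A w ∧ ‖w‖ < ε := by
  simp only [capacity, iInf_lt_iff] at h
  obtain ⟨w, hw, hlt⟩ := h
  refine ⟨w, hw, lt_of_pow_lt_pow_left₀ 2 hε.le ?_⟩
  exact (ENNReal.ofReal_lt_ofReal_iff (by positivity)).1 hlt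

theorem capacity_eq_zero_of_forall {A : Set (Eu n)}
    (h : ∀ ε > 0, ∃ w : H1 (univ : Set (Eu n)), IsCapCompetitor A w ∧ ‖w‖ ≤ ε) :
    capacity A = 0 := by
  refine le_antisymm (ENNReal.le_of_forall_pos_le_add fun δ hδ _ => ?_) zero_le
  obtain ⟨w, hw, hwε⟩ := h (Real.sqrt δ) (Real.sqrt_pos.2 (by exact_mod_cast hδ))
  refine (capacity_le_of_isCapCompetitor hw).trans ?_
  rw [zero_add, ← ENNReal.ofReal_coe_nnreal]
  refine ENNReal.ofReal_le_ofReal ?_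
  calc ‖w‖ ^ 2 ≤ Real.sqrt (δ : ℝ) ^ 2 := by gcongr
    _ = (δ : ℝ) := Real.sq_sqrt δ.2

theorem isCapCompetitor_mono {A B : Set (Eu n)} (h : A ⊆ B) {w : H1 (univ : Set (Eu n))}
    (hw : IsCapCompetitor B w) : IsCapCompetitor A w := by
  obtain ⟨h0, G, hG, hBG, h1⟩ := hw
  exact ⟨h0, G, hG, h.trans hBG, h1⟩

theorem isClosed_fn_nonneg :
    IsClosed {w : H1 (univ : Set (Eu n)) | ∀ᵐ x ∂volume, 0 ≤ fn w x} := by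
  have : {w : H1 (univ : Set (Eu n)) | ∀ᵐ x ∂volume, 0 ≤ fn w x} = (fun w => fn w) ⁻¹' Ici 0 := by
    ext w
    rw [mem_preimage, mem_Ici, ← Lp.coeFn_nonneg, mem_ofPred_eq]
    constructor
    · intro h
      exact ae_restrict_of_ae h
    · intro h
      exact ae_univ h
  rw [this]
  exact isClosed_Ici.preimage continuous_fn

/-- Competitors are nonnegative, so the sum of the series dominates each term almost everywhere: the
remaining finite sums are nonnegative and nonnegativity is a closed condition. Hence the sum is at
least `1` on the union of the neighbourhoods. -/
theorem isCapCompetitor_tsum {A : ℕ → Set (Eu n)} {e : ℕ → H1 (univ : Set (Eu n))}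
    (he : ∀ k, IsCapCompetitor (A k) (e k)) (hs : Summable e) :
    IsCapCompetitor (⋃ k, A k) (∑' k, e k) := by
  have hfin : ∀ s : Finset ℕ, ∀ᵐ x ∂volume, 0 ≤ fn (∑ k ∈ s, e k) x := by
    intro s
    induction s using Finset.induction_on with
    | empty =>
      rw [Finset.sum_empty]
      filter_upwards [fn_zero_ae (n := n)] with x hx
      exact hx.ge
    | insert a s ha ih =>
      rw [Finset.sum_insert ha]
      filter_upwards [fn_add_ae (e a) (∑ k ∈ s, e k), ih, (he a).1] with x h1 h2 h3
      rw [h1]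
      exact add_nonneg h3 h2
  have h0 : ∀ᵐ x ∂volume, 0 ≤ fn (∑' k, e k) x :=
    isClosed_fn_nonneg.mem_of_tendsto hs.hasSum (Eventually.of_forall hfin)
  have hk : ∀ k, ∀ᵐ x ∂volume, fn (e k) x ≤ fn (∑' k, e k) x := by
    intro k
    have h1 : Tendsto (fun s : Finset ℕ => ∑ i ∈ s, e i - e k) atTop (𝓝 ((∑' k, e k) - e k)) :=
      hs.hasSum.sub_const _
    have h2 : ∀ᵐ x ∂volume, 0 ≤ fn ((∑' k, e k) - e k) x := by
      refine isClosed_fn_nonneg.mem_of_tendsto h1 ?_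
      filter_upwards [eventually_ge_atTop {k}] with s hs
      have hks : k ∈ s := hs (Finset.mem_singleton_self k)
      rw [← Finset.add_sum_erase s e hks, add_sub_cancel_left]
      exact hfin _
    filter_upwards [h2, ae_univ (coeFn_fn_sub (∑' k, e k) (e k))] with x h3 h4
    rw [h4] at h3
    linarith
  choose G hG hAG hG1 using fun k => (he k).2
  refine ⟨h0, ⋃ k, G k, isOpen_iUnion hG, iUnion_mono hAG, ?_⟩
  filter_upwards [ae_all_iff.2 hk, ae_all_iff.2 hG1] with x h1 h2 hx
  obtain ⟨k, hxk⟩ := mem_iUnion.1 hx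
  exact (h2 k hxk).trans (h1 k)

/-- Countable subadditivity at the level of the norms of competitors rather than their squares. -/
theorem exists_isCapCompetitor_iUnion {A : ℕ → Set (Eu n)} {b : ℕ → ℝ} {S : ℝ} (hb : HasSum b S)
    (h : ∀ k, ∃ e : H1 (univ : Set (Eu n)), IsCapCompetitor (A k) e ∧ ‖e‖ ≤ b k) :
    ∃ e : H1 (univ : Set (Eu n)), IsCapCompetitor (⋃ k, A k) e ∧ ‖e‖ ≤ S := by
  choose e he hle using h
  exact ⟨∑' k, e k, isCapCompetitor_tsum he (Summable.of_norm_bounded hb.summable hle),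
    tsum_of_norm_bounded hb hle⟩

theorem exists_isCapCompetitor_of_capacity_eq_zero {A : Set (Eu n)} (h : capacity A = 0)
    {ε : ℝ} (hε : 0 < ε) :
    ∃ w : H1 (univ : Set (Eu n)), IsCapCompetitor A w ∧ ‖w‖ ≤ ε := by
  obtain ⟨w, h1, h2⟩ := exists_isCapCompetitor_of_capacity_lt (A := A) hε
    (by rw [h]; exact ENNReal.ofReal_pos.2 (by positivity))
  exact ⟨w, h1, h2.le⟩

theorem capacity_iUnion_eq_zero {A : ℕ → Set (Eu n)} (h : ∀ k, capacity (A k) = 0) :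
    capacity (⋃ k, A k) = 0 := by
  refine capacity_eq_zero_of_forall fun ε hε => ?_
  refine exists_isCapCompetitor_iUnion (hasSum_geometric_two' ε) fun k => ?_
  exact exists_isCapCompetitor_of_capacity_eq_zero (h k) (by positivity)

theorem capacity_union_eq_zero {A B : Set (Eu n)} (hA : capacity A = 0) (hB : capacity B = 0) :
    capacity (A ∪ B) = 0 :=
  le_antisymm ((capacity_union_le A B).trans (by simp [hA, hB])) zero_le

theorem capacity_eq_zero_mono {A B : Set (Eu n)} (h : A ⊆ B) (hB : capacity B = 0) :
    capacity A = 0 :=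
  le_antisymm ((capacity_mono h).trans hB.le) zero_le

/-- Chebyshev's inequality for a competitor. Its use is that sets of zero capacity are Lebesgue
null. -/
theorem volume_le_capacity (A : Set (Eu n)) : volume A ≤ capacity A := by
  refine le_iInf₂ fun w hw => ?_
  obtain ⟨-, G, hG, hAG, h1⟩ := hw
  have hw2 : MemLp (fn w) 2 volume := memLp_univ_iff.1 (hasL2Gradient w).memLp
  calc volume A ≤ volume G := measure_mono hAG
    _ = ∫⁻ x in G, 1 := by simp
    _ ≤ ∫⁻ x in G, ‖fn w x‖ₑ ^ 2 := by
        refine setLIntegral_mono_ae' hG.measurableSet ?_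
        filter_upwards [h1] with x hx hxG
        refine one_le_pow₀ ?_
        rw [← ofReal_norm, ← ENNReal.ofReal_one]
        exact ENNReal.ofReal_le_ofReal ((hx hxG).trans (le_abs_self _))
    _ ≤ ∫⁻ x, ‖fn w x‖ₑ ^ 2 := setLIntegral_le_lintegral _ _
    _ = eLpNorm (fn w) 2 volume ^ 2 := (eLpNorm_two_sq _).symm
    _ = ENNReal.ofReal (‖fn w‖ ^ 2) := by
        rw [Lp.norm_def, eLpNorm_restrict_univ, ENNReal.ofReal_pow ENNReal.toReal_nonneg,
          ENNReal.ofReal_toReal hw2.2.ne]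
    _ ≤ ENNReal.ofReal (‖w‖ ^ 2) := by
        gcongr
        exact norm_fn_le w

theorem ae_notMem_of_capacity_eq_zero {A : Set (Eu n)} (h : capacity A = 0) :
    ∀ᵐ x ∂(volume : Measure (Eu n)), x ∉ A :=
  measure_eq_zero_iff_ae_notMem.1 (le_antisymm ((volume_le_capacity A).trans h.le) zero_le)

/-- Capacitary weak-type estimate for continuous Sobolev functions. -/
theorem exists_isCapCompetitor_abs_gt {φ : Eu n → ℝ} (hφ : Continuous φ)
    {w : H1 (univ : Set (Eu n))} (hw : ∀ᵐ x ∂volume, φ x = fn w x) {r : ℝ} (hr : 0 < r) :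
    ∃ e : H1 (univ : Set (Eu n)), IsCapCompetitor {x | r < |φ x|} e ∧ ‖e‖ ≤ 2 / r * ‖w‖ := by
  -- A smooth substitute for `min (|t| / r) 1`: it is at least `1` once `|t| ≥ r`, and both `|h'|`
  -- and `|h t| / |t|` are at most `2 / r` since `2 r |t| ≤ r² + t²`.
  set h : ℝ → ℝ := fun t => 2 * t ^ 2 / (r ^ 2 + t ^ 2) with hh
  have hpos : ∀ t : ℝ, 0 < r ^ 2 + t ^ 2 := fun t => by positivity
  have hd : ∀ t, HasDerivAt h (4 * r ^ 2 * t / (r ^ 2 + t ^ 2) ^ 2) t := by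
    intro t
    have h1 : HasDerivAt (fun t : ℝ => 2 * t ^ 2) (2 * (2 * t)) t := by
      simpa using (hasDerivAt_pow 2 t).const_mul 2
    have h2 : HasDerivAt (fun t : ℝ => r ^ 2 + t ^ 2) (2 * t) t := by
      simpa using (hasDerivAt_pow 2 t).const_add (r ^ 2)
    refine (h1.div h2 (hpos t).ne').congr_deriv ?_
    congr 1
    ring
  have hsm : ContDiff ℝ 1 h :=
    (contDiff_const.mul (contDiff_id.pow 2)).div (contDiff_const.add (contDiff_id.pow 2))
      fun t => (hpos t).ne'
  have hdb : ∀ t, |deriv h t| ≤ 2 / r := by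
    intro t
    rw [(hd t).deriv, abs_div, abs_of_pos (pow_pos (hpos t) 2), div_le_div_iff₀
      (pow_pos (hpos t) 2) hr, abs_mul, abs_of_nonneg (show 0 ≤ 4 * r ^ 2 by positivity)]
    have h1 : 2 * r * |t| ≤ r ^ 2 + t ^ 2 := by
      rw [← sq_abs t]; nlinarith [sq_nonneg (r - |t|)]
    have h2 : r ^ 2 ≤ r ^ 2 + t ^ 2 := by nlinarith [sq_nonneg t]
    have h3 := mul_le_mul h1 h2 (sq_nonneg r) (hpos t).le
    nlinarith
  have hb : ∀ t, |h t| ≤ 2 / r * |t| := by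
    intro t
    have h1 : 2 * r * |t| ≤ r ^ 2 + t ^ 2 := by
      rw [← sq_abs t]; nlinarith [sq_nonneg (r - |t|)]
    rw [hh, abs_of_nonneg (by positivity), div_le_iff₀ (hpos t), ← sq_abs t]
    rw [← sq_abs t] at h1
    have h2 : |t| * (2 * r * |t|) ≤ |t| * (r ^ 2 + |t| ^ 2) := by gcongr
    rw [div_mul_eq_mul_div, div_mul_eq_mul_div, le_div_iff₀ hr]
    nlinarith [abs_nonneg t, sq_nonneg (|t| * r), mul_nonneg (abs_nonneg t) (sq_nonneg r),
      mul_nonneg (abs_nonneg t) (sq_nonneg |t|)]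
  have hL := (hasL2Gradient w).comp hsm hdb (by simp [hh])
  refine ⟨hL.toH1, ⟨?_, {x | r < |φ x|}, isOpen_lt continuous_const hφ.abs, subset_rfl, ?_⟩, ?_⟩
  · filter_upwards [ae_univ hL.fn_toH1] with x hx
    rw [hx]
    positivity
  · filter_upwards [ae_univ hL.fn_toH1, hw] with x hx h1 h2
    rw [hx, ← h1, hh, le_div_iff₀ (hpos _), one_mul]
    have h3 : r < |φ x| := h2
    have h4 : r ^ 2 ≤ φ x ^ 2 := by rw [← sq_abs (φ x)]; gcongr
    linarith
  · refine le_of_sq_le_sq ?_ (by positivity)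
    rw [hL.norm_sq_toH1, mul_pow, h1_norm_sq_integral, mul_add, ← integral_const_mul,
      ← integral_const_mul]
    refine add_le_add ?_ ?_
    · refine integral_mono hL.memLp.integrable_norm_sq
        ((hasL2Gradient w).memLp.integrable_norm_sq.const_mul _) fun x => ?_
      simp only
      rw [← mul_pow]
      gcongr
      exact hb _
    · refine integral_mono hL.memLp_grad.integrable_norm_sq
        ((hasL2Gradient w).memLp_grad.integrable_norm_sq.const_mul _) fun x => ?_
      simp only
      rw [← mul_pow, norm_smul]
      gcongr
      exact hdb _

/-! ### Quasi-continuous representatives -/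

theorem tendsto_eLpNorm_of_tendsto_lp {α E : Type*} [MeasurableSpace α] {μ : Measure α}
    [NormedAddCommGroup E] {f : ℕ → Lp E 2 μ} {g : Lp E 2 μ} (h : Tendsto f atTop (𝓝 g)) :
    Tendsto (fun j => eLpNorm (fun x => f j x - g x) 2 μ) atTop (𝓝 0) :=
  (Lp.tendsto_Lp_iff_tendsto_eLpNorm' f g).1 h

theorem tendsto_eLpNorm_fn_sub {U : Set (Eu n)} {v : ℕ → H1 U} {w : H1 U}
    (h : Tendsto v atTop (𝓝 w)) :
    Tendsto (fun j => eLpNorm (fun x => fn (v j) x - fn w x) 2 (volume.restrict U)) atTop (𝓝 0) :=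
  tendsto_eLpNorm_of_tendsto_lp ((continuous_fn.tendsto w).comp h)

theorem tendsto_const_mul_half_pow (c : ℝ) :
    Tendsto (fun m : ℕ => c * (1 / 2 : ℝ) ^ m) atTop (𝓝 0) := by
  simpa using (tendsto_pow_atTop_nhds_zero_of_lt_one (r := (1 / 2 : ℝ)) (by norm_num)
    (by norm_num)).const_mul c

/-- Continuous functions whose consecutive differences are small off sets of small capacity
converge quasi-everywhere to a quasi-continuous function. -/
theorem exists_quasiContinuous_limit {ψ : ℕ → Eu n → ℝ} (hψ : ∀ j, Continuous (ψ j))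
    (hG : ∀ j, ∃ e : H1 (univ : Set (Eu n)),
      IsCapCompetitor {x | (1 / 2) ^ j < |ψ (j + 1) x - ψ j x|} e ∧ ‖e‖ ≤ 4 * (1 / 2) ^ j) :
    ∃ (f : Eu n → ℝ) (N : Set (Eu n)), QuasiContinuous f ∧ capacity N = 0 ∧
      ∀ x ∉ N, Tendsto (fun j => ψ j x) atTop (𝓝 (f x)) := by
  -- Off `V m` all differences from index `m` on are geometrically small, so convergence is uniform
  -- there, while the competitors of the pieces sum to norm at most `8 * (1 / 2) ^ m`.
  set V : ℕ → Set (Eu n) := fun m => ⋃ i, {x | (1 / 2) ^ (m + i) < |ψ (m + i + 1) x - ψ (m + i) x|}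
    with hV
  have hVo : ∀ m, IsOpen (V m) := fun m => isOpen_iUnion fun i =>
    isOpen_lt continuous_const ((hψ _).sub (hψ _)).abs
  have hVe : ∀ m, ∃ e : H1 (univ : Set (Eu n)), IsCapCompetitor (V m) e ∧
      ‖e‖ ≤ 8 * (1 / 2) ^ m := by
    intro m
    have h1 : HasSum (fun i : ℕ => 4 * (1 / 2 : ℝ) ^ (m + i)) (8 * (1 / 2) ^ m) := by
      have h2 := hasSum_geometric_two.mul_left (4 * (1 / 2 : ℝ) ^ m)
      rw [show 4 * (1 / 2 : ℝ) ^ m * 2 = 8 * (1 / 2) ^ m by ring] at h2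
      simpa only [pow_add, mul_assoc] using h2
    exact exists_isCapCompetitor_iUnion h1 fun i => hG (m + i)
  -- The bound is written as `C / 2 / 2 ^ i` with `C = 2`, the shape used by the geometric Cauchy
  -- criterion; the distance to the limit is then at most `2 / 2 ^ i`.
  have hconv : ∀ m, ∀ x ∉ V m, ∀ i,
      dist (ψ (m + i) x) (ψ (m + (i + 1)) x) ≤ (2 / 2) / 2 ^ i := by
    intro m x hx i
    have h1 : ¬ (1 / 2) ^ (m + i) < |ψ (m + i + 1) x - ψ (m + i) x| :=
      fun h => hx (mem_iUnion.2 ⟨i, h⟩)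
    rw [not_lt] at h1
    rw [dist_comm, Real.dist_eq, ← add_assoc]
    refine h1.trans ?_
    rw [pow_add, one_div_pow (2 : ℝ) i, div_self two_ne_zero]
    exact mul_le_of_le_one_left (by positivity) (pow_le_one₀ (by norm_num) (by norm_num))
  -- Where the sequence diverges `limUnder` has an arbitrary value; such points lie in every `V m`,
  -- a set of zero capacity.
  set f : Eu n → ℝ := fun x => limUnder atTop fun j => ψ j x with hf
  have hlim : ∀ m, ∀ x ∉ V m, Tendsto (fun j => ψ j x) atTop (𝓝 (f x)) := by
    intro m x hx
    obtain ⟨l, hl⟩ := cauchySeq_tendsto_of_complete (cauchySeq_of_le_geometric_two (hconv m x hx))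
    have h2 : Tendsto (fun j => ψ j x) atTop (𝓝 l) := by
      rw [← tendsto_add_atTop_iff_nat m]
      simpa only [add_comm m] using hl
    exact tendsto_nhds_limUnder ⟨l, h2⟩
  refine ⟨f, ⋂ m, V m, fun ε hε => ?_, ?_, ?_⟩
  · have ht : Tendsto (fun m : ℕ => ENNReal.ofReal ((8 * (1 / 2 : ℝ) ^ m) ^ 2)) atTop (𝓝 0) := by
      simpa using ENNReal.tendsto_ofReal ((tendsto_const_mul_half_pow 8).pow 2)
    obtain ⟨m, hm⟩ := (ht.eventually (eventually_lt_nhds hε)).exists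
    obtain ⟨e, he, hle⟩ := hVe m
    refine ⟨V m, hVo m, ((capacity_le_of_isCapCompetitor he).trans
      (ENNReal.ofReal_le_ofReal (pow_le_pow_left₀ (norm_nonneg _) hle 2))).trans_lt hm, ?_⟩
    have hu : TendstoUniformlyOn (fun i x => ψ (m + i) x) f atTop (V m)ᶜ := by
      rw [Metric.tendstoUniformlyOn_iff]
      intro δ hδ
      have ht2 : Tendsto (fun i : ℕ => (2 : ℝ) / 2 ^ i) atTop (𝓝 0) := by
        refine (tendsto_const_mul_half_pow 2).congr fun i => ?_
        rw [one_div_pow, mul_one_div]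
      filter_upwards [ht2.eventually (eventually_lt_nhds hδ)] with i hi x hx
      rw [dist_comm]
      refine (dist_le_of_le_geometric_two_of_tendsto (hconv m x hx) ?_ i).trans_lt hi
      have := (tendsto_add_atTop_iff_nat m).2 (hlim m x hx)
      simpa only [add_comm m] using this
    exact hu.continuousOn (Frequently.of_forall fun i => (hψ _).continuousOn)
  · refine capacity_eq_zero_of_forall fun ε hε => ?_
    obtain ⟨m, hm⟩ := ((tendsto_const_mul_half_pow 8).eventually (eventually_le_nhds hε)).exists
    obtain ⟨e, he, hle⟩ := hVe m
    exact ⟨e, isCapCompetitor_mono (iInter_subset _ m) he, hle.trans hm⟩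
  · intro x hx
    obtain ⟨m, hm⟩ := not_forall.1 (fun h => hx (mem_iInter.2 h))
    exact hlim m x hm

/-- A sequence converging in `H¹(ℝⁿ)` has a rapidly converging subsequence which also converges
almost everywhere. -/
theorem exists_fast_subseq {v : ℕ → H1 (univ : Set (Eu n))}
    {w : H1 (univ : Set (Eu n))} (hvw : Tendsto v atTop (𝓝 w)) :
    ∃ ns : ℕ → ℕ, StrictMono ns ∧
      (∀ᵐ x ∂volume, Tendsto (fun j => fn (v (ns j)) x) atTop (𝓝 (fn w x))) ∧
      ∀ j, ‖v (ns (j + 1)) - v (ns j)‖ ≤ 2 * (1 / 4) ^ j := by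
  have hwL : MemLp (fn w) 2 volume := memLp_univ_iff.1 (hasL2Gradient w).memLp
  have hvL : ∀ j, MemLp (fn (v j)) 2 volume := fun j =>
    memLp_univ_iff.1 (hasL2Gradient (v j)).memLp
  have h1 : Tendsto (fun j => eLpNorm (fun x => fn (v j) x - fn w x) 2 volume) atTop (𝓝 0) :=
    (tendsto_eLpNorm_fn_sub hvw).congr fun j => eLpNorm_restrict_univ _
  obtain ⟨ms, hms, hae⟩ := exists_subseq_tendsto_ae (f := fun j x => fn (v j) x)
    (g := fun x => fn w x) (fun j => (hvL j).1) hwL.1 h1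
  obtain ⟨ks, hks, hk⟩ : ∃ ks : ℕ → ℕ, StrictMono ks ∧
      ∀ j, ‖v (ms (ks j)) - w‖ ≤ (1 / 4) ^ j := by
    refine extraction_forall_of_eventually' (P := fun j i => ‖v (ms i) - w‖ ≤ (1 / 4) ^ j)
      fun j => ?_
    have h1 : Tendsto (fun i => ‖v (ms i) - w‖) atTop (𝓝 0) :=
      tendsto_iff_norm_sub_tendsto_zero.1 (hvw.comp hms.tendsto_atTop)
    exact eventually_atTop.1 (h1.eventually (eventually_le_nhds (by positivity)))
  refine ⟨ms ∘ ks, hms.comp hks, ?_, fun j => ?_⟩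
  · filter_upwards [hae] with x hx
    exact hx.comp hks.tendsto_atTop
  · calc ‖v (ms (ks (j + 1))) - v (ms (ks j))‖
        ≤ ‖v (ms (ks (j + 1))) - w‖ + ‖w - v (ms (ks j))‖ :=
          norm_sub_le_norm_sub_add_norm_sub _ _ _
      _ ≤ (1 / 4) ^ (j + 1) + (1 / 4) ^ j := by
          rw [norm_sub_rev w]
          exact add_le_add (hk _) (hk _)
      _ ≤ 2 * (1 / 4) ^ j := by
          rw [pow_succ]
          have : (0 : ℝ) < (1 / 4) ^ j := by positivity
          linarith

/-- A sequence of continuous functions converging in `H¹(ℝⁿ)` has a subsequence converging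
quasi-everywhere to a quasi-continuous representative of the limit. -/
theorem exists_subseq_tendsto_qe {φ : ℕ → Eu n → ℝ} (hφ : ∀ j, Continuous (φ j))
    {v : ℕ → H1 (univ : Set (Eu n))} (hv : ∀ j, ∀ᵐ x ∂volume, φ j x = fn (v j) x)
    {w : H1 (univ : Set (Eu n))} (hvw : Tendsto v atTop (𝓝 w)) :
    ∃ (ns : ℕ → ℕ) (f : Eu n → ℝ) (N : Set (Eu n)), StrictMono ns ∧ IsQuasiContRep f w ∧
      capacity N = 0 ∧ ∀ x ∉ N, Tendsto (fun j => φ (ns j) x) atTop (𝓝 (f x)) := by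
  obtain ⟨ns, hns, hae, hfast⟩ := exists_fast_subseq hvw
  have hGe : ∀ j, ∃ e : H1 (univ : Set (Eu n)),
      IsCapCompetitor {x | (1 / 2) ^ j < |φ (ns (j + 1)) x - φ (ns j) x|} e ∧
      ‖e‖ ≤ 4 * (1 / 2) ^ j := by
    intro j
    obtain ⟨e, he, hle⟩ := exists_isCapCompetitor_abs_gt
      (φ := fun x => φ (ns (j + 1)) x - φ (ns j) x) ((hφ _).sub (hφ _))
      (w := v (ns (j + 1)) - v (ns j)) (by
        filter_upwards [hv (ns (j + 1)), hv (ns j),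
          ae_univ (coeFn_fn_sub (v (ns (j + 1))) (v (ns j)))] with x h1 h2 h3
        rw [h1, h2, h3]) (r := (1 / 2) ^ j) (by positivity)
    refine ⟨e, he, hle.trans ?_⟩
    -- The distances decay like `4⁻ʲ` against thresholds `2⁻ʲ`, so the competitor norms still decay
    -- like `2⁻ʲ`.
    calc 2 / (1 / 2) ^ j * ‖v (ns (j + 1)) - v (ns j)‖
        ≤ 2 / (1 / 2) ^ j * (2 * (1 / 4) ^ j) := by gcongr; exact hfast j
      _ = 4 * (1 / 2) ^ j := by
          rw [show (1 / 4 : ℝ) = 1 / 2 * (1 / 2) by norm_num, mul_pow]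
          field_simp
          ring
  obtain ⟨f, N, hf, hN, hlim⟩ := exists_quasiContinuous_limit (fun j => hφ (ns j)) hGe
  refine ⟨ns, f, N, hns, ⟨hf, ?_⟩, hN, hlim⟩
  filter_upwards [ae_notMem_of_capacity_eq_zero hN, hae, ae_all_iff.2 hv] with x h1 h2 h3
  exact tendsto_nhds_unique (hlim x h1) (h2.congr fun j => (h3 _).symm)

theorem continuous_mollify_fn (φ : ContDiffBump (0 : Eu n)) (w : H1 (univ : Set (Eu n))) :
    Continuous (mollify φ (fn w)) :=
  (contDiff_mollify φ ((memLp_univ_iff.1 (hasL2Gradient w).memLp).locallyIntegrable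
    (by norm_num))).continuous

theorem mollify_ae_eq_fn (φ : ContDiffBump (0 : Eu n)) (w : H1 (univ : Set (Eu n))) :
    ∀ᵐ x ∂volume, mollify φ (fn w) x = fn (mollifyH1 φ w) x := by
  filter_upwards [ae_univ ((hasL2Gradient w).mollify φ).fn_toH1] with x hx
  exact hx.symm

/-- Mollifications are continuous and converge in `H¹(ℝⁿ)`. This makes the first branch in the
definition of `trace` the one that always applies. -/
theorem exists_isQuasiContRep (w : H1 (univ : Set (Eu n))) : ∃ f, IsQuasiContRep f w := by
  obtain ⟨ns, f, N, -, hf, -⟩ := exists_subseq_tendsto_qe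
    (fun j => continuous_mollify_fn (bumpSeq n j) w)
    (fun j => mollify_ae_eq_fn (bumpSeq n j) w)
    (tendsto_mollifyH1 w (tendsto_bumpSeq_rOut (n := n)))
  exact ⟨f, hf⟩

/-- Quasi-continuous functions that agree almost everywhere on an open set agree
quasi-everywhere on it. -/
theorem QuasiContinuous.capacity_ne_eq_zero {f g : Eu n → ℝ} (hf : QuasiContinuous f)
    (hg : QuasiContinuous g) {O : Set (Eu n)} (hO : IsOpen O)
    (h : ∀ᵐ x ∂volume, x ∈ O → f x = g x) : capacity {x | x ∈ O ∧ f x ≠ g x} = 0 := by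
  refine capacity_eq_zero_of_forall fun ε hε => ?_
  have hpos : 0 < ENNReal.ofReal (ε ^ 2) / 4 :=
    ENNReal.div_pos (ENNReal.ofReal_pos.2 (by positivity)).ne' (by simp)
  obtain ⟨G₁, hG₁, hc₁, hf₁⟩ := hf _ hpos
  obtain ⟨G₂, hG₂, hc₂, hg₂⟩ := hg _ hpos
  set G := G₁ ∪ G₂ with hG
  have hGo : IsOpen G := hG₁.union hG₂
  have hcap : capacity G < ENNReal.ofReal (ε ^ 2) := by
    refine (capacity_union_le G₁ G₂).trans_lt ?_
    calc 2 * capacity G₁ + 2 * capacity G₂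
        < 2 * (ENNReal.ofReal (ε ^ 2) / 4) + 2 * (ENNReal.ofReal (ε ^ 2) / 4) :=
          ENNReal.add_lt_add ((ENNReal.mul_lt_mul_iff_right (by simp) (by simp)).2 hc₁)
            ((ENNReal.mul_lt_mul_iff_right (by simp) (by simp)).2 hc₂)
      _ = ENNReal.ofReal (ε ^ 2) := by
          rw [← add_mul]
          norm_num
          exact ENNReal.mul_div_cancel (by simp) (by simp)
  obtain ⟨e, ⟨he0, G', hG', hGG', he1⟩, hle⟩ := exists_isCapCompetitor_of_capacity_lt hε hcap
  have hfc : ContinuousOn (fun x => f x - g x) Gᶜ :=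
    (hf₁.mono (compl_subset_compl.2 subset_union_left)).sub
      (hg₂.mono (compl_subset_compl.2 subset_union_right))
  -- Off `G` the difference `f - g` is continuous, so `{f ≠ g}` is there the trace of an open set
  -- `W`. Almost no point of `O ∩ W` lies outside `G'`, and so `e` remains a competitor on the
  -- larger open set `(O ∩ W) ∪ G'`.
  obtain ⟨W, hW, hWeq⟩ := (continuousOn_iff'.1 hfc) {0}ᶜ isOpen_compl_singleton
  have hmem : ∀ x, x ∉ G → (x ∈ W ↔ f x ≠ g x) := by
    intro x hx
    have h1 : x ∈ (fun x => f x - g x) ⁻¹' {0}ᶜ ∩ Gᶜ ↔ x ∈ W ∩ Gᶜ := by rw [hWeq]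
    simp only [mem_inter_iff, mem_compl_iff, hx, not_false_eq_true, and_true, mem_preimage,
      mem_singleton_iff, sub_eq_zero] at h1
    exact h1.symm
  refine ⟨e, ⟨he0, (O ∩ W) ∪ G', (hO.inter hW).union hG', ?_, ?_⟩, hle.le⟩
  · rintro x ⟨hxO, hne⟩
    by_cases hxG : x ∈ G
    · exact Or.inr (hGG' hxG)
    · exact Or.inl ⟨hxO, (hmem x hxG).2 hne⟩
  · filter_upwards [he1, h] with x h1 h2 hx
    by_cases hxG' : x ∈ G'
    · exact h1 hxG'
    · rcases hx with ⟨hxO, hxW⟩ | hx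
      · exact absurd (h2 hxO) ((hmem x fun hxG => hxG' (hGG' hxG)).1 hxW)
      · exact absurd hx hxG'

theorem QuasiContinuous.comp {f : Eu n → ℝ} (hf : QuasiContinuous f) {h : ℝ → ℝ}
    (hh : Continuous h) : QuasiContinuous fun x => h (f x) := by
  intro ε hε
  obtain ⟨G, hG, hGε, hc⟩ := hf ε hε
  exact ⟨G, hG, hGε, hh.comp_continuousOn hc⟩

/-! ### Cutoff functions -/

/-- The derivative is continuous and vanishes outside `[0, 1]`. -/
theorem exists_abs_deriv_smoothTransition_le :
    ∃ L : ℝ, 0 < L ∧ ∀ t, |deriv Real.smoothTransition t| ≤ L := by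
  have hc : Continuous (deriv Real.smoothTransition) :=
    (Real.smoothTransition.contDiff (n := 1)).continuous_deriv le_rfl
  obtain ⟨L, hL⟩ := isCompact_Icc.exists_bound_of_continuousOn (s := Icc (0 : ℝ) 1) hc.continuousOn
  refine ⟨max L 1, by positivity, fun t => ?_⟩
  by_cases ht : t ∈ Icc (0 : ℝ) 1
  · exact (hL t ht).trans (le_max_left _ _)
  · have : deriv Real.smoothTransition t = 0 := by
      rw [mem_Icc, not_and_or, not_le, not_le] at ht
      rcases ht with ht | ht
      · have : Real.smoothTransition =ᶠ[𝓝 t] fun _ => 0 := by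
          filter_upwards [eventually_lt_nhds ht] with s hs
          exact Real.smoothTransition.zero_of_nonpos hs.le
        rw [this.deriv_eq]; simp
      · have : Real.smoothTransition =ᶠ[𝓝 t] fun _ => 1 := by
          filter_upwards [eventually_gt_nhds ht] with s hs
          exact Real.smoothTransition.one_of_one_le hs.le
        rw [this.deriv_eq]; simp
    rw [this, abs_zero]
    positivity

/-- Cutoff functions between concentric balls, with a gradient bound inversely proportional to
the difference of the radii. -/
theorem exists_cutoff (n : ℕ) : ∃ L : ℝ, 0 < L ∧ ∀ (x₀ : Eu n) (a b : ℝ), 0 < a → a < b →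
    ∃ φ : Eu n → ℝ, ContDiff ℝ 1 φ ∧ HasCompactSupport φ ∧ (∀ x, |φ x| ≤ 1) ∧
      (∀ x ∈ Metric.closedBall x₀ a, φ x = 1) ∧ (∀ x ∉ Metric.closedBall x₀ b, φ x = 0) ∧
      (∀ x, ‖gradient φ x‖ ≤ L / (b - a)) ∧
      ∀ x ∉ Metric.closedBall x₀ b, gradient φ x = 0 := by
  obtain ⟨L, hL, hLd⟩ := exists_abs_deriv_smoothTransition_le
  refine ⟨2 * L, by positivity, fun x₀ a b ha hab => ?_⟩
  have hb : 0 < b := ha.trans hab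
  have hD : 0 < b ^ 2 - a ^ 2 := by nlinarith
  set D := b ^ 2 - a ^ 2 with hDdef
  -- Squared distances keep the function smooth at the centre. The factor `b / (b ^ 2 - a ^ 2)` in
  -- the gradient is still at most `1 / (b - a)`.
  set φ : Eu n → ℝ := fun x => Real.smoothTransition ((b ^ 2 - ‖x - x₀‖ ^ 2) / D) with hφ
  have hsm : ContDiff ℝ 1 φ := by
    refine Real.smoothTransition.contDiff.comp ?_
    exact (contDiff_const.sub ((contDiff_id.sub contDiff_const).norm_sq ℝ)).div_const _
  have hz : ∀ x ∉ Metric.closedBall x₀ b, φ x = 0 := by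
    intro x hx
    rw [Metric.mem_closedBall, not_le, dist_eq_norm] at hx
    refine Real.smoothTransition.zero_of_nonpos (div_nonpos_of_nonpos_of_nonneg ?_ hD.le)
    nlinarith [norm_nonneg (x - x₀)]
  have hgz : ∀ x ∉ Metric.closedBall x₀ b, gradient φ x = 0 := by
    intro x hx
    have : φ =ᶠ[𝓝 x] fun _ => 0 := by
      filter_upwards [Metric.isClosed_closedBall.isOpen_compl.mem_nhds hx] with y hy
      exact hz y hy
    rw [← norm_eq_zero, norm_gradient, this.fderiv_eq]
    simp
  refine ⟨φ, hsm, ?_, fun x => ?_, fun x hx => ?_, hz, fun x => ?_, hgz⟩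
  · refine HasCompactSupport.intro (isCompact_closedBall x₀ b) hz
  · rw [abs_of_nonneg (Real.smoothTransition.nonneg _)]
    exact Real.smoothTransition.le_one _
  · rw [Metric.mem_closedBall, dist_eq_norm] at hx
    refine Real.smoothTransition.one_of_one_le ?_
    rw [one_le_div hD]
    have := pow_le_pow_left₀ (norm_nonneg _) hx 2
    linarith
  · by_cases hx : x ∈ Metric.closedBall x₀ b
    · rw [Metric.mem_closedBall, dist_eq_norm] at hx
      have h1 : HasFDerivAt (fun x => (b ^ 2 - ‖x - x₀‖ ^ 2) / D)
          ((-(2 / D)) • innerSL ℝ (x - x₀)) x := by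
        have h2 : HasFDerivAt (fun y : Eu n => ‖y - x₀‖ ^ 2)
            ((2 • innerSL ℝ (x - x₀)).comp (ContinuousLinearMap.id ℝ (Eu n))) x :=
          ((hasFDerivAt_id x).sub_const x₀).norm_sq
        refine ((h2.const_sub (b ^ 2)).mul_const D⁻¹).congr_fderiv ?_
        ext y
        simp
        ring
      have h3 : fderiv ℝ φ x = deriv Real.smoothTransition ((b ^ 2 - ‖x - x₀‖ ^ 2) / D) •
          ((-(2 / D)) • innerSL ℝ (x - x₀)) :=
        ((((Real.smoothTransition.contDiff (n := 1)).differentiable one_ne_zero)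
          _).hasDerivAt.comp_hasFDerivAt x h1).fderiv
      rw [norm_gradient, h3, norm_smul, norm_smul, innerSL_apply_norm, norm_neg,
        Real.norm_of_nonneg (show 0 ≤ 2 / D by positivity)]
      calc ‖deriv Real.smoothTransition ((b ^ 2 - ‖x - x₀‖ ^ 2) / D)‖ * (2 / D * ‖x - x₀‖)
          ≤ L * (2 / D * b) := by
            gcongr
            exact hLd _
        _ ≤ 2 * L / (b - a) := by
            rw [le_div_iff₀ (by linarith), hDdef, show b ^ 2 - a ^ 2 = (b - a) * (b + a) by ring]
            have hba : 0 < b - a := by linarith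
            rw [show L * (2 / ((b - a) * (b + a)) * b) * (b - a) = 2 * L * (b / (b + a)) by
              field_simp]
            refine mul_le_of_le_one_right (by positivity) ?_
            rw [div_le_one (by positivity)]
            linarith
    · rw [hgz x hx, norm_zero]
      have : 0 < b - a := by linarith
      positivity

/-! ### Measure density of extension domains -/

/-- The bump function with radii `s / 2` and `s`. -/
def bumpOfRadius (n : ℕ) (s : ℝ) (hs : 0 < s) : ContDiffBump (0 : Eu n) where
  rIn := s / 2
  rOut := s
  rIn_pos := by positivity
  rIn_lt_rOut := by linarith

/-- The measure of the part of `Ω` in the closed ball of radius `r` around `x`. -/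
def ballMeas (Ω : Set (Eu n)) (x : Eu n) (r : ℝ) : ℝ :=
  volume.real (Ω ∩ Metric.closedBall x r)

theorem measure_inter_closedBall_ne_top (Ω : Set (Eu n)) (x : Eu n) (r : ℝ) :
    volume (Ω ∩ Metric.closedBall x r) ≠ ⊤ :=
  ((measure_mono inter_subset_right).trans_lt measure_closedBall_lt_top).ne

theorem ballMeas_mono (Ω : Set (Eu n)) (x : Eu n) {r s : ℝ} (h : r ≤ s) :
    ballMeas Ω x r ≤ ballMeas Ω x s :=
  measureReal_mono (inter_subset_inter_right _ (Metric.closedBall_subset_closedBall h))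
    (measure_inter_closedBall_ne_top Ω x s)

theorem ballMeas_pos {Ω : Set (Eu n)} (hΩ : IsOpen Ω) {x : Eu n} (hx : x ∈ closure Ω) {r : ℝ}
    (hr : 0 < r) : 0 < ballMeas Ω x r := by
  have h1 : (Ω ∩ Metric.ball x r).Nonempty := by
    obtain ⟨y, hy, hd⟩ := Metric.mem_closure_iff.1 hx r hr
    exact ⟨y, hy, by rwa [Metric.mem_ball, dist_comm]⟩
  refine ENNReal.toReal_pos ?_ (measure_inter_closedBall_ne_top Ω x r)
  exact (((hΩ.inter Metric.isOpen_ball).measure_pos volume h1).trans_le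
    (measure_mono (inter_subset_inter_right _ Metric.ball_subset_closedBall))).ne'

theorem integral_sq_le_ballMeas {E : Type*} [NormedAddCommGroup E] {Ω : Set (Eu n)}
    {f : Eu n → E} {x₀ : Eu n} {b C : ℝ}
    (hz : ∀ x ∉ Metric.closedBall x₀ b, f x = 0) (hC : ∀ x, ‖f x‖ ≤ C) :
    ∫ x in Ω, ‖f x‖ ^ 2 ≤ C ^ 2 * ballMeas Ω x₀ b := by
  have h1 : ∫ x in Ω, ‖f x‖ ^ 2 = ∫ x in Metric.closedBall x₀ b, ‖f x‖ ^ 2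
      ∂(volume.restrict Ω) :=
    (setIntegral_eq_integral_of_forall_compl_eq_zero fun x hx => by simp [hz x hx]).symm
  have h2 : (volume.restrict Ω).real (Metric.closedBall x₀ b) = ballMeas Ω x₀ b := by
    rw [Measure.real, Measure.restrict_apply measurableSet_closedBall, inter_comm]
    rfl
  rw [h1, ← h2]
  have h3 := norm_setIntegral_le_of_norm_le_const (μ := volume.restrict Ω)
    (s := Metric.closedBall x₀ b) (f := fun x => ‖f x‖ ^ 2) (C := C ^ 2) ?_ ?_
  · exact (le_abs_self _).trans h3
  · exact (Measure.restrict_apply_le _ _).trans_lt measure_closedBall_lt_top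
  · intro x _
    rw [norm_pow, norm_norm]
    exact pow_le_pow_left₀ (norm_nonneg _) (hC x) 2

/-- One step of the De Giorgi iteration for the measures `|Ω ∩ B(x₀, r)|`. -/
theorem exists_ballMeas_step {Ω : Set (Eu n)} (hΩ : IsOpen Ω)
    (T : H1 Ω →L[ℝ] H1 (univ : Set (Eu n))) (hT : IsExtensionOperator T) :
    ∃ K : ℝ, 1 ≤ K ∧ ∀ (x₀ : Eu n) (r a b s : ℝ), 0 < a → a < b → b ≤ r → r ≤ 1 → 0 < s →
      2 * ballMeas Ω x₀ r ≤ ballMeas Ω x₀ (2 * r) →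
      (2 * r) ^ 2 * (1 / ((s / 2) ^ n * volume.real (Metric.ball (0 : Eu n) 1)) *
        (K * ballMeas Ω x₀ b / (b - a) ^ 2)) ≤ 1 / 16 →
      ballMeas Ω x₀ a ≤ 16 * s ^ 2 * (K * ballMeas Ω x₀ b / (b - a) ^ 2) := by
  obtain ⟨L, hL, hcut⟩ := exists_cutoff n
  refine ⟨‖T‖ ^ 2 * (1 + L ^ 2) + 1, le_add_of_nonneg_left (by positivity), ?_⟩
  intro x₀ r a b s ha hab hbr hr hs hdouble hosc
  set K := ‖T‖ ^ 2 * (1 + L ^ 2) + 1 with hK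
  obtain ⟨φ, hφ, hφc, hφ1, hφa, hφb, hφg, hφgz⟩ := hcut x₀ a b ha hab
  have hu := hasL2Gradient_of_hasCompactSupport (U := Ω) hφ hφc
  have hba : 0 < b - a := by linarith
  have hba1 : (b - a) ^ 2 ≤ 1 := pow_le_one₀ hba.le (by linarith)
  have hm0 : 0 ≤ ballMeas Ω x₀ b := measureReal_nonneg
  set v := T hu.toH1 with hv
  have hvL := hasL2Gradient v
  have henergy : ∫ y, ‖grad v y‖ ^ 2 ≤ K * ballMeas Ω x₀ b / (b - a) ^ 2 := by
    have h1 : ∫ y, ‖grad v y‖ ^ 2 ≤ ‖v‖ ^ 2 := by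
      have h2 : ‖grad v‖ ^ 2 = ∫ y in univ, ‖grad v y‖ ^ 2 := norm_sq_lp_eq_integral (grad v)
      rw [setIntegral_univ] at h2
      rw [← h2]
      gcongr
      exact norm_grad_le v
    have h2 : ‖v‖ ^ 2 ≤ ‖T‖ ^ 2 * ‖hu.toH1‖ ^ 2 := by
      rw [← mul_pow]
      exact pow_le_pow_left₀ (norm_nonneg _) (T.le_opNorm _) 2
    have h3 : ‖hu.toH1‖ ^ 2 ≤ (1 + L ^ 2) * ballMeas Ω x₀ b / (b - a) ^ 2 := by
      rw [hu.norm_sq_toH1]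
      have h4 := integral_sq_le_ballMeas (Ω := Ω) (f := φ) hφb hφ1
      have h5 := integral_sq_le_ballMeas (Ω := Ω) (f := gradient φ) hφgz hφg
      -- Since `b - a ≤ 1`, the `L²` part of the norm is absorbed into the scale of the gradient
      -- part.
      have h6 : (1 : ℝ) ^ 2 * ballMeas Ω x₀ b ≤ ballMeas Ω x₀ b / (b - a) ^ 2 := by
        rw [one_pow, one_mul]
        exact le_div_self hm0 (by positivity) hba1
      calc _ ≤ ballMeas Ω x₀ b / (b - a) ^ 2 + (L / (b - a)) ^ 2 * ballMeas Ω x₀ b :=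
            add_le_add (h4.trans h6) h5
        _ = (1 + L ^ 2) * ballMeas Ω x₀ b / (b - a) ^ 2 := by
            rw [div_pow]; ring
    calc ∫ y, ‖grad v y‖ ^ 2 ≤ ‖T‖ ^ 2 * ((1 + L ^ 2) * ballMeas Ω x₀ b / (b - a) ^ 2) :=
          h1.trans (h2.trans (by gcongr))
      _ = (‖T‖ ^ 2 * (1 + L ^ 2)) * ballMeas Ω x₀ b / (b - a) ^ 2 := by ring
      _ ≤ K * ballMeas Ω x₀ b / (b - a) ^ 2 := by
          gcongr
          rw [hK]; linarith
  have hval : ∀ᵐ x, x ∈ Ω → fn v x = φ x := by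
    have h1 := hT hu.toH1
    have h2 := hu.fn_toH1
    have h3 : ∀ᵐ x ∂(volume.restrict Ω), fn v x = φ x := by
      filter_upwards [h1, h2] with x hx1 hx2
      rw [hv, hx1, hx2]
    exact (ae_restrict_iff' hΩ.measurableSet).1 h3
  have hmono := ballMeas_mono Ω x₀ (show a ≤ r by linarith)
  -- The extension `v` of the cutoff is `1` on `Ω ∩ B(x₀, a)` and `0` on the part of `Ω` in the
  -- shell between radii `r` and `2 * r`. The hypothesis `hdouble` makes that part at least as large
  -- as `Ω ∩ B(x₀, r)`.
  refine (measure_le_of_mollify_oscillation (bumpOfRadius n s hs) hvL (R := 2 * r)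
    (by linarith) x₀ ?_
    (E₀ := (Ω ∩ Metric.closedBall x₀ (2 * r)) \ (Ω ∩ Metric.closedBall x₀ r))
    (E₁ := Ω ∩ Metric.closedBall x₀ a)
    ((hΩ.measurableSet.inter measurableSet_closedBall).diff
      (hΩ.measurableSet.inter measurableSet_closedBall))
    (hΩ.measurableSet.inter measurableSet_closedBall) ?_ ?_ ?_ ?_
    (m := ballMeas Ω x₀ a) ?_ le_rfl).trans ?_
  · refine le_trans ?_ hosc
    change (2 * r) ^ 2 * (1 / ((s / 2) ^ n * _) * _) ≤ _
    gcongr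
  · exact fun x hx => hx.1.2
  · exact fun x hx => Metric.closedBall_subset_closedBall (by linarith) hx.2
  · filter_upwards [hval] with x hx hxE
    rw [hx hxE.1.1, hφb]
    intro hxb
    exact hxE.2 ⟨hxE.1.1, Metric.closedBall_subset_closedBall hbr hxb⟩
  · filter_upwards [hval] with x hx hxE
    rw [hx hxE.1, hφa x hxE.2]
  · rw [measureReal_sdiff (inter_subset_inter_right _
      (Metric.closedBall_subset_closedBall (show r ≤ 2 * r by linarith)))
      (hΩ.measurableSet.inter measurableSet_closedBall)
      (measure_inter_closedBall_ne_top Ω x₀ (2 * r))]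
    change _ ≤ ballMeas Ω x₀ (2 * r) - ballMeas Ω x₀ r
    linarith
  · change 16 * s ^ 2 * _ ≤ _
    gcongr

/-- If both alternatives fail, the De Giorgi step can be iterated along radii decreasing from `r` to
`r / 2`. The measures then tend to zero, so `Ω ∩ B(x₀, r / 2)` is null, which is impossible for a
point of the closure of an open set. -/
theorem exists_ballMeas_doubling_or_large {Ω : Set (Eu n)} (hΩ : IsOpen Ω)
    (T : H1 Ω →L[ℝ] H1 (univ : Set (Eu n))) (hT : IsExtensionOperator T) :
    ∃ ε : ℝ, 0 < ε ∧ ∀ x₀ ∈ closure Ω, ∀ r : ℝ, 0 < r → r ≤ 1 →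
      ballMeas Ω x₀ (2 * r) < 2 * ballMeas Ω x₀ r ∨ ε * r ^ n ≤ ballMeas Ω x₀ r := by
  obtain ⟨K, hK, hstep⟩ := exists_ballMeas_step hΩ T hT
  set V := volume.real (Metric.ball (0 : Eu n) 1) with hV
  have hVpos : 0 < V := ENNReal.toReal_pos (Metric.measure_ball_pos _ _ one_pos).ne'
    measure_ball_lt_top.ne
  -- The decay rate per step. With `p = 2⁻ʲ` one has `q ^ j = p ^ n * p ^ 2`: the first factor
  -- compensates the normalisation of the bump at scale proportional to `r * p`, the second the
  -- factor `(b - a)⁻²`.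
  set q : ℝ := (1 / 2) ^ (n + 2) with hq
  have hq0 : 0 < q := by positivity
  have hq1 : q < 1 := pow_lt_one₀ (by norm_num) (by norm_num) (by omega)
  -- The ratio of the mollification scale to `r * p`, small enough for `256 * σ ^ 2 * K ≤ q`, which
  -- closes the induction.
  set σ : ℝ := q / (256 * K) with hσ
  have hσ0 : 0 < σ := by positivity
  have hσ1 : σ ≤ 1 := by
    rw [hσ, div_le_one (by positivity)]
    linarith
  have hσq : 256 * σ ^ 2 * K ≤ q := by
    have : 256 * σ ^ 2 * K = q * σ := by
      rw [hσ]; field_simp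
    rw [this]
    exact mul_le_of_le_one_right hq0.le hσ1
  -- Chosen so that the upper bound for the oscillation term equals `1 / 16` at every step.
  set ε : ℝ := σ ^ n * V / (1024 * 2 ^ n * K) with hε
  have hε0 : 0 < ε := by positivity
  refine ⟨ε, hε0, fun x₀ hx₀ r hr hr1 => ?_⟩
  by_contra! hcon
  obtain ⟨hdouble, hsmall⟩ := hcon
  have hiter : ∀ j : ℕ, ballMeas Ω x₀ (r * (1 / 2 + (1 / 2) ^ (j + 1))) ≤ ε * q ^ j * r ^ n := by
    intro j
    induction j with
    | zero =>
      norm_num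
      exact hsmall.le
    | succ j ih =>
      set p : ℝ := (1 / 2) ^ j with hp
      have hp0 : 0 < p := by positivity
      have hp1 : p ≤ 1 := pow_le_one₀ (by norm_num) (by norm_num)
      have hqp : q ^ j = p ^ n * p ^ 2 := by
        rw [hq, hp, ← pow_mul, ← pow_mul, ← pow_mul, ← pow_add]
        congr 1; ring
      have e1 : (1 / 2 : ℝ) ^ (j + 1) = p / 2 := by rw [pow_succ, hp]; ring
      have e2 : (1 / 2 : ℝ) ^ (j + 1 + 1) = p / 4 := by rw [pow_succ, e1]; ring
      rw [e1] at ih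
      rw [e2]
      set a := r * (1 / 2 + p / 4) with ha
      set b := r * (1 / 2 + p / 2) with hb
      have hbasub : b - a = r * p / 4 := by rw [ha, hb]; ring
      have hab : a < b := by
        have : 0 < r * p := by positivity
        linarith
      have hX : K * ballMeas Ω x₀ b / (b - a) ^ 2 ≤ 16 * K * ε * p ^ n * r ^ n / r ^ 2 := by
        rw [hbasub, div_le_div_iff₀ (by positivity) (by positivity)]
        calc K * ballMeas Ω x₀ b * r ^ 2 ≤ K * (ε * q ^ j * r ^ n) * r ^ 2 := by gcongr
          _ = 16 * K * ε * p ^ n * r ^ n * (r * p / 4) ^ 2 := by rw [hqp]; ring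
      have h := hstep x₀ r a b (σ * r * p) (by positivity) hab
        (by rw [hb]; exact mul_le_of_le_one_right hr.le (by linarith)) hr1 (by positivity)
        hdouble ?_
      · refine h.trans ?_
        calc 16 * (σ * r * p) ^ 2 * (K * ballMeas Ω x₀ b / (b - a) ^ 2)
            ≤ 16 * (σ * r * p) ^ 2 * (16 * K * ε * p ^ n * r ^ n / r ^ 2) := by gcongr
          _ = (256 * σ ^ 2 * K) * (ε * (p ^ n * p ^ 2) * r ^ n) := by
              field_simp; ring
          _ ≤ q * (ε * (p ^ n * p ^ 2) * r ^ n) := by gcongr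
          _ = ε * q ^ (j + 1) * r ^ n := by rw [pow_succ q j, hqp]; ring
      · calc (2 * r) ^ 2 * (1 / ((σ * r * p / 2) ^ n * V) * (K * ballMeas Ω x₀ b / (b - a) ^ 2))
            ≤ (2 * r) ^ 2 * (1 / ((σ * r * p / 2) ^ n * V) *
              (16 * K * ε * p ^ n * r ^ n / r ^ 2)) := by gcongr
          _ = 1 / 16 := by
              rw [div_pow, mul_pow, mul_pow, hε]
              field_simp
              ring
          _ ≤ 1 / 16 := le_rfl
  have hle : ∀ j : ℕ, ballMeas Ω x₀ (r / 2) ≤ ε * q ^ j * r ^ n := fun j =>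
    (ballMeas_mono Ω x₀ (by
      have : 0 ≤ r * (1 / 2) ^ (j + 1) := by positivity
      linarith)).trans (hiter j)
  have ht : Tendsto (fun j : ℕ => ε * q ^ j * r ^ n) atTop (𝓝 0) := by
    simpa using ((tendsto_pow_atTop_nhds_zero_of_lt_one hq0.le hq1).const_mul ε).mul_const (r ^ n)
  have hpos := ballMeas_pos hΩ hx₀ (show 0 < r / 2 by positivity)
  exact absurd (ge_of_tendsto' ht hle) (not_le.2 hpos)

/-- Extension domains satisfy the measure density condition at each point of the closure. -/
theorem exists_ballMeas_ge {Ω : Set (Eu n)} (hn : n ≠ 0) (hΩ : IsOpen Ω)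
    (T : H1 Ω →L[ℝ] H1 (univ : Set (Eu n))) (hT : IsExtensionOperator T) {x₀ : Eu n}
    (hx₀ : x₀ ∈ closure Ω) :
    ∃ c : ℝ, 0 < c ∧ ∀ r : ℝ, 0 < r → r ≤ 1 → c * r ^ n ≤ ballMeas Ω x₀ r := by
  obtain ⟨ε, hε, h⟩ := exists_ballMeas_doubling_or_large hΩ T hT
  have hpos := ballMeas_pos hΩ hx₀ (show (0 : ℝ) < 1 / 2 by norm_num)
  -- The constant depends on the point through the second entry, which settles the radii above `1 /
  -- 2`. The later limits are taken at one point at a time, so uniformity is not needed.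
  set c := min ε (ballMeas Ω x₀ (1 / 2)) with hc
  have hc0 : 0 < c := lt_min hε hpos
  have key : ∀ k : ℕ, ∀ r : ℝ, (1 / 2) ^ (k + 1) < r → r ≤ 1 → c * r ^ n ≤ ballMeas Ω x₀ r := by
    intro k
    induction k with
    | zero =>
      intro r hr hr1
      have hr2 : 1 / 2 < r := by simpa using hr
      calc c * r ^ n ≤ ballMeas Ω x₀ (1 / 2) * 1 := by
            gcongr
            · exact min_le_right _ _
            · exact pow_le_one₀ (by linarith) hr1
        _ ≤ ballMeas Ω x₀ r := by
            rw [mul_one]; exact ballMeas_mono Ω x₀ hr2.le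
    | succ k ih =>
      intro r hr hr1
      have hr0 : 0 < r := lt_trans (by positivity) hr
      rcases h x₀ hx₀ r hr0 hr1 with h1 | h1
      · by_cases hr2 : 2 * r ≤ 1
        · have h3 := ih (2 * r) (by rw [pow_succ] at hr; linarith) hr2
          -- When doubling the radius less than doubles the measure, passing from `2 * r` to `r`
          -- loses at most a factor `2`, whereas the target `c * r ^ n` drops by `2 ^ n ≥ 2`.
          have h4 : (2 : ℝ) ≤ 2 ^ n := le_self_pow₀ one_le_two hn
          have h5 : 2 * (c * r ^ n) ≤ 2 ^ n * (c * r ^ n) := by gcongr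
          rw [mul_pow] at h3
          linarith
        · refine le_trans ?_ (ballMeas_mono Ω x₀ (show 1 / 2 ≤ r by linarith))
          calc c * r ^ n ≤ ballMeas Ω x₀ (1 / 2) * 1 := by
                gcongr
                · exact min_le_right _ _
                · exact pow_le_one₀ (by linarith) hr1
            _ = _ := mul_one _
      · refine le_trans ?_ h1
        gcongr
        exact min_le_left _ _
  refine ⟨c, hc0, fun r hr hr1 => ?_⟩
  obtain ⟨k, hk⟩ := exists_pow_lt_of_lt_one hr (show (1 / 2 : ℝ) < 1 by norm_num)
  exact key k r (lt_of_le_of_lt (pow_le_pow_of_le_one (by norm_num) (by norm_num) k.le_succ) hk) hr1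

/-! ### Boundary values are determined by the values in the domain -/

/-- The bump equals `1` on its inner ball, so its normalised density there is at least one over the
volume of the outer ball. The corresponding mass in `Ω` sees the value `0`, and all the rest sees at
most `1`. -/
theorem mollify_le_of_ballMeas {Ω : Set (Eu n)} (hΩ : IsOpen Ω) (φ : ContDiffBump (0 : Eu n))
    {u : Eu n → ℝ} (hu : LocallyIntegrable u volume) (h1 : ∀ᵐ y ∂volume, u y ≤ 1)
    (h0 : ∀ᵐ y ∂volume, y ∈ Ω → u y = 0) (x : Eu n) :
    mollify φ u x ≤ 1 - ballMeas Ω x φ.rIn / volume.real (Metric.closedBall (0 : Eu n) φ.rOut) := by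
  set A := Ω ∩ Metric.closedBall x φ.rIn with hA
  have hAm : MeasurableSet A := hΩ.measurableSet.inter measurableSet_closedBall
  have hint : Integrable fun y => φ.normed volume (x - y) • u y :=
    (φ.hasCompactSupport_normed.convolutionExists_left (ContinuousLinearMap.lsmul ℝ ℝ)
      φ.continuous_normed hu x).integrable_swap
  have hη : Integrable fun y => φ.normed volume (x - y) :=
    (Measure.measurePreserving_sub_left volume x).integrable_comp_of_integrable φ.integrable_normed
  set V := volume.real (Metric.closedBall (0 : Eu n) φ.rOut) with hV
  have hVpos : 0 < V := ENNReal.toReal_pos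
    (Metric.measure_closedBall_pos _ _ φ.rOut_pos).ne' measure_closedBall_lt_top.ne
  have hAi : Integrable (A.indicator fun _ => 1 / V) volume :=
    (integrable_indicator_iff hAm).2
      (integrableOn_const (measure_inter_closedBall_ne_top Ω x φ.rIn))
  have hle : ∀ᵐ y ∂volume, φ.normed volume (x - y) • u y ≤
      φ.normed volume (x - y) - A.indicator (fun _ => 1 / V) y := by
    filter_upwards [h1, h0] with y hy1 hy0
    by_cases hyA : y ∈ A
    · rw [hy0 hyA.1, smul_zero, indicator_of_mem hyA, sub_nonneg, φ.normed_def]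
      have h2 : φ (x - y) = 1 := by
        refine φ.one_of_mem_closedBall ?_
        have := hyA.2
        rwa [mem_closedBall_zero_iff, ← dist_eq_norm, dist_comm]
      rw [h2]
      exact one_div_le_one_div_of_le φ.integral_pos (φ.integral_le_measure_closedBall volume)
    · rw [indicator_of_notMem hyA, sub_zero, smul_eq_mul]
      exact mul_le_of_le_one_right (φ.nonneg_normed _) hy1
  rw [mollify_apply_swap]
  refine (integral_mono_ae hint (hη.sub hAi) hle).trans (le_of_eq ?_)
  simp only [Pi.sub_apply]
  rw [integral_sub hη hAi, integral_indicator_const _ hAm]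
  have h3 : ∫ y, φ.normed volume (x - y) = 1 := by
    rw [integral_sub_left_eq_self (fun y => φ.normed volume y) volume x, φ.integral_normed]
  rw [h3, smul_eq_mul, mul_one_div]
  rfl

/-- At a boundary point outside an exceptional set, `f` is a limit of mollifications, and measure
density keeps these below a constant smaller than `1`. -/
theorem capacity_one_le_eq_zero {Ω : Set (Eu n)} (hn : n ≠ 0) (hΩ : IsOpen Ω)
    {T : H1 Ω →L[ℝ] H1 (univ : Set (Eu n))} (hT : IsExtensionOperator T)
    {w : H1 (univ : Set (Eu n))} (h1 : ∀ᵐ x ∂volume, fn w x ≤ 1)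
    (h0 : ∀ᵐ x ∂volume, x ∈ Ω → fn w x = 0) {f : Eu n → ℝ} (hf : IsQuasiContRep f w) :
    capacity {x | x ∈ frontier Ω ∧ 1 ≤ f x} = 0 := by
  obtain ⟨ns, g, N, hns, hg, hN, hlim⟩ := exists_subseq_tendsto_qe
    (fun j => continuous_mollify_fn (bumpSeq n j) w)
    (fun j => mollify_ae_eq_fn (bumpSeq n j) w)
    (tendsto_mollifyH1 w (tendsto_bumpSeq_rOut (n := n)))
  have hfg := hf.1.capacity_ne_eq_zero hg.1 isOpen_univ (by
    filter_upwards [hf.2, hg.2] with x hx1 hx2 _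
    rw [hx1, hx2])
  refine capacity_eq_zero_mono ?_ (capacity_union_eq_zero hN hfg)
  rintro x ⟨hx, hx1⟩
  by_contra hcon
  rw [mem_union, not_or] at hcon
  obtain ⟨hxN, hxne⟩ := hcon
  have hfgx : f x = g x := by
    by_contra hne
    exact hxne ⟨mem_univ x, hne⟩
  obtain ⟨c, hc, hdens⟩ := exists_ballMeas_ge hn hΩ T hT (frontier_subset_closure hx)
  set V := volume.real (Metric.ball (0 : Eu n) 1) with hV
  have hVpos : 0 < V := ENNReal.toReal_pos (Metric.measure_ball_pos _ _ one_pos).ne'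
    measure_ball_lt_top.ne
  have hbound : ∀ j, mollify (bumpSeq n (ns j)) (fn w) x ≤ 1 - c / (2 ^ n * V) := by
    intro j
    set φ := bumpSeq n (ns j) with hφ
    -- The fixed ratio of the radii removes the scale from the quotient of inner density by outer
    -- volume, so the bound is uniform in `j`.
    have hrel : φ.rOut = 2 * φ.rIn := by
      change 1 / ((ns j : ℝ) + 1) = 2 * (1 / (2 * ((ns j : ℝ) + 1)))
      field_simp
    have hin1 : φ.rIn ≤ 1 := by
      change 1 / (2 * ((ns j : ℝ) + 1)) ≤ 1
      rw [div_le_one (by positivity)]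
      have : (0 : ℝ) ≤ ns j := Nat.cast_nonneg _
      linarith
    refine (mollify_le_of_ballMeas hΩ φ ((memLp_univ_iff.1
      (hasL2Gradient w).memLp).locallyIntegrable (by norm_num)) h1 h0 x).trans ?_
    have hball : volume.real (Metric.closedBall (0 : Eu n) φ.rOut) = 2 ^ n * φ.rIn ^ n * V := by
      rw [Measure.real, Measure.addHaar_closedBall _ _ φ.rOut_pos.le, ENNReal.toReal_mul,
        ENNReal.toReal_ofReal (by have := φ.rOut_pos; positivity), hrel, finrank_euclideanSpace_fin,
        mul_pow]
      rfl
    have h2 := hdens φ.rIn φ.rIn_pos hin1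
    have h3 : 0 < φ.rIn ^ n := pow_pos φ.rIn_pos n
    rw [hball]
    refine sub_le_sub_left ?_ 1
    rw [div_le_div_iff₀ (by positivity) (by positivity)]
    calc c * (2 ^ n * φ.rIn ^ n * V) = (c * φ.rIn ^ n) * (2 ^ n * V) := by ring
      _ ≤ ballMeas Ω x φ.rIn * (2 ^ n * V) := by gcongr
  have h4 := le_of_tendsto' (hlim x hxN) hbound
  rw [← hfgx] at h4
  have h5 : 0 < c / (2 ^ n * V) := by positivity
  linarith

theorem isQuasiContRep_comp {h : ℝ → ℝ} (hh : ContDiff ℝ 1 h) {C : ℝ} (hC : ∀ t, |deriv h t| ≤ C)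
    (h0 : h 0 = 0) {w : H1 (univ : Set (Eu n))} {f : Eu n → ℝ} (hf : IsQuasiContRep f w) :
    IsQuasiContRep (fun x => h (f x)) ((hasL2Gradient w).comp hh hC h0).toH1 := by
  refine ⟨hf.1.comp hh.continuous, ?_⟩
  filter_upwards [hf.2, ae_univ ((hasL2Gradient w).comp hh hC h0).fn_toH1] with x h1 h2
  rw [h2, h1]

/-- The functions `S((k + 1) w)`, with `S` the smooth transition, vanish on `Ω` and are at most `1`.
Their representatives equal `1` where `f ≥ 1 / (k + 1)`; these sets exhaust `{f > 0}`. -/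
theorem capacity_pos_eq_zero {Ω : Set (Eu n)} (hn : n ≠ 0) (hΩ : IsOpen Ω)
    {T : H1 Ω →L[ℝ] H1 (univ : Set (Eu n))} (hT : IsExtensionOperator T)
    {w : H1 (univ : Set (Eu n))}
    (h0 : ∀ᵐ x ∂volume, x ∈ Ω → fn w x = 0) {f : Eu n → ℝ} (hf : IsQuasiContRep f w) :
    capacity {x | x ∈ frontier Ω ∧ 0 < f x} = 0 := by
  obtain ⟨L, hL, hLd⟩ := exists_abs_deriv_smoothTransition_le
  have key : ∀ k : ℕ, capacity {x | x ∈ frontier Ω ∧ 1 ≤ ((k : ℝ) + 1) * f x} = 0 := by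
    intro k
    set h : ℝ → ℝ := fun t => Real.smoothTransition (((k : ℝ) + 1) * t) with hh
    have hsm : ContDiff ℝ 1 h :=
      Real.smoothTransition.contDiff.comp (contDiff_const.mul contDiff_id)
    have hd : ∀ t, |deriv h t| ≤ L * ((k : ℝ) + 1) := by
      intro t
      have h1 : HasDerivAt (fun t : ℝ => ((k : ℝ) + 1) * t) ((k : ℝ) + 1) t := by
        simpa using (hasDerivAt_id t).const_mul ((k : ℝ) + 1)
      have h2 : deriv h t = _ := ((((Real.smoothTransition.contDiff (n := 1)).differentiable
        one_ne_zero) (((k : ℝ) + 1) * t)).hasDerivAt.comp t h1).deriv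
      rw [h2, abs_mul, abs_of_nonneg (show (0 : ℝ) ≤ (k : ℝ) + 1 by positivity)]
      gcongr
      exact hLd _
    have hz : h 0 = 0 := by simp [hh]
    have hrep := isQuasiContRep_comp hsm hd hz hf
    have hae := ae_univ ((hasL2Gradient w).comp hsm hd hz).fn_toH1
    have h3 := capacity_one_le_eq_zero hn hΩ hT (w := ((hasL2Gradient w).comp hsm hd hz).toH1)
      (by
        filter_upwards [hae] with x hx
        rw [hx]
        exact Real.smoothTransition.le_one _)
      (by
        filter_upwards [hae, h0] with x hx hx0 hxΩ
        rw [hx, hx0 hxΩ, hz]) hrep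
    refine capacity_eq_zero_mono ?_ h3
    rintro x ⟨hx, hx1⟩
    exact ⟨hx, (Real.smoothTransition.one_of_one_le hx1).ge⟩
  refine capacity_eq_zero_mono ?_ (capacity_iUnion_eq_zero key)
  rintro x ⟨hx, hpos⟩
  obtain ⟨k, hk⟩ := exists_nat_one_div_lt hpos
  refine mem_iUnion.2 ⟨k, hx, ?_⟩
  rw [div_lt_iff₀ (by positivity)] at hk
  linarith

theorem isQuasiContRep_sub {v w : H1 (univ : Set (Eu n))} {f g : Eu n → ℝ}
    (hf : IsQuasiContRep f v) (hg : IsQuasiContRep g w) :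
    IsQuasiContRep (fun x => f x - g x) (v - w) := by
  refine ⟨?_, ?_⟩
  · have := hf.1.add (hg.1.comp continuous_neg)
    simp only [sub_eq_add_neg]
    exact this
  · filter_upwards [hf.2, hg.2, ae_univ (coeFn_fn_sub v w)] with x h1 h2 h3
    rw [h3, h1, h2]

theorem isQuasiContRep_zero : IsQuasiContRep (fun _ => 0) (0 : H1 (univ : Set (Eu n))) := by
  refine ⟨fun ε hε => ⟨∅, isOpen_empty, by simpa [capacity_empty] using hε,
      continuousOn_const⟩, ?_⟩
  filter_upwards [fn_zero_ae] with x hx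
  exact hx.symm

/-- If `w ∈ H¹(ℝⁿ)` vanishes on the extension domain `Ω`, its quasi-continuous representative
vanishes quasi-everywhere on `∂Ω`. -/
theorem capacity_frontier_ne_zero_eq_zero {Ω : Set (Eu n)} (hn : n ≠ 0) (hΩ : IsOpen Ω)
    {T : H1 Ω →L[ℝ] H1 (univ : Set (Eu n))} (hT : IsExtensionOperator T)
    {w : H1 (univ : Set (Eu n))}
    (h0 : ∀ᵐ x ∂volume, x ∈ Ω → fn w x = 0) {f : Eu n → ℝ} (hf : IsQuasiContRep f w) :
    capacity {x | x ∈ frontier Ω ∧ f x ≠ 0} = 0 := by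
  have h1 := capacity_pos_eq_zero hn hΩ hT h0 hf
  have h2 := capacity_pos_eq_zero hn hΩ hT (w := 0 - w) (by
    filter_upwards [ae_univ (coeFn_fn_sub 0 w), fn_zero_ae, h0] with x hx1 hx2 hx3 hxΩ
    rw [hx1, hx2, hx3 hxΩ, sub_zero]) (isQuasiContRep_sub isQuasiContRep_zero hf)
  refine capacity_eq_zero_mono ?_ (capacity_union_eq_zero h1 h2)
  rintro x ⟨hx, hne⟩
  rcases lt_or_gt_of_ne hne with h | h
  · exact Or.inr ⟨hx, by linarith⟩
  · exact Or.inl ⟨hx, h⟩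

/-! ### The trace operator -/

theorem restrictBoundary_eq_iff {Ω : Set (Eu n)} {f g : Eu n → ℝ} :
    restrictBoundary Ω f = restrictBoundary Ω g ↔
      capacity {x | x ∈ frontier Ω ∧ f x - g x ≠ 0} = 0 := by
  rw [restrictBoundary, restrictBoundary, Submodule.Quotient.eq]
  have : Subtype.val '' {x : frontier Ω | ((fun x : frontier Ω => f x) -
      fun x : frontier Ω => g x) x ≠ 0} =
      {x | x ∈ frontier Ω ∧ f x - g x ≠ 0} := by
    ext x
    constructor
    · rintro ⟨y, hy, rfl⟩
      exact ⟨y.2, hy⟩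
    · rintro ⟨hx, hne⟩
      exact ⟨⟨x, hx⟩, hne, rfl⟩
  change capacity _ = 0 ↔ _
  rw [this]

/-- The trace of `u` is computed by any `H¹(ℝⁿ)` extension of `u`. -/
theorem trace_eq {Ω : Set (Eu n)} (hn : n ≠ 0) (hΩ : IsOpen Ω)
    {T : H1 Ω →L[ℝ] H1 (univ : Set (Eu n))} (hT : IsExtensionOperator T) {u : H1 Ω}
    {w : H1 (univ : Set (Eu n))} (hwu : ∀ᵐ x ∂(volume.restrict Ω), fn w x = fn u x)
    {f : Eu n → ℝ} (hf : IsQuasiContRep f w) :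
    (trace T u : QEClass Ω) = restrictBoundary Ω f := by
  have hex : ∃ f : Eu n → ℝ, IsQuasiContRep f (T u) := exists_isQuasiContRep (T u)
  rw [trace, dif_pos hex]
  change restrictBoundary Ω hex.choose = _
  rw [restrictBoundary_eq_iff]
  refine capacity_frontier_ne_zero_eq_zero hn hΩ hT (w := T u - w) ?_
    (isQuasiContRep_sub hex.choose_spec hf)
  refine (ae_restrict_iff' hΩ.measurableSet).1 ?_
  filter_upwards [hT u, hwu, ae_restrict_of_ae_univ (coeFn_fn_sub (T u) w)] with x h1 h2 h3
  rw [h3, h1, h2, sub_self]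

theorem restrictBoundary_add {Ω : Set (Eu n)} (f g : Eu n → ℝ) :
    restrictBoundary Ω (f + g) = restrictBoundary Ω f + restrictBoundary Ω g := rfl

theorem restrictBoundary_smul {Ω : Set (Eu n)} (c : ℝ) (f : Eu n → ℝ) :
    restrictBoundary Ω (c • f) = c • restrictBoundary Ω f := rfl

theorem isQuasiContRep_add {v w : H1 (univ : Set (Eu n))} {f g : Eu n → ℝ}
    (hf : IsQuasiContRep f v) (hg : IsQuasiContRep g w) : IsQuasiContRep (f + g) (v + w) := by
  refine ⟨hf.1.add hg.1, ?_⟩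
  filter_upwards [hf.2, hg.2, fn_add_ae v w] with x h1 h2 h3
  rw [h3, Pi.add_apply, h1, h2]

theorem isQuasiContRep_smul (c : ℝ) {v : H1 (univ : Set (Eu n))} {f : Eu n → ℝ}
    (hf : IsQuasiContRep f v) : IsQuasiContRep (c • f) (c • v) := by
  refine ⟨hf.1.comp (h := fun t => c * t) (by fun_prop), ?_⟩
  filter_upwards [hf.2, fn_smul_ae c v] with x h1 h3
  rw [h3, Pi.smul_apply, h1, smul_eq_mul]

/-- The trace operator as a linear map. -/
def traceLinear {Ω : Set (Eu n)} (hn : n ≠ 0) (hΩ : IsOpen Ω)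
    {T : H1 Ω →L[ℝ] H1 (univ : Set (Eu n))} (hT : IsExtensionOperator T) :
    H1 Ω →ₗ[ℝ] TraceSpace Ω where
  toFun := trace T
  map_add' u v := by
    obtain ⟨f, hf⟩ := exists_isQuasiContRep (T u)
    obtain ⟨g, hg⟩ := exists_isQuasiContRep (T v)
    refine Subtype.ext ?_
    rw [Submodule.coe_add, trace_eq hn hΩ hT (hT u) hf, trace_eq hn hΩ hT (hT v) hg,
      ← restrictBoundary_add]
    refine trace_eq hn hΩ hT (hT (u + v)) ?_
    rw [map_add]
    exact isQuasiContRep_add hf hg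
  map_smul' c u := by
    obtain ⟨f, hf⟩ := exists_isQuasiContRep (T u)
    refine Subtype.ext ?_
    rw [RingHom.id_apply, Submodule.coe_smul, trace_eq hn hΩ hT (hT u) hf,
      ← restrictBoundary_smul]
    refine trace_eq hn hΩ hT (hT (c • u)) ?_
    rw [map_smul]
    exact isQuasiContRep_smul c hf

/-- An element of the trace space comes from some `w` on `ℝⁿ`. This `w` need not be the extension
that `T` assigns to its restriction, which is why `trace_eq` allows arbitrary extensions. -/
theorem trace_surjective {Ω : Set (Eu n)} (hn : n ≠ 0) (hΩ : IsOpen Ω)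
    {T : H1 Ω →L[ℝ] H1 (univ : Set (Eu n))} (hT : IsExtensionOperator T) :
    Function.Surjective (trace T) := by
  rintro ⟨_, w, f, hf, rfl⟩
  exact ⟨restrictH1 Ω w, Subtype.ext (trace_eq hn hΩ hT
    (by filter_upwards [fn_restrictH1 (U := Ω) w] with x hx; exact hx.symm) hf)⟩

/-! ### The closure of the test functions -/

/-- The elements of `H¹(U)` given by test functions on `U`. -/
def testSpace (U : Set (Eu n)) : Submodule ℝ (H1 U) where
  carrier := {w | ∃ φ, ∃ h : IsTest U φ, w = h.hasL2Gradient.toH1}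
  zero_mem' := by
    have h : IsTest U fun _ => (0 : ℝ) :=
      ⟨contDiff_const, HasCompactSupport.zero, by simp [tsupport]⟩
    refine ⟨_, h, ?_⟩
    have h2 : ‖h.hasL2Gradient.toH1 (U := U)‖ ^ 2 = 0 := by
      rw [HasL2Gradient.norm_sq_toH1]
      simp [gradient]
    exact (norm_eq_zero.1 (pow_eq_zero_iff two_ne_zero |>.1 h2)).symm
  add_mem' := by
    rintro _ _ ⟨φ, hφ, rfl⟩ ⟨ψ, hψ, rfl⟩
    have h : IsTest U fun x => φ x + ψ x :=
      ⟨hφ.smooth.add hψ.smooth, hφ.compact.add hψ.compact,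
        (tsupport_add φ ψ).trans (union_subset hφ.supp hψ.supp)⟩
    refine ⟨_, h, h1_ext ?_ ?_⟩
    · filter_upwards [coeFn_fn_add hφ.hasL2Gradient.toH1 hψ.hasL2Gradient.toH1,
        (hφ.hasL2Gradient (U := U)).fn_toH1, (hψ.hasL2Gradient (U := U)).fn_toH1,
        (h.hasL2Gradient (U := U)).fn_toH1] with x h1 h2 h3 h4
      rw [h1, h2, h3, h4]
    · filter_upwards [coeFn_grad_add hφ.hasL2Gradient.toH1 hψ.hasL2Gradient.toH1,
        (hφ.hasL2Gradient (U := U)).grad_toH1, (hψ.hasL2Gradient (U := U)).grad_toH1,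
        (h.hasL2Gradient (U := U)).grad_toH1] with x h1 h2 h3 h4
      rw [h1, h2, h3, h4]
      have h5 : HasFDerivAt (fun x => φ x + ψ x) (fderiv ℝ φ x + fderiv ℝ ψ x) x :=
        (hφ.smooth.differentiable (by simp) x).hasFDerivAt.add
          (hψ.smooth.differentiable (by simp) x).hasFDerivAt
      rw [gradient, gradient, gradient, h5.fderiv, map_add]
  smul_mem' := by
    rintro c _ ⟨φ, hφ, rfl⟩
    have h : IsTest U fun x => c * φ x :=
      ⟨contDiff_const.mul hφ.smooth, hφ.compact.mul_left,
        (tsupport_mul_subset_right).trans hφ.supp⟩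
    refine ⟨_, h, h1_ext ?_ ?_⟩
    · filter_upwards [coeFn_fn_smul c hφ.hasL2Gradient.toH1,
        (hφ.hasL2Gradient (U := U)).fn_toH1,
        (h.hasL2Gradient (U := U)).fn_toH1] with x h1 h2 h4
      rw [h1, h2, h4]
    · filter_upwards [coeFn_grad_smul c hφ.hasL2Gradient.toH1,
        (hφ.hasL2Gradient (U := U)).grad_toH1,
        (h.hasL2Gradient (U := U)).grad_toH1] with x h1 h2 h4
      rw [h1, h2, h4]
      have h5 : HasFDerivAt (fun x => c * φ x) (c • fderiv ℝ φ x) x :=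
        (hφ.smooth.differentiable (by simp) x).hasFDerivAt.const_mul c
      rw [gradient, gradient, h5.fderiv, map_smulₛₗ]
      simp

/-- The space `H¹₀(U)`. -/
def H10 (U : Set (Eu n)) : Submodule ℝ (H1 U) := (testSpace U).topologicalClosure

theorem isClosed_h10 (U : Set (Eu n)) : IsClosed (H10 U : Set (H1 U)) :=
  Submodule.isClosed_topologicalClosure _

theorem IsTest.toH1_mem_h10 {U : Set (Eu n)} {φ : Eu n → ℝ} (h : IsTest U φ) :
    h.hasL2Gradient.toH1 ∈ H10 U :=
  Submodule.le_topologicalClosure _ ⟨φ, h, rfl⟩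

/-- A closed condition on `H¹(U)` satisfied by the test functions holds on `H¹₀(U)`. -/
theorem h10_induction {U : Set (Eu n)} {p : H1 U → Prop} (hp : IsClosed {w | p w})
    (h : ∀ φ, ∀ hφ : IsTest U φ, p hφ.hasL2Gradient.toH1) {w : H1 U} (hw : w ∈ H10 U) : p w := by
  refine closure_minimal (s := (testSpace U : Set (H1 U))) (t := {w | p w}) ?_ hp hw
  rintro _ ⟨φ, hφ, rfl⟩
  exact h φ hφ

/-! ### Friedrichs' inequality -/

/-- Write `1` as the derivative of a coordinate, integrate by parts, and use that the coordinate is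
bounded by `R` on the support. -/
theorem integral_sq_le_of_isTest (hn : n ≠ 0) {U : Set (Eu n)} {R : ℝ}
    (hR : U ⊆ Metric.closedBall 0 R) {φ : Eu n → ℝ} (hφ : IsTest U φ) :
    ∫ x, φ x ^ 2 ≤ 4 * R ^ 2 * ∫ x, ‖gradient φ x‖ ^ 2 := by
  let i : Fin n := ⟨0, Nat.pos_of_ne_zero hn⟩
  let L : Eu n →L[ℝ] ℝ := EuclideanSpace.proj i
  have hs : ContDiff ℝ ∞ fun x => φ x ^ 2 := hφ.smooth.pow 2
  have hc := hφ.smooth.continuous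
  have hd : ∀ x, fderiv ℝ (fun x => φ x ^ 2) x (EuclideanSpace.single i 1) =
      2 * φ x * gradient φ x i := by
    intro x
    have h1 := (hφ.smooth.differentiable (by simp) x).hasFDerivAt.pow 2
    have h2 : fderiv ℝ (fun x => φ x ^ 2) x = _ := h1.fderiv
    rw [h2, gradient_coord]
    simp
  have hL : ∀ x, fderiv ℝ (fun x => L x) x (EuclideanSpace.single i 1) = 1 := by
    intro x
    rw [L.fderiv]
    simp [L]
  have hcg := continuous_gradient (hφ.smooth.of_le (by simp))
  have hci : Continuous fun x => gradient φ x i := (EuclideanSpace.proj i).continuous.comp hcg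
  have hc2 : HasCompactSupport fun x => φ x ^ 2 :=
    hφ.compact.mono fun x hx => by
      rw [Function.mem_support] at hx ⊢
      exact fun h => hx (by simp [h])
  have hparts := integral_mul_fderiv_eq_neg_fderiv_mul_of_integrable (μ := volume)
    (f := fun x => φ x ^ 2) (g := fun x => L x) (v := EuclideanSpace.single i 1)
    (by
      simp only [hd]
      exact (((continuous_const.mul hc).mul hci).mul L.continuous).integrable_of_hasCompactSupport
        (hφ.compact.mul_left.mul_right.mul_right))
    (by
      simp only [hL, mul_one]
      exact (hc.pow 2).integrable_of_hasCompactSupport hc2)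
    (((hc.pow 2).mul L.continuous).integrable_of_hasCompactSupport hc2.mul_right)
    (fun x _ => hs.differentiable (by simp) x) (fun x _ => L.differentiableAt)
  simp only [hL, mul_one, hd] at hparts
  have hi2 : Integrable fun x => φ x ^ 2 := (hc.pow 2).integrable_of_hasCompactSupport hc2
  have hig : Integrable fun x => ‖gradient φ x‖ ^ 2 :=
    (hcg.memLp_of_hasCompactSupport (hasCompactSupport_gradient hφ.compact)).integrable_norm_sq
  have key : ∫ x, φ x ^ 2 ≤ ∫ x, (1 / 2 * φ x ^ 2 + 2 * R ^ 2 * ‖gradient φ x‖ ^ 2) := by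
    rw [hparts, ← integral_neg]
    refine integral_mono (((((continuous_const.mul hc).mul hci).mul
      L.continuous).integrable_of_hasCompactSupport
        (hφ.compact.mul_left.mul_right.mul_right)).neg)
      ((hi2.const_mul _).add (hig.const_mul _)) fun x => ?_
    change -(2 * φ x * gradient φ x i * L x) ≤ 1 / 2 * φ x ^ 2 + 2 * R ^ 2 * ‖gradient φ x‖ ^ 2
    by_cases hx : x ∈ U
    · have h1 : |L x| ≤ R :=
        (PiLp.norm_apply_le x i).trans (mem_closedBall_zero_iff.1 (hR hx))
      have h2 : |gradient φ x i| ≤ ‖gradient φ x‖ := PiLp.norm_apply_le (gradient φ x) i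
      have h3 : (L x * gradient φ x i) ^ 2 ≤ (R * ‖gradient φ x‖) ^ 2 := by
        have h4 : 0 ≤ R := (abs_nonneg _).trans h1
        rw [← sq_abs, abs_mul]
        gcongr
      -- Young's inequality weighted so that half of `φ²` can be absorbed on the left, which leaves
      -- the factor `4 * R ^ 2`.
      nlinarith [sq_nonneg (φ x + 2 * (L x * gradient φ x i))]
    · have h1 : φ x = 0 := image_eq_zero_of_notMem_tsupport fun h => hx (hφ.supp h)
      rw [h1]
      simp only [mul_zero, zero_mul, neg_zero]
      positivity
  rw [integral_add (hi2.const_mul _) (hig.const_mul _), integral_const_mul,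
    integral_const_mul] at key
  linarith

theorem norm_fn_sq_le_of_mem_h10 (hn : n ≠ 0) {U : Set (Eu n)} {R : ℝ}
    (hR : U ⊆ Metric.closedBall 0 R) {w : H1 U} (hw : w ∈ H10 U) :
    ‖fn w‖ ^ 2 ≤ 4 * R ^ 2 * ‖grad w‖ ^ 2 := by
  refine h10_induction (p := fun w => ‖fn w‖ ^ 2 ≤ 4 * R ^ 2 * ‖grad w‖ ^ 2)
    (isClosed_le (continuous_fn.norm.pow 2) (continuous_const.mul (continuous_grad.norm.pow 2)))
    (fun φ hφ => ?_) hw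
  have h1 : ‖fn hφ.hasL2Gradient.toH1 (U := U)‖ ^ 2 = ∫ x, φ x ^ 2 := by
    rw [norm_sq_lp_eq_integral,
      ← setIntegral_eq_integral_of_forall_compl_eq_zero (s := U) (f := fun x => φ x ^ 2)]
    · refine integral_congr_ae ?_
      filter_upwards [(hφ.hasL2Gradient (U := U)).fn_toH1] with x hx
      rw [hx, Real.norm_eq_abs, sq_abs]
    · intro x hx
      rw [image_eq_zero_of_notMem_tsupport fun h => hx (hφ.supp h)]
      simp
  have h2 : ‖grad hφ.hasL2Gradient.toH1 (U := U)‖ ^ 2 = ∫ x, ‖gradient φ x‖ ^ 2 := by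
    rw [norm_sq_lp_eq_integral,
      ← setIntegral_eq_integral_of_forall_compl_eq_zero (s := U)
        (f := fun x => ‖gradient φ x‖ ^ 2)]
    · refine integral_congr_ae ?_
      filter_upwards [(hφ.hasL2Gradient (U := U)).grad_toH1] with x hx
      rw [hx]
    · intro x hx
      rw [norm_gradient, image_eq_zero_of_notMem_tsupport
        fun h => hx (hφ.supp (tsupport_fderiv_subset ℝ h))]
      simp
  rw [h1, h2]
  exact integral_sq_le_of_isTest hn hR hφ

/-! ### Functions in `H¹₀` have zero trace -/

theorem IsTest.norm_toH1_univ {U : Set (Eu n)} {φ : Eu n → ℝ} (hφ : IsTest U φ) :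
    ‖hφ.hasL2Gradient.toH1 (U := univ)‖ = ‖hφ.hasL2Gradient.toH1 (U := U)‖ := by
  refine (sq_eq_sq₀ (norm_nonneg _) (norm_nonneg _)).1 ?_
  rw [HasL2Gradient.norm_sq_toH1, HasL2Gradient.norm_sq_toH1, setIntegral_univ, setIntegral_univ,
    setIntegral_eq_integral_of_forall_compl_eq_zero, setIntegral_eq_integral_of_forall_compl_eq_zero]
  · intro x hx
    rw [norm_gradient, image_eq_zero_of_notMem_tsupport
      fun h => hx (hφ.supp (tsupport_fderiv_subset ℝ h))]
    simp
  · intro x hx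
    rw [image_eq_zero_of_notMem_tsupport fun h => hx (hφ.supp h)]
    simp

theorem toH1_sub {U : Set (Eu n)} {u v : Eu n → ℝ} {g k : Eu n → Eu n} (hu : HasL2Gradient U u g)
    (hv : HasL2Gradient U v k) (huv : HasL2Gradient U (fun x => u x - v x) fun x => g x - k x) :
    hu.toH1 - hv.toH1 = huv.toH1 := by
  refine h1_ext ?_ ?_
  · filter_upwards [coeFn_fn_sub hu.toH1 hv.toH1, hu.fn_toH1, hv.fn_toH1, huv.fn_toH1]
      with x h1 h2 h3 h4
    rw [h1, h2, h3, h4]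
  · filter_upwards [coeFn_grad_sub hu.toH1 hv.toH1, hu.grad_toH1, hv.grad_toH1, huv.grad_toH1]
      with x h1 h2 h3 h4
    rw [h1, h2, h3, h4]

theorem IsTest.dist_toH1_univ {U : Set (Eu n)} {φ ψ : Eu n → ℝ} (hφ : IsTest U φ)
    (hψ : IsTest U ψ) :
    dist (hφ.hasL2Gradient.toH1 (U := univ)) (hψ.hasL2Gradient.toH1 (U := univ)) =
      dist (hφ.hasL2Gradient.toH1 (U := U)) (hψ.hasL2Gradient.toH1 (U := U)) := by
  have h : IsTest U fun x => φ x - ψ x :=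
    ⟨hφ.smooth.sub hψ.smooth, hφ.compact.sub hψ.compact,
      (tsupport_sub φ ψ).trans (union_subset hφ.supp hψ.supp)⟩
  have hg : gradient (fun x => φ x - ψ x) = fun x => gradient φ x - gradient ψ x := by
    funext x
    have h5 : HasFDerivAt (fun x => φ x - ψ x) (fderiv ℝ φ x - fderiv ℝ ψ x) x :=
      (hφ.smooth.differentiable (by simp) x).hasFDerivAt.sub
        (hψ.smooth.differentiable (by simp) x).hasFDerivAt
    rw [gradient, gradient, gradient, h5.fderiv, map_sub]
  have h1 : HasL2Gradient univ (fun x => φ x - ψ x) fun x => gradient φ x - gradient ψ x :=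
    hg ▸ h.hasL2Gradient
  have h2 : HasL2Gradient U (fun x => φ x - ψ x) fun x => gradient φ x - gradient ψ x :=
    hg ▸ h.hasL2Gradient
  rw [dist_eq_norm, dist_eq_norm, toH1_sub _ _ h1, toH1_sub _ _ h2]
  have h3 := h.norm_toH1_univ
  simp only [hg] at h3
  exact h3

/-- Extension by zero is isometric on test functions, so approximating test functions also converge
in `H¹(ℝⁿ)`. A subsequence converges quasi-everywhere, and every term vanishes outside `U`. -/
theorem exists_extension_of_mem_h10 {U : Set (Eu n)} {v : H1 U} (hv : v ∈ H10 U) :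
    ∃ (w : H1 (univ : Set (Eu n))) (f : Eu n → ℝ), (∀ᵐ x ∂(volume.restrict U), fn w x = fn v x) ∧
      IsQuasiContRep f w ∧ capacity {x | x ∉ U ∧ f x ≠ 0} = 0 := by
  obtain ⟨s, hs, hsv⟩ := mem_closure_iff_seq_limit.1
    (show v ∈ closure (testSpace U : Set (H1 U)) from hv)
  choose φ hφ hsφ using hs
  set z : ℕ → H1 (univ : Set (Eu n)) := fun k => (hφ k).hasL2Gradient.toH1 with hz
  have hcz : CauchySeq z := by
    have hcs := hsv.cauchySeq
    rw [Metric.cauchySeq_iff] at hcs ⊢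
    intro ε hε
    obtain ⟨N, hN⟩ := hcs ε hε
    refine ⟨N, fun k hk l hl => ?_⟩
    rw [hz, (hφ k).dist_toH1_univ (hφ l), ← hsφ, ← hsφ]
    exact hN k hk l hl
  obtain ⟨w, hw⟩ := cauchySeq_tendsto_of_complete hcz
  obtain ⟨ns, f, N, -, hf, hN, hlim⟩ := exists_subseq_tendsto_qe
    (fun k => (hφ k).smooth.continuous) (v := z) (fun k => by
      filter_upwards [ae_univ ((hφ k).hasL2Gradient (U := univ)).fn_toH1] with x hx
      exact hx.symm) hw
  refine ⟨w, f, ?_, hf, capacity_eq_zero_mono ?_ hN⟩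
  · have h1 : ∀ k, restrictH1 U (z k) = s k := by
      intro k
      rw [hsφ k]
      refine h1_ext ?_ ?_
      · filter_upwards [fn_restrictH1 (U := U) (z k), ((hφ k).hasL2Gradient (U := U)).fn_toH1,
          ae_restrict_of_ae_univ ((hφ k).hasL2Gradient (U := univ)).fn_toH1] with x h1 h2 h3
        rw [h1, h2, h3]
      · filter_upwards [grad_restrictH1 (U := U) (z k), ((hφ k).hasL2Gradient (U := U)).grad_toH1,
          ae_restrict_of_ae_univ ((hφ k).hasL2Gradient (U := univ)).grad_toH1] with x h1 h2 h3
        rw [h1, h2, h3]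
    have h2 := ((restrictH1 U).continuous.tendsto w).comp hw
    have h3 : restrictH1 U w = v := tendsto_nhds_unique h2 (hsv.congr fun k => (h1 k).symm)
    rw [← h3]
    filter_upwards [fn_restrictH1 (U := U) w] with x hx
    exact hx.symm
  · rintro x ⟨hxU, hne⟩
    by_contra hxN
    refine hne (tendsto_nhds_unique (hlim x hxN) ?_)
    refine tendsto_const_nhds.congr fun k => ?_
    exact (image_eq_zero_of_notMem_tsupport fun h => hxU ((hφ _).supp h)).symm

theorem trace_eq_zero_of_mem_h10 {Ω : Set (Eu n)} (hn : n ≠ 0) (hΩ : IsOpen Ω)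
    {T : H1 Ω →L[ℝ] H1 (univ : Set (Eu n))} (hT : IsExtensionOperator T) {v : H1 Ω}
    (hv : v ∈ H10 Ω) : trace T v = 0 := by
  obtain ⟨w, f, hwv, hf, hcap⟩ := exists_extension_of_mem_h10 hv
  refine Subtype.ext ?_
  rw [trace_eq hn hΩ hT hwv hf]
  change _ = restrictBoundary Ω fun _ => 0
  rw [restrictBoundary_eq_iff]
  refine capacity_eq_zero_mono ?_ hcap
  rintro x ⟨hx, hne⟩
  -- The frontier of an open set is disjoint from it.
  rw [hΩ.frontier_eq] at hx
  exact ⟨hx.2, by simpa using hne⟩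

/-! ### Functions with zero trace belong to `H¹₀` -/

theorem exists_smooth_cutoff {K Ω : Set (Eu n)} (hK : IsCompact K) (hΩ : IsOpen Ω) (h : K ⊆ Ω) :
    ∃ χ : Eu n → ℝ, IsTest Ω χ ∧ ∀ x ∈ K, χ x = 1 := by
  obtain ⟨K', hK', h1, h2⟩ := exists_compact_between hK hΩ h
  obtain ⟨f, hf0, hf1, -⟩ := exists_contMDiffMap_zero_one_of_isClosed (n := ⊤)
    (modelWithCornersSelf ℝ (Eu n)) (isOpen_interior (s := K')).isClosed_compl hK.isClosed
    (disjoint_left.2 fun x hx hxK => hx (h1 hxK))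
  have hsupp : tsupport (f : Eu n → ℝ) ⊆ K' := by
    refine closure_minimal (fun x hx => ?_) hK'.isClosed
    by_contra hxK
    exact hx (hf0 fun hxi => hxK (interior_subset hxi))
  exact ⟨f, ⟨contMDiff_iff_contDiff.1 f.contMDiff, hK'.of_isClosed_subset (isClosed_tsupport _) hsupp,
    hsupp.trans h2⟩, fun x hx => hf1 hx⟩

theorem gradient_mul {φ ψ : Eu n → ℝ} (hφ : ContDiff ℝ 1 φ) (hψ : ContDiff ℝ 1 ψ) (x : Eu n) :
    gradient (fun x => φ x * ψ x) x = φ x • gradient ψ x + ψ x • gradient φ x := by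
  have h := ((hφ.differentiable one_ne_zero) x).hasFDerivAt.mul
    ((hψ.differentiable one_ne_zero) x).hasFDerivAt
  have h2 : fderiv ℝ (fun x => φ x * ψ x) x = _ := h.fderiv
  rw [gradient, h2, map_add, gradient, gradient, map_smulₛₗ, map_smulₛₗ]
  simp

/-- A Sobolev function that vanishes in `Ω` off a compact subset of `Ω` restricts to an element of
`H¹₀(Ω)`. -/
theorem restrictH1_mem_h10_of_isCompact {Ω K : Set (Eu n)} (hΩ : IsOpen Ω) (hK : IsCompact K)
    (hKΩ : K ⊆ Ω) {z : H1 (univ : Set (Eu n))}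
    (hz : ∀ᵐ x ∂volume, x ∈ Ω → x ∉ K → fn z x = 0) : restrictH1 Ω z ∈ H10 Ω := by
  obtain ⟨χ, hχ, hχK⟩ := exists_smooth_cutoff hK hΩ hKΩ
  have hz2 : MemLp (fn z) 2 volume := memLp_univ_iff.1 (hasL2Gradient z).memLp
  have hg2 : MemLp (grad z) 2 volume := memLp_univ_iff.1 (hasL2Gradient z).memLp_grad
  have hzl := hz2.locallyIntegrable (by norm_num)
  have hχ1 : ContDiff ℝ 1 χ := hχ.smooth.of_le (by simp)
  obtain ⟨C, hC⟩ := hχ.compact.exists_bound_of_continuous hχ.smooth.continuous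
  obtain ⟨D, hD⟩ := (hasCompactSupport_gradient hχ.compact).exists_bound_of_continuous
    (continuous_gradient hχ1)
  -- The products `χ * ψ j` are test functions on `Ω` that converge in `H¹(Ω)` to `χ z`.
  set ψ : ℕ → Eu n → ℝ := fun j => mollify (bumpSeq n j) (fn z) with hψ
  have hψs : ∀ j, ContDiff ℝ ∞ (ψ j) := fun j => contDiff_mollify _ hzl
  have hψ2 : ∀ j, MemLp (ψ j) 2 volume := fun j => memLp_mollify _ hz2
  have hψg : ∀ j, gradient (ψ j) = mollify (bumpSeq n j) (grad z) := fun j =>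
    gradient_mollify _ (hasL2Gradient z)
  have hψg2 : ∀ j, MemLp (gradient (ψ j)) 2 volume := fun j => by
    rw [hψg]; exact memLp_mollify _ hg2
  have htest : ∀ j, IsTest Ω fun x => χ x * ψ j x := fun j =>
    ⟨hχ.smooth.mul (hψs j), hχ.compact.mul_right, (tsupport_mul_subset_left).trans hχ.supp⟩
  have hgr : ∀ j, gradient (fun x => χ x * ψ j x) =
      fun x => χ x • gradient (ψ j) x + ψ j x • gradient χ x := fun j =>
    funext fun x => gradient_mul hχ1 ((hψs j).of_le (by simp)) x
  have m1 : MemLp (fun x => χ x • fn z x) 2 volume :=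
    hz2.of_le_mul (c := C) (hχ.smooth.continuous.aestronglyMeasurable.smul hz2.1)
      (ae_of_all _ fun x => by rw [norm_smul]; gcongr; exact hC x)
  have m2 : MemLp (fun x => χ x • grad z x) 2 volume :=
    hg2.of_le_mul (c := C) (hχ.smooth.continuous.aestronglyMeasurable.smul hg2.1)
      (ae_of_all _ fun x => by rw [norm_smul]; gcongr; exact hC x)
  have m3 : MemLp (fun x => fn z x • gradient χ x) 2 volume :=
    hz2.of_le_mul (c := D) (hz2.1.smul (continuous_gradient hχ1).aestronglyMeasurable)
      (ae_of_all _ fun x => by rw [norm_smul, mul_comm]; gcongr; exact hD x)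
  have t1 := tendsto_eLpNorm_mollify_sub (tendsto_bumpSeq_rOut (n := n)) hz2
  have t2 := tendsto_eLpNorm_mollify_sub (tendsto_bumpSeq_rOut (n := n)) hg2
  have hlim1 : Tendsto (fun j => eLpNorm (fun x => χ x * ψ j x - χ x * fn z x) 2
      (volume.restrict Ω)) atTop (𝓝 0) := by
    have t : Tendsto (fun j => ENNReal.ofReal C * eLpNorm (fun x => ψ j x - fn z x) 2 volume) atTop
        (𝓝 0) := by
      simpa using ENNReal.Tendsto.const_mul (a := ENNReal.ofReal C) t1 (Or.inr (by simp))
    refine tendsto_of_tendsto_of_tendsto_of_le_of_le tendsto_const_nhds t (fun _ => zero_le)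
      fun j => (eLpNorm_restrict_le _ _ _ _).trans ?_
    refine eLpNorm_le_mul_eLpNorm_of_ae_le_mul (ae_of_all _ fun x => ?_) 2
    rw [← mul_sub, norm_mul]
    gcongr
    exact hC x
  have hlim2 : Tendsto (fun j => eLpNorm (fun x => gradient (fun x => χ x * ψ j x) x -
      (χ x • grad z x + fn z x • gradient χ x)) 2 (volume.restrict Ω)) atTop (𝓝 0) := by
    have t : Tendsto (fun j => ENNReal.ofReal C *
        eLpNorm (fun x => gradient (ψ j) x - grad z x) 2 volume +
        ENNReal.ofReal D * eLpNorm (fun x => ψ j x - fn z x) 2 volume) atTop (𝓝 0) := by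
      have h3 := (ENNReal.Tendsto.const_mul (a := ENNReal.ofReal C) t2 (Or.inr (by simp))).add
        (ENNReal.Tendsto.const_mul (a := ENNReal.ofReal D) t1 (Or.inr (by simp)))
      simp only [mul_zero, add_zero] at h3
      simpa only [hψg] using h3
    refine tendsto_of_tendsto_of_tendsto_of_le_of_le tendsto_const_nhds t (fun _ => zero_le)
      fun j => (eLpNorm_restrict_le _ _ _ _).trans ?_
    have e : (fun x => gradient (fun x => χ x * ψ j x) x -
        (χ x • grad z x + fn z x • gradient χ x)) =
        (fun x => χ x • (gradient (ψ j) x - grad z x)) +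
          fun x => (ψ j x - fn z x) • gradient χ x := by
      funext x
      rw [hgr]
      simp only [Pi.add_apply, smul_sub, sub_smul]
      abel
    rw [e]
    refine (eLpNorm_add_le (hχ.smooth.continuous.aestronglyMeasurable.smul
      ((hψg2 j).sub hg2).1) ((((hψ2 j).sub hz2).1).smul
        (continuous_gradient hχ1).aestronglyMeasurable) (by norm_num)).trans ?_
    refine add_le_add ?_ ?_
    · refine eLpNorm_le_mul_eLpNorm_of_ae_le_mul (ae_of_all _ fun x => ?_) 2
      change ‖χ x • (gradient (ψ j) x - grad z x)‖ ≤ _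
      rw [norm_smul]
      gcongr
      exact hC x
    · refine eLpNorm_le_mul_eLpNorm_of_ae_le_mul (ae_of_all _ fun x => ?_) 2
      change ‖(ψ j x - fn z x) • gradient χ x‖ ≤ _
      rw [norm_smul, mul_comm]
      gcongr
      exact hD x
  have n1 : MemLp (fun x => χ x * fn z x) 2 (volume.restrict Ω) := m1.mono_measure
    Measure.restrict_le_self
  have n2 : MemLp (fun x => χ x • grad z x + fn z x • gradient χ x) 2 (volume.restrict Ω) :=
    (m2.add m3).mono_measure Measure.restrict_le_self
  have hlimit := hasL2Gradient_of_tendsto (fun j => (htest j).hasL2Gradient (U := Ω)) n1 n2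
    hlim1 hlim2
  have htend := tendsto_toH1 (fun j => (htest j).hasL2Gradient (U := Ω)) hlimit hlim1 hlim2
  -- In `Ω` one has `χ z = z`: the cutoff is `1` on `K` and `z` vanishes off `K`. Uniqueness of weak
  -- gradients then identifies the elements of `H¹(Ω)`.
  have heq : restrictH1 Ω z = hlimit.toH1 := by
    refine h1_ext_of_isOpen hΩ ?_
    filter_upwards [fn_restrictH1 (U := Ω) z, hlimit.fn_toH1,
      (ae_restrict_iff' hΩ.measurableSet).2 hz] with x h1 h2 h3
    rw [h1, h2]
    by_cases hx : x ∈ K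
    · rw [hχK x hx, one_mul]
    · rw [h3 hx, mul_zero]
  rw [heq]
  exact (isClosed_h10 Ω).mem_of_tendsto htend
    (Eventually.of_forall fun j => (htest j).toH1_mem_h10)

/-- Composition with functions converging to the identity. -/
theorem tendsto_toH1_comp {h : ℕ → ℝ → ℝ} {C : ℝ} (hh : ∀ j, ContDiff ℝ 1 (h j))
    (hC : ∀ j t, |deriv (h j) t| ≤ C) (h0 : ∀ j, h j 0 = 0) {d : ℝ → ℝ}
    (hlim : ∀ t, Tendsto (fun j => h j t) atTop (𝓝 t))
    (hd : ∀ t, Tendsto (fun j => deriv (h j) t) atTop (𝓝 (d t)))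
    (w : H1 (univ : Set (Eu n))) :
    Tendsto (fun j => ((hasL2Gradient w).comp (hh j) (hC j) (h0 j)).toH1) atTop (𝓝 w) := by
  have hle : ∀ j t, |h j t| ≤ C * |t| := by
    intro j t
    have := Convex.norm_image_sub_le_of_norm_deriv_le (f := h j) (C := C) (s := univ) (x := 0)
      (y := t) (fun x _ => (hh j).differentiable one_ne_zero x) (fun x _ => hC j x) convex_univ
      (mem_univ _) (mem_univ _)
    simpa [h0] using this
  have mw := (hasL2Gradient w).memLp
  have mg := (hasL2Gradient w).memLp_grad
  have t1 : Tendsto (fun j => eLpNorm (fun x => h j (fn w x) - fn w x) 2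
      (volume.restrict univ)) atTop (𝓝 0) := by
    refine tendsto_eLpNorm_of_dominated (b := fun x => (C + 1) * ‖fn w x‖) (mw.norm.const_mul _)
      (fun j => ((hh j).continuous.comp_aestronglyMeasurable mw.1).sub mw.1)
      (fun j => ae_of_all _ fun x => ?_) (ae_of_all _ fun x => ?_)
    · calc ‖h j (fn w x) - fn w x‖ ≤ |h j (fn w x)| + |fn w x| := abs_sub _ _
        _ ≤ C * |fn w x| + |fn w x| := by gcongr; exact hle _ _
        _ = _ := by rw [Real.norm_eq_abs]; ring
    · simpa using (hlim (fn w x)).sub_const (fn w x)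
  have a1 : ∀ j, AEStronglyMeasurable (fun x => deriv (h j) (fn w x)) (volume.restrict univ) :=
    fun j => ((hh j).continuous_deriv le_rfl).comp_aestronglyMeasurable mw.1
  have t2 := tendsto_eLpNorm_smul_sub (a := fun j x => deriv (h j) (fn w x))
    (a₀ := fun x => d (fn w x)) mg a1 (fun j => ae_of_all _ fun x => hC j _)
    (ae_of_all _ fun x => hd (fn w x))
  have md : MemLp (fun x => d (fn w x) • grad w x) 2 (volume.restrict univ) := by
    refine mg.of_le_mul (c := C) ((aestronglyMeasurable_of_tendsto_ae atTop a1
      (ae_of_all _ fun x => hd (fn w x))).smul mg.1) (ae_of_all _ fun x => ?_)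
    rw [norm_smul]
    gcongr
    exact le_of_tendsto' (hd _).abs fun j => hC j _
  have hl := hasL2Gradient_of_tendsto (fun j => (hasL2Gradient w).comp (hh j) (hC j) (h0 j))
    mw md t1 t2
  -- The limiting coefficient `d` need not be `1`, but uniqueness of the weak gradient forces `d(w)
  -- ∇w = ∇w` almost everywhere. For `d = 0` at the origin this contains the fact that `∇w = 0`
  -- almost everywhere on `{w = 0}`.
  have heq : hl.toH1 = w := h1_ext_of_isOpen isOpen_univ hl.fn_toH1
  have := tendsto_toH1 (fun j => (hasL2Gradient w).comp (hh j) (hC j) (h0 j)) hl t1 t2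
  rwa [heq] at this

/-- The cutoff `s ↦ s S(s² - 1)` with `S` the smooth transition function. -/
def gapFun (s : ℝ) : ℝ := s * Real.smoothTransition (s ^ 2 - 1)

theorem contDiff_gapFun : ContDiff ℝ 1 gapFun :=
  contDiff_id.mul (Real.smoothTransition.contDiff.comp ((contDiff_id.pow 2).sub contDiff_const))

theorem gapFun_of_sq_le {s : ℝ} (h : s ^ 2 ≤ 1) : gapFun s = 0 := by
  rw [gapFun, Real.smoothTransition.zero_of_nonpos (by linarith), mul_zero]

theorem gapFun_of_le_sq {s : ℝ} (h : 2 ≤ s ^ 2) : gapFun s = s := by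
  rw [gapFun, Real.smoothTransition.one_of_one_le (by linarith), mul_one]

theorem deriv_gapFun_of_sq_lt {s : ℝ} (h : s ^ 2 < 1) : deriv gapFun s = 0 := by
  have : gapFun =ᶠ[𝓝 s] fun _ => 0 := by
    filter_upwards [(isOpen_lt (continuous_pow 2) continuous_const).mem_nhds h] with t ht
    exact gapFun_of_sq_le (le_of_lt ht)
  rw [this.deriv_eq]
  simp

theorem deriv_gapFun_of_lt_sq {s : ℝ} (h : 2 < s ^ 2) : deriv gapFun s = 1 := by
  have : gapFun =ᶠ[𝓝 s] fun t => t := by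
    filter_upwards [(isOpen_lt continuous_const (continuous_pow 2)).mem_nhds h] with t ht
    exact gapFun_of_le_sq (le_of_lt ht)
  rw [this.deriv_eq]
  exact deriv_id s

theorem exists_abs_deriv_gapFun_le : ∃ C : ℝ, 0 < C ∧ ∀ s, |deriv gapFun s| ≤ C := by
  obtain ⟨C, hC⟩ := isCompact_Icc.exists_bound_of_continuousOn (s := Icc (-2 : ℝ) 2)
    (contDiff_gapFun.continuous_deriv le_rfl).continuousOn
  refine ⟨max C 1, by positivity, fun s => ?_⟩
  by_cases hs : s ∈ Icc (-2 : ℝ) 2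
  · exact (hC s hs).trans (le_max_left _ _)
  · rw [deriv_gapFun_of_lt_sq, abs_one]
    · exact le_max_right _ _
    · rw [mem_Icc, ← abs_le] at hs
      rw [← sq_abs]
      nlinarith

theorem abs_sub_gapFun_le (s : ℝ) : |s - gapFun s| ≤ 2 := by
  by_cases hs : 2 ≤ s ^ 2
  · rw [gapFun_of_le_sq hs]; simp
  · have h1 : |s| ≤ 2 := by
      rw [← sq_abs] at hs
      nlinarith [abs_nonneg s]
    have h2 : s - gapFun s = s * (1 - Real.smoothTransition (s ^ 2 - 1)) := by
      rw [gapFun]; ring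
    have h3 := Real.smoothTransition.nonneg (s ^ 2 - 1)
    have h4 := Real.smoothTransition.le_one (s ^ 2 - 1)
    rw [h2, abs_mul, abs_of_nonneg (show 0 ≤ 1 - Real.smoothTransition (s ^ 2 - 1) by linarith)]
    nlinarith [abs_nonneg s]

/-- The rescaling `c⁻¹ h(c t)` preserves the bound on the derivative, so one constant serves all
cutoffs of the family. -/
theorem hasDerivAt_scale {h : ℝ → ℝ} (hh : ContDiff ℝ 1 h) {c : ℝ} (hc : c ≠ 0) (t : ℝ) :
    HasDerivAt (fun t => c⁻¹ * h (c * t)) (deriv h (c * t)) t := by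
  have h1 : HasDerivAt (fun t : ℝ => c * t) c t := by
    simpa using (hasDerivAt_id t).const_mul c
  refine ((((hh.differentiable one_ne_zero) (c * t)).hasDerivAt.comp t h1).const_mul
    c⁻¹).congr_deriv ?_
  field_simp

theorem contDiff_scale {h : ℝ → ℝ} (hh : ContDiff ℝ 1 h) (c : ℝ) :
    ContDiff ℝ 1 fun t => c⁻¹ * h (c * t) :=
  contDiff_const.mul (hh.comp (contDiff_const.mul contDiff_id))

/-- The competitor `e` covers an open set `O` containing the discontinuities of `f` and the boundary
points where `f ≠ 0`. On the rest of the closure `f` is continuous and vanishes on `∂Ω`, so `{|f| ≥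
δ}` is there a compact set that misses the boundary. -/
theorem exists_isCapCompetitor_of_frontier {Ω : Set (Eu n)}
    (hb : Bornology.IsBounded Ω) {f : Eu n → ℝ} (hf : QuasiContinuous f)
    (h0 : capacity {x | x ∈ frontier Ω ∧ f x ≠ 0} = 0) {δ : ℝ} (hδ : 0 < δ) {ε : ℝ} (hε : 0 < ε) :
    ∃ (e : H1 (univ : Set (Eu n))) (K : Set (Eu n)), ‖e‖ < ε ∧ IsCompact K ∧ K ⊆ Ω ∧
      (∀ᵐ x ∂volume, 0 ≤ fn e x) ∧
      ∀ᵐ x ∂volume, x ∈ Ω → x ∉ K → 1 ≤ fn e x ∨ |f x| < δ := by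
  have hpos : 0 < ENNReal.ofReal (ε ^ 2) / 2 :=
    ENNReal.div_pos (ENNReal.ofReal_pos.2 (by positivity)).ne' (by simp)
  obtain ⟨G, hG, hGc, hfG⟩ := hf _ hpos
  have hcap : capacity (G ∪ {x | x ∈ frontier Ω ∧ f x ≠ 0}) < ENNReal.ofReal (ε ^ 2) := by
    refine (capacity_union_le _ _).trans_lt ?_
    rw [h0, mul_zero, add_zero]
    exact ENNReal.mul_lt_of_lt_div' hGc
  obtain ⟨e, ⟨he0, O, hO, hGO, he1⟩, hle⟩ := exists_isCapCompetitor_of_capacity_lt hε hcap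
  have hcl : IsClosed ((closure Ω ∩ Oᶜ) ∩ (fun x => |f x|) ⁻¹' Ici δ) :=
    ContinuousOn.preimage_isClosed_of_isClosed
      (hfG.mono fun x hx hxG => hx.2 (hGO (Or.inl hxG))).abs
      (isClosed_closure.inter hO.isClosed_compl) isClosed_Ici
  refine ⟨e, (closure Ω ∩ Oᶜ) ∩ (fun x => |f x|) ⁻¹' Ici δ, hle,
    Metric.isCompact_of_isClosed_isBounded hcl
      (hb.closure.subset fun x hx => hx.1.1), ?_, he0, ?_⟩
  · rintro x ⟨⟨hx1, hx2⟩, hx3⟩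
    by_contra hxΩ
    have hxf : x ∈ frontier Ω := ⟨hx1, fun h => hxΩ (interior_subset h)⟩
    refine hx2 (hGO (Or.inr ⟨hxf, fun h => ?_⟩))
    rw [mem_preimage, h, abs_zero, mem_Ici] at hx3
    linarith
  · filter_upwards [he1] with x hx hxΩ hxK
    by_cases hxO : x ∈ O
    · exact Or.inl (hx hxO)
    · right
      by_contra hlt
      exact hxK ⟨⟨subset_closure hxΩ, hxO⟩, not_lt.1 hlt⟩

/-- The factor `1 - S(e)` annihilates the region where the competitor `e` is at least `1`.
Boundedness of `g` is what controls the derivative in the second variable, and hence the need for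
truncation near infinity. -/
theorem isC1Bounded_mul_transition {g : ℝ → ℝ} (hg : ContDiff ℝ 1 g) {C M L : ℝ}
    (hC : ∀ t, |deriv g t| ≤ C) (hM : ∀ t, |g t| ≤ M) (h0 : g 0 = 0) (hL0 : 0 ≤ L)
    (hL : ∀ t, |deriv Real.smoothTransition t| ≤ L) :
    IsC1Bounded (fun p => g p.1 * (1 - Real.smoothTransition p.2))
      (fun p => deriv g p.1 * (1 - Real.smoothTransition p.2))
      (fun p => -(g p.1 * deriv Real.smoothTransition p.2)) (C + M * L) := by
  have hS : ContDiff ℝ 1 Real.smoothTransition := Real.smoothTransition.contDiff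
  have hC0 : 0 ≤ C := (abs_nonneg _).trans (hC 0)
  have hM0 : 0 ≤ M := (abs_nonneg _).trans (hM 0)
  refine ⟨fun p => ?_, ?_, ?_, fun p => ?_, fun p => ?_, by simp [h0]⟩
  · have h1 := ((hg.differentiable one_ne_zero) p.1).hasDerivAt.comp_hasFDerivAt p
      (ContinuousLinearMap.fst ℝ ℝ ℝ).hasFDerivAt
    have h2 := ((hS.differentiable one_ne_zero) p.2).hasDerivAt.comp_hasFDerivAt p
      (ContinuousLinearMap.snd ℝ ℝ ℝ).hasFDerivAt
    refine (h1.mul (h2.const_sub 1)).congr_fderiv ?_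
    ext <;> simp [mul_comm]
  · exact ((hg.continuous_deriv le_rfl).comp continuous_fst).mul
      (continuous_const.sub (hS.continuous.comp continuous_snd))
  · exact ((hg.continuous.comp continuous_fst).mul
      ((hS.continuous_deriv le_rfl).comp continuous_snd)).neg
  · have h1 := Real.smoothTransition.nonneg p.2
    have h2 := Real.smoothTransition.le_one p.2
    rw [abs_mul, abs_of_nonneg (show 0 ≤ 1 - Real.smoothTransition p.2 by linarith)]
    have h3 : 0 ≤ M * L := by positivity
    have h4 := hC p.1
    nlinarith [abs_nonneg (deriv g p.1)]
  · rw [abs_neg, abs_mul]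
    have h3 : |g p.1| * |deriv Real.smoothTransition p.2| ≤ M * L :=
      mul_le_mul (hM _) (hL _) (abs_nonneg _) hM0
    linarith

theorem tendsto_one_sub_smoothTransition {ι : Type*} {l : Filter ι} {b : ι → ℝ}
    (hb : Tendsto b l (𝓝 0)) : Tendsto (fun j => 1 - Real.smoothTransition (b j)) l (𝓝 1) := by
  have hS : ContDiff ℝ 1 Real.smoothTransition := Real.smoothTransition.contDiff
  simpa using ((hS.continuous.tendsto 0).comp hb).const_sub 1

/-! ### Convergence of the products with capacitary cutoffs. -/

section Truncation

variable {α E : Type*} [MeasurableSpace α] {μ : Measure α} [NormedAddCommGroup E]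
  [NormedSpace ℝ E]

theorem tendsto_eLpNorm_mul_transition {u : α → ℝ} (hu : MemLp u 2 μ) {b : ℕ → α → ℝ}
    (hb : ∀ j, AEStronglyMeasurable (b j) μ)
    (hb0 : ∀ᵐ x ∂μ, Tendsto (fun j => b j x) atTop (𝓝 0)) :
    Tendsto (fun j => eLpNorm (fun x => u x * (1 - Real.smoothTransition (b j x)) - u x) 2 μ)
      atTop (𝓝 0) := by
  have hS : ContDiff ℝ 1 Real.smoothTransition := Real.smoothTransition.contDiff
  have := tendsto_eLpNorm_smul_sub (C := 1)
    (a := fun j x => 1 - Real.smoothTransition (b j x)) (a₀ := fun _ => 1) hu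
    (fun j => aestronglyMeasurable_const.sub (hS.continuous.comp_aestronglyMeasurable (hb j)))
    (fun j => ae_of_all _ fun x => ?_) (hb0.mono fun x hx => tendsto_one_sub_smoothTransition hx)
  · refine this.congr fun j => ?_
    congr 1
    funext x
    rw [smul_eq_mul, smul_eq_mul, one_mul, mul_comm]
  · have h1 := Real.smoothTransition.nonneg (b j x)
    have h2 := Real.smoothTransition.le_one (b j x)
    rw [abs_le]; constructor <;> linarith

/-- The term with the gradient of `u` converges by domination; the term with the gradients `c j` of
the competitors has bounded coefficients and tends to zero with them. -/
theorem tendsto_eLpNorm_grad_mul_transition {g : ℝ → ℝ} (hg : ContDiff ℝ 1 g) {D : ℝ}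
    (hFa : ∀ p : ℝ × ℝ, |deriv g p.1 * (1 - Real.smoothTransition p.2)| ≤ D)
    (hFb : ∀ p : ℝ × ℝ, |-(g p.1 * deriv Real.smoothTransition p.2)| ≤ D)
    {u : α → ℝ} {k : α → E} (hu : MemLp u 2 μ) (hk : MemLp k 2 μ) {b : ℕ → α → ℝ}
    {c : ℕ → α → E} (hb : ∀ j, AEStronglyMeasurable (b j) μ)
    (hb0 : ∀ᵐ x ∂μ, Tendsto (fun j => b j x) atTop (𝓝 0)) (hc : ∀ j, MemLp (c j) 2 μ)
    (hc0 : Tendsto (fun j => eLpNorm (c j) 2 μ) atTop (𝓝 0)) :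
    Tendsto (fun j => eLpNorm (fun x =>
      ((deriv g (u x) * (1 - Real.smoothTransition (b j x))) • k x +
        (-(g (u x) * deriv Real.smoothTransition (b j x))) • c j x) -
      deriv g (u x) • k x) 2 μ) atTop (𝓝 0) := by
  have hS : ContDiff ℝ 1 Real.smoothTransition := Real.smoothTransition.contDiff
  have ma : ∀ j, AEStronglyMeasurable (fun x => deriv g (u x) *
      (1 - Real.smoothTransition (b j x))) μ := fun j =>
    ((hg.continuous_deriv le_rfl).comp_aestronglyMeasurable hu.1).mul
      (aestronglyMeasurable_const.sub (hS.continuous.comp_aestronglyMeasurable (hb j)))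
  have mb : ∀ j, AEStronglyMeasurable (fun x => -(g (u x) *
      deriv Real.smoothTransition (b j x))) μ := fun j =>
    ((hg.continuous.comp_aestronglyMeasurable hu.1).mul
      ((hS.continuous_deriv le_rfl).comp_aestronglyMeasurable (hb j))).neg
  have t2 := tendsto_eLpNorm_smul_sub
      (a := fun j x => deriv g (u x) * (1 - Real.smoothTransition (b j x)))
      (a₀ := fun x => deriv g (u x)) hk ma
      (fun j => ae_of_all _ fun x => hFa (u x, b j x)) (by
        filter_upwards [hb0] with x hx
        have := (tendsto_one_sub_smoothTransition hx).const_mul (deriv g (u x))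
        rwa [mul_one] at this)
  have t3 : Tendsto (fun j => ENNReal.ofReal D * eLpNorm (c j) 2 μ) atTop (𝓝 0) := by
    simpa using ENNReal.Tendsto.const_mul (a := ENNReal.ofReal D) hc0 (Or.inr (by simp))
  have h5 := t2.add t3
  rw [add_zero] at h5
  refine tendsto_of_tendsto_of_tendsto_of_le_of_le tendsto_const_nhds h5 (fun _ => zero_le)
    fun j => ?_
  have e : (fun x => ((deriv g (u x) * (1 - Real.smoothTransition (b j x))) • k x +
      (-(g (u x) * deriv Real.smoothTransition (b j x))) • c j x) - deriv g (u x) • k x) =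
      (fun x => (deriv g (u x) * (1 - Real.smoothTransition (b j x))) • k x -
        deriv g (u x) • k x) +
      fun x => (-(g (u x) * deriv Real.smoothTransition (b j x))) • c j x := by
    funext x
    exact add_sub_right_comm _ _ _
  rw [e]
  refine (eLpNorm_add_le (((ma j).smul hk.1).sub
    (((hg.continuous_deriv le_rfl).comp_aestronglyMeasurable hu.1).smul hk.1))
    ((mb j).smul (hc j).1) (by norm_num)).trans ?_
  refine add_le_add le_rfl (eLpNorm_le_mul_eLpNorm_of_ae_le_mul (ae_of_all _ fun x => ?_) 2)
  refine (norm_smul_le _ (c j x)).trans ?_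
  gcongr
  exact hFb (u x, b j x)

end Truncation

theorem exists_subseq_fn_tendsto_zero {e : ℕ → H1 (univ : Set (Eu n))}
    (he : Tendsto e atTop (𝓝 0)) : ∃ ns : ℕ → ℕ, StrictMono ns ∧
      (∀ᵐ x ∂(volume.restrict univ), Tendsto (fun j => fn (e (ns j)) x) atTop (𝓝 0)) ∧
      Tendsto (fun j => eLpNorm (grad (e (ns j))) 2 (volume.restrict univ)) atTop (𝓝 0) := by
  obtain ⟨ns, hns, hae⟩ := exists_subseq_tendsto_ae (f := fun j x => fn (e j) x)
    (g := fun x => fn (0 : H1 (univ : Set (Eu n))) x)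
    (fun j => (hasL2Gradient (e j)).memLp.1) (hasL2Gradient 0).memLp.1
    (tendsto_eLpNorm_fn_sub he)
  refine ⟨ns, hns, ?_, ?_⟩
  · filter_upwards [hae, Lp.coeFn_zero ℝ 2 (volume.restrict (univ : Set (Eu n)))] with x h1 h2
    have h3 : fn (0 : H1 (univ : Set (Eu n))) x = 0 := h2
    rwa [h3] at h1
  · have h1 := tendsto_eLpNorm_of_tendsto_lp
      ((continuous_grad.tendsto _).comp (he.comp hns.tendsto_atTop))
    refine h1.congr fun j => eLpNorm_congr_ae ?_
    filter_upwards [Lp.coeFn_zero (Eu n) 2 (volume.restrict (univ : Set (Eu n)))] with x hx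
    have h3 : grad (0 : H1 (univ : Set (Eu n))) x = 0 := hx
    rw [h3, sub_zero]
    rfl

/-- Truncations of a Sobolev function that vanishes quasi-everywhere on `∂Ω` belong to
`H¹₀(Ω)`. -/
theorem restrictH1_comp_mem_h10 {Ω : Set (Eu n)} (hΩ : IsOpen Ω) (hb : Bornology.IsBounded Ω)
    {w : H1 (univ : Set (Eu n))} {f : Eu n → ℝ} (hf : IsQuasiContRep f w)
    (h0 : capacity {x | x ∈ frontier Ω ∧ f x ≠ 0} = 0) {g : ℝ → ℝ} (hg : ContDiff ℝ 1 g) {C M : ℝ}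
    (hC : ∀ t, |deriv g t| ≤ C) (hM : ∀ t, |g t| ≤ M) (hg0 : g 0 = 0) {δ : ℝ} (hδ : 0 < δ)
    (hgδ : ∀ t, |t| < δ → g t = 0) :
    restrictH1 Ω ((hasL2Gradient w).comp hg hC hg0).toH1 ∈ H10 Ω := by
  obtain ⟨L, hL, hLd⟩ := exists_abs_deriv_smoothTransition_le
  have hF := isC1Bounded_mul_transition hg hC hM hg0 hL.le hLd
  -- Competitors of norm below `1 / (k + 1)` tend to `0` in `H¹(ℝⁿ)`, so multiplication by `1 - S(e
  -- k)` has no effect in the limit, while each product vanishes in `Ω` off the compact set `K k`.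
  choose e K hle hK hKΩ he0 heK using fun k : ℕ => exists_isCapCompetitor_of_frontier hb hf.1 h0 hδ
    (ε := 1 / ((k : ℝ) + 1)) (by positivity)
  have he : Tendsto e atTop (𝓝 0) :=
    squeeze_zero_norm (fun k => (hle k).le) tendsto_one_div_add_atTop_nhds_zero_nat
  obtain ⟨ns, hns, hae0, hge⟩ := exists_subseq_fn_tendsto_zero he
  have hz := fun j => hF.hasL2Gradient_comp (hasL2Gradient w) (hasL2Gradient (e (ns j)))
  have hlimit := (hasL2Gradient w).comp hg hC hg0
  have me := fun j => (hasL2Gradient (e (ns j))).memLp.1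
  have t1 := tendsto_eLpNorm_mul_transition hlimit.memLp me hae0
  have t4 := tendsto_eLpNorm_grad_mul_transition hg hF.bound_fst hF.bound_snd
    (hasL2Gradient w).memLp (hasL2Gradient w).memLp_grad me hae0
    (fun j => (hasL2Gradient (e (ns j))).memLp_grad) hge
  have htend := ((restrictH1 Ω).continuous.tendsto _).comp (tendsto_toH1 hz hlimit t1 t4)
  refine (isClosed_h10 Ω).mem_of_tendsto htend (Eventually.of_forall fun j => ?_)
  refine restrictH1_mem_h10_of_isCompact hΩ (hK (ns j)) (hKΩ (ns j)) ?_
  filter_upwards [ae_univ (hz j).fn_toH1, heK (ns j), hf.2] with x h1 h2 h3 hxΩ hxK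
  rw [h1]
  -- Off `K` either the competitor is at least `1`, which kills the cutoff factor, or `|f| < δ`,
  -- which kills `g`.
  rcases h2 hxΩ hxK with h | h
  · rw [Real.smoothTransition.one_of_one_le h, sub_self, mul_zero]
  · rw [← h3, hgδ _ h, zero_mul]

theorem tendsto_deriv_gapFun_mul (t : ℝ) :
    Tendsto (fun m : ℕ => deriv gapFun (((m : ℝ) + 1) * t)) atTop (𝓝 (if t = 0 then 0 else 1)) := by
  split_ifs with h
  · subst h
    simp [deriv_gapFun_of_sq_lt]
  · refine tendsto_const_nhds.congr' ?_
    obtain ⟨N, hN⟩ := exists_nat_gt (2 / t ^ 2)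
    have ht : 0 < t ^ 2 := by positivity
    filter_upwards [eventually_ge_atTop N] with m hm
    refine (deriv_gapFun_of_lt_sq ?_).symm
    have h1 : (N : ℝ) ≤ m := by exact_mod_cast hm
    rw [div_lt_iff₀ ht] at hN
    have h0 : (0 : ℝ) ≤ N := Nat.cast_nonneg N
    calc 2 < (N : ℝ) * t ^ 2 := hN
      _ ≤ ((m : ℝ) + 1) ^ 2 * t ^ 2 := by gcongr; nlinarith
      _ = _ := by ring

theorem tendsto_gapFun_mul (t : ℝ) :
    Tendsto (fun m : ℕ => ((m : ℝ) + 1)⁻¹ * gapFun (((m : ℝ) + 1) * t)) atTop (𝓝 t) := by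
  rcases eq_or_ne t 0 with rfl | h
  · simp [gapFun]
  · refine tendsto_const_nhds.congr' ?_
    obtain ⟨N, hN⟩ := exists_nat_gt (2 / t ^ 2)
    have ht : 0 < t ^ 2 := by positivity
    filter_upwards [eventually_ge_atTop N] with m hm
    have h1 : (N : ℝ) ≤ m := by exact_mod_cast hm
    have h0 : (0 : ℝ) ≤ N := Nat.cast_nonneg N
    rw [div_lt_iff₀ ht] at hN
    rw [gapFun_of_le_sq]
    · field_simp
    · calc 2 ≤ (N : ℝ) * t ^ 2 := hN.le
        _ ≤ ((m : ℝ) + 1) ^ 2 * t ^ 2 := by gcongr; nlinarith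
        _ = _ := by ring

theorem eventually_sq_inv_mul_lt (t : ℝ) :
    ∀ᶠ m : ℕ in atTop, (((m : ℝ) + 1)⁻¹ * t) ^ 2 < 1 := by
  obtain ⟨N, hN⟩ := exists_nat_gt |t|
  filter_upwards [eventually_ge_atTop N] with m hm
  have h1 : (N : ℝ) ≤ m := by exact_mod_cast hm
  rw [sq_lt_one_iff_abs_lt_one, abs_mul, abs_of_pos (show 0 < ((m : ℝ) + 1)⁻¹ by positivity),
    inv_mul_lt_one₀ (by positivity)]
  linarith

/-- The complementary bounded cutoff. -/
def capFun (s : ℝ) : ℝ := s - gapFun s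

theorem contDiff_capFun : ContDiff ℝ 1 capFun := contDiff_id.sub contDiff_gapFun

theorem deriv_capFun (s : ℝ) : deriv capFun s = 1 - deriv gapFun s :=
  ((hasDerivAt_id s).sub (contDiff_gapFun.differentiable one_ne_zero s).hasDerivAt).deriv

theorem tendsto_deriv_capFun_mul (t : ℝ) :
    Tendsto (fun m : ℕ => deriv capFun (((m : ℝ) + 1)⁻¹ * t)) atTop (𝓝 1) := by
  refine tendsto_const_nhds.congr' ?_
  filter_upwards [eventually_sq_inv_mul_lt t] with m hm
  rw [deriv_capFun, deriv_gapFun_of_sq_lt hm, sub_zero]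

theorem tendsto_capFun_mul (t : ℝ) :
    Tendsto (fun m : ℕ => (((m : ℝ) + 1)⁻¹)⁻¹ * capFun (((m : ℝ) + 1)⁻¹ * t)) atTop (𝓝 t) := by
  refine tendsto_const_nhds.congr' ?_
  filter_upwards [eventually_sq_inv_mul_lt t] with m hm
  rw [capFun, gapFun_of_sq_le hm.le, sub_zero, inv_mul_cancel_left₀ (by positivity)]

theorem gapFun_zero : gapFun 0 = 0 := by simp [gapFun]

theorem capFun_zero : capFun 0 = 0 := by simp [capFun, gapFun]

/-- A Sobolev function that vanishes quasi-everywhere on `∂Ω` restricts to an element of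
`H¹₀(Ω)`. -/
theorem restrictH1_mem_h10 {Ω : Set (Eu n)} (hΩ : IsOpen Ω) (hb : Bornology.IsBounded Ω)
    {w : H1 (univ : Set (Eu n))} {f : Eu n → ℝ} (hf : IsQuasiContRep f w)
    (h0 : capacity {x | x ∈ frontier Ω ∧ f x ≠ 0} = 0) : restrictH1 Ω w ∈ H10 Ω := by
  obtain ⟨C, hC0, hC⟩ := exists_abs_deriv_gapFun_le
  have hD : ∀ s, |deriv capFun s| ≤ 1 + C := fun s => by
    rw [deriv_capFun]
    refine (abs_sub _ _).trans ?_
    rw [abs_one]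
    linarith [hC s]
  -- Two families tend to the identity: rescaled `gapFun`, vanishing near `0`, and rescaled
  -- `capFun`, which is bounded. Their composition satisfies the requirements of
  -- `restrictH1_comp_mem_h10`; closedness of `H10 Ω` removes first one truncation and then the
  -- other.
  have cp := fun m : ℕ => contDiff_scale contDiff_gapFun ((m : ℝ) + 1)
  have cq := fun m : ℕ => contDiff_scale contDiff_capFun ((m : ℝ) + 1)⁻¹
  have dp : ∀ (m : ℕ) (t : ℝ), deriv (fun t => ((m : ℝ) + 1)⁻¹ * gapFun (((m : ℝ) + 1) * t)) t =
      deriv gapFun (((m : ℝ) + 1) * t) := fun m t =>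
    (hasDerivAt_scale contDiff_gapFun (by positivity) t).deriv
  have dq : ∀ (m : ℕ) (t : ℝ),
      deriv (fun t => (((m : ℝ) + 1)⁻¹)⁻¹ * capFun (((m : ℝ) + 1)⁻¹ * t)) t =
      deriv capFun (((m : ℝ) + 1)⁻¹ * t) := fun m t =>
    (hasDerivAt_scale contDiff_capFun (by positivity) t).deriv
  have bp : ∀ (m : ℕ) (t : ℝ),
      |deriv (fun t => ((m : ℝ) + 1)⁻¹ * gapFun (((m : ℝ) + 1) * t)) t| ≤ C := fun m t => by
    rw [dp]; exact hC _
  have bq : ∀ (m : ℕ) (t : ℝ),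
      |deriv (fun t => (((m : ℝ) + 1)⁻¹)⁻¹ * capFun (((m : ℝ) + 1)⁻¹ * t)) t| ≤ 1 + C :=
    fun m t => by rw [dq]; exact hD _
  have zp : ∀ m : ℕ, ((m : ℝ) + 1)⁻¹ * gapFun (((m : ℝ) + 1) * 0) = 0 := fun m => by
    simp [gapFun_zero]
  have zq : ∀ m : ℕ, (((m : ℝ) + 1)⁻¹)⁻¹ * capFun (((m : ℝ) + 1)⁻¹ * 0) = 0 := fun m => by
    simp [capFun_zero]
  have tp := tendsto_toH1_comp cp bp zp tendsto_gapFun_mul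
    (fun t => by simp only [dp]; exact tendsto_deriv_gapFun_mul t) w
  refine (isClosed_h10 Ω).mem_of_tendsto (((restrictH1 Ω).continuous.tendsto _).comp tp)
    (Eventually.of_forall fun m => ?_)
  set u := ((hasL2Gradient w).comp (cp m) (bp m) (zp m)).toH1 with hu
  have tq := tendsto_toH1_comp cq bq zq tendsto_capFun_mul
    (fun t => by simp only [dq]; exact tendsto_deriv_capFun_mul t) u
  refine (isClosed_h10 Ω).mem_of_tendsto (((restrictH1 Ω).continuous.tendsto _).comp tq)
    (Eventually.of_forall fun k => ?_)
  have cg : ContDiff ℝ 1 fun t => (((k : ℝ) + 1)⁻¹)⁻¹ *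
      capFun (((k : ℝ) + 1)⁻¹ * (((m : ℝ) + 1)⁻¹ * gapFun (((m : ℝ) + 1) * t))) :=
    (cq k).comp (cp m)
  have bg : ∀ t, |deriv (fun t => (((k : ℝ) + 1)⁻¹)⁻¹ *
      capFun (((k : ℝ) + 1)⁻¹ * (((m : ℝ) + 1)⁻¹ * gapFun (((m : ℝ) + 1) * t)))) t| ≤
      (1 + C) * C := fun t => by
    have h1 := ((hasDerivAt_scale contDiff_capFun (c := ((k : ℝ) + 1)⁻¹) (by positivity)
      (((m : ℝ) + 1)⁻¹ * gapFun (((m : ℝ) + 1) * t))).comp t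
      (hasDerivAt_scale contDiff_gapFun (c := (m : ℝ) + 1) (by positivity) t)).deriv
    have h2 : deriv (fun t => (((k : ℝ) + 1)⁻¹)⁻¹ *
      capFun (((k : ℝ) + 1)⁻¹ * (((m : ℝ) + 1)⁻¹ * gapFun (((m : ℝ) + 1) * t)))) t = _ := h1
    rw [h2, abs_mul]
    exact mul_le_mul (hD _) (hC _) (abs_nonneg _) (by positivity)
  have zg : (fun t : ℝ => (((k : ℝ) + 1)⁻¹)⁻¹ *
      capFun (((k : ℝ) + 1)⁻¹ * (((m : ℝ) + 1)⁻¹ * gapFun (((m : ℝ) + 1) * t)))) 0 = 0 := by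
    simp [gapFun_zero, capFun_zero]
  have hmem := restrictH1_comp_mem_h10 hΩ hb hf h0 cg bg
    (M := (((k : ℝ) + 1)⁻¹)⁻¹ * 2) (fun t => by
      rw [abs_mul, abs_of_pos (show 0 < (((k : ℝ) + 1)⁻¹)⁻¹ by positivity)]
      gcongr
      exact abs_sub_gapFun_le _) zg (δ := ((m : ℝ) + 1)⁻¹) (by positivity) (fun t ht => by
      rw [gapFun_of_sq_le, mul_zero, mul_zero, capFun_zero, mul_zero]
      rw [sq_le_one_iff_abs_le_one, abs_mul, abs_of_pos (show 0 < (m : ℝ) + 1 by positivity)]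
      calc ((m : ℝ) + 1) * |t| ≤ ((m : ℝ) + 1) * ((m : ℝ) + 1)⁻¹ := by gcongr
        _ = 1 := mul_inv_cancel₀ (by positivity))
  -- Truncating once by the composition or twice in succession gives the same function, hence the
  -- same element of `H¹(ℝⁿ)`.
  have heq : ((hasL2Gradient w).comp cg bg zg).toH1 =
      ((hasL2Gradient u).comp (cq k) (bq k) (zq k)).toH1 := by
    refine h1_ext_of_isOpen isOpen_univ ?_
    filter_upwards [((hasL2Gradient w).comp cg bg zg).fn_toH1,
      ((hasL2Gradient u).comp (cq k) (bq k) (zq k)).fn_toH1,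
      ((hasL2Gradient w).comp (cp m) (bp m) (zp m)).fn_toH1] with x h1 h2 h3
    rw [h1, h2, hu, h3]
  rw [heq] at hmem
  exact hmem

/-- The hard half of the description of the kernel of the trace: `v` is the restriction of `T v`,
whose representative vanishes quasi-everywhere on `∂Ω`. -/
theorem mem_h10_of_trace_eq_zero {Ω : Set (Eu n)} (hn : n ≠ 0) (hΩ : IsOpen Ω)
    (hb : Bornology.IsBounded Ω)
    {T : H1 Ω →L[ℝ] H1 (univ : Set (Eu n))} (hT : IsExtensionOperator T) {v : H1 Ω}
    (hv : trace T v = 0) : v ∈ H10 Ω := by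
  obtain ⟨f, hf⟩ := exists_isQuasiContRep (T v)
  have h1 := trace_eq hn hΩ hT (hT v) hf
  rw [hv] at h1
  have h2 : restrictBoundary Ω f = restrictBoundary Ω fun _ => 0 := h1.symm
  rw [restrictBoundary_eq_iff] at h2
  simp only [sub_zero] at h2
  have h3 : restrictH1 Ω (T v) = v := by
    refine h1_ext_of_isOpen hΩ ?_
    filter_upwards [fn_restrictH1 (U := Ω) (T v), hT v] with x h3 h4
    rw [h3, h4]
  rw [← h3]
  exact restrictH1_mem_h10 hΩ hb hf h2

/-! ### The energy form -/

/-- Lax–Milgram: the variational problem for a bounded bilinear form that is coercive on a closed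
subspace. -/
theorem exists_orthogonal_decomposition {H : Type*} [NormedAddCommGroup H] [InnerProductSpace ℝ H]
    [CompleteSpace H] (B : H →ₗ[ℝ] H →ₗ[ℝ] ℝ) {M : ℝ} (hM0 : 0 ≤ M)
    (hM : ∀ u v, |B u v| ≤ M * ‖u‖ * ‖v‖) {K : Submodule ℝ H} (hK : IsClosed (K : Set H)) {c : ℝ}
    (hc : 0 < c) (hco : ∀ u ∈ K, c * ‖u‖ ^ 2 ≤ B u u) :
    ∃ C : ℝ, 0 ≤ C ∧ ∀ v : H, ∃ u : H, (∀ x ∈ K, B u x = 0) ∧ v - u ∈ K ∧ ‖u‖ ≤ C * ‖v‖ := by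
  have : CompleteSpace K := hK.completeSpace_coe
  let B' : H →L[ℝ] H →L[ℝ] ℝ := LinearMap.mkContinuous₂ B M hM
  have hB' : IsCoercive (B'.bilinearComp K.subtypeL K.subtypeL) := by
    refine ⟨c, hc, fun u => ?_⟩
    have := hco u u.2
    rw [pow_two, ← mul_assoc] at this
    exact this
  refine ⟨1 + M / c, by positivity, fun v => ?_⟩
  set ℓ : K →L[ℝ] ℝ := (B' v).comp K.subtypeL with hℓ
  -- `z ∈ K` represents `B v` on `K`, so `u = v - z` is annihilated there; coercivity gives `‖z‖ ≤
  -- (M / c) ‖v‖`, hence the constant `1 + M / c`.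
  set z := hB'.continuousLinearEquivOfBilin.symm ((InnerProductSpace.toDual ℝ K).symm ℓ)
    with hz
  have hzx : ∀ x ∈ K, B z x = B v x := fun x hx => by
    have h1 := hB'.continuousLinearEquivOfBilin_apply z ⟨x, hx⟩
    rw [hz, ContinuousLinearEquiv.apply_symm_apply, InnerProductSpace.toDual_symm_apply] at h1
    exact h1.symm
  refine ⟨v - z, fun x hx => ?_, by simp, ?_⟩
  · rw [map_sub, LinearMap.sub_apply, hzx x hx, sub_self]
  · have h1 := hco z z.2
    rw [hzx z z.2] at h1
    have h2 : B v z ≤ M * ‖v‖ * ‖z‖ := (le_abs_self _).trans (hM v z)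
    have h3 : ‖z‖ ≤ M / c * ‖v‖ := by
      rw [div_mul_eq_mul_div, le_div_iff₀ hc]
      rcases (norm_nonneg z).eq_or_lt with h | h
      · rw [← h, zero_mul]; positivity
      · refine le_of_mul_le_mul_right ?_ h
        calc ‖z‖ * c * ‖z‖ = c * ‖(z : H)‖ ^ 2 := by rw [Submodule.coe_norm]; ring
          _ ≤ _ := h1.trans h2
    calc ‖v - z‖ ≤ ‖v‖ + ‖(z : H)‖ := norm_sub_le _ _
      _ ≤ ‖v‖ + M / c * ‖v‖ := by gcongr; exact h3
      _ = _ := by ring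

section Energy

variable {Ω : Set (Eu n)} {γ : Eu n → ℝ}

theorem exists_ae_abs_le_of_memLp_top (hγ : MemLp γ ∞ (volume.restrict Ω)) :
    ∃ M : ℝ, 0 ≤ M ∧ ∀ᵐ x ∂(volume.restrict Ω), |γ x| ≤ M := by
  refine ⟨(eLpNorm γ ∞ (volume.restrict Ω)).toReal, ENNReal.toReal_nonneg, ?_⟩
  rw [eLpNorm_exponent_top]
  filter_upwards [ae_le_eLpNormEssSup (f := γ) (μ := volume.restrict Ω)] with x hx
  have htop : eLpNormEssSup γ (volume.restrict Ω) ≠ ⊤ := by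
    rw [← eLpNorm_exponent_top]; exact hγ.2.ne
  have := (ENNReal.toReal_le_toReal enorm_ne_top htop).2 hx
  rwa [toReal_enorm, Real.norm_eq_abs] at this

theorem memLp_conductivity_smul (hγ : MemLp γ ∞ (volume.restrict Ω)) (u : H1 Ω) :
    MemLp (fun x => γ x • grad u x) 2 (volume.restrict Ω) := by
  obtain ⟨M, -, hM⟩ := exists_ae_abs_le_of_memLp_top hγ
  refine (Lp.memLp (grad u)).of_le_mul (c := M) (hγ.1.smul (Lp.memLp (grad u)).1) ?_
  filter_upwards [hM] with x hx
  rw [norm_smul]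
  gcongr
  exact hx

theorem integrable_energy (hγ : MemLp γ ∞ (volume.restrict Ω)) (u v : H1 Ω) :
    Integrable (fun x => γ x * inner ℝ (grad u x) (grad v x)) (volume.restrict Ω) := by
  refine (L2.integrable_inner (𝕜 := ℝ) ((memLp_conductivity_smul hγ u).toLp _) (grad v)).congr ?_
  filter_upwards [(memLp_conductivity_smul hγ u).coeFn_toLp] with x hx
  rw [hx, real_inner_smul_left]

/-- As an `L²` inner product of `γ ∇u` with `∇v`, the energy inherits additivity, homogeneity,
continuity and the Cauchy–Schwarz bound. -/
theorem integral_energy_eq_inner (hγ : MemLp γ ∞ (volume.restrict Ω)) (u v : H1 Ω) :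
    ∫ x in Ω, γ x * inner ℝ (grad u x) (grad v x) =
      inner ℝ ((memLp_conductivity_smul hγ u).toLp _) (grad v) := by
  rw [L2.inner_def]
  refine integral_congr_ae ?_
  filter_upwards [(memLp_conductivity_smul hγ u).coeFn_toLp] with x hx
  rw [hx, real_inner_smul_left]

theorem abs_integral_energy_le (hγ : MemLp γ ∞ (volume.restrict Ω)) {M : ℝ} (hM0 : 0 ≤ M)
    (hM : ∀ᵐ x ∂(volume.restrict Ω), |γ x| ≤ M) (u v : H1 Ω) :
    |∫ x in Ω, γ x * inner ℝ (grad u x) (grad v x)| ≤ M * ‖u‖ * ‖v‖ := by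
  rw [integral_energy_eq_inner hγ]
  have h1 : ‖(memLp_conductivity_smul hγ u).toLp _‖ ≤ M * ‖grad u‖ := by
    refine Lp.norm_le_mul_norm_of_ae_le_mul ?_
    filter_upwards [hM, (memLp_conductivity_smul hγ u).coeFn_toLp] with x hx h2
    rw [h2, norm_smul]
    gcongr
    exact hx
  refine (abs_real_inner_le_norm _ _).trans ?_
  have h2 := norm_grad_le u
  have h3 := norm_grad_le v
  gcongr
  exact h1.trans (by gcongr)

theorem integral_energy_comm (γ : Eu n → ℝ) (u v : H1 Ω) :
    ∫ x in Ω, γ x * inner ℝ (grad u x) (grad v x) =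
      ∫ x in Ω, γ x * inner ℝ (grad v x) (grad u x) := by
  simp only [real_inner_comm]

theorem integral_energy_add (hγ : MemLp γ ∞ (volume.restrict Ω)) (u v w : H1 Ω) :
    ∫ x in Ω, γ x * inner ℝ (grad u x) (grad (v + w) x) =
      (∫ x in Ω, γ x * inner ℝ (grad u x) (grad v x)) +
        ∫ x in Ω, γ x * inner ℝ (grad u x) (grad w x) := by
  rw [integral_energy_eq_inner hγ, integral_energy_eq_inner hγ, integral_energy_eq_inner hγ,
    ← inner_add_right]
  rfl

theorem integral_energy_smul (hγ : MemLp γ ∞ (volume.restrict Ω)) (c : ℝ) (u v : H1 Ω) :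
    ∫ x in Ω, γ x * inner ℝ (grad u x) (grad (c • v) x) =
      c * ∫ x in Ω, γ x * inner ℝ (grad u x) (grad v x) := by
  rw [integral_energy_eq_inner hγ, integral_energy_eq_inner hγ, ← real_inner_smul_right]
  rfl

/-- The energy form `(u, v) ↦ ∫_Ω γ ∇u · ∇v`. -/
def energyForm (hγ : MemLp γ ∞ (volume.restrict Ω)) : H1 Ω →ₗ[ℝ] H1 Ω →ₗ[ℝ] ℝ :=
  LinearMap.mk₂ ℝ (fun u v : H1 Ω => ∫ x in Ω, γ x * inner ℝ (grad u x) (grad v x))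
    (fun u v w => by
      rw [integral_energy_comm γ, integral_energy_add hγ, integral_energy_comm γ w,
        integral_energy_comm γ w])
    (fun c u v => by
      rw [integral_energy_comm γ, integral_energy_smul hγ, integral_energy_comm γ v, smul_eq_mul])
    (integral_energy_add hγ) (fun c u v => integral_energy_smul hγ c u v)

theorem energyForm_apply (hγ : MemLp γ ∞ (volume.restrict Ω)) (u v : H1 Ω) :
    energyForm hγ u v = ∫ x in Ω, γ x * inner ℝ (grad u x) (grad v x) := rfl

theorem energyForm_comm (hγ : MemLp γ ∞ (volume.restrict Ω)) (u v : H1 Ω) :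
    energyForm hγ u v = energyForm hγ v u :=
  integral_energy_comm γ u v

theorem exists_abs_energyForm_le (hγ : MemLp γ ∞ (volume.restrict Ω)) :
    ∃ M : ℝ, 0 ≤ M ∧ ∀ u v : H1 Ω, |energyForm hγ u v| ≤ M * ‖u‖ * ‖v‖ := by
  obtain ⟨M, hM0, hM⟩ := exists_ae_abs_le_of_memLp_top hγ
  exact ⟨M, hM0, abs_integral_energy_le hγ hM0 hM⟩

theorem continuous_energyForm (hγ : MemLp γ ∞ (volume.restrict Ω)) (u : H1 Ω) :
    Continuous (energyForm hγ u) := by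
  have h : Continuous fun v : H1 Ω =>
      inner ℝ ((memLp_conductivity_smul hγ u).toLp _) (grad v) :=
    continuous_const.inner continuous_grad
  exact h.congr fun v => (integral_energy_eq_inner hγ u v).symm

/-- The energy form is continuous in its second argument, so orthogonality to test functions passes
to their closure. -/
theorem isWeakSolution_iff (hγ : MemLp γ ∞ (volume.restrict Ω)) {u : H1 Ω} :
    IsWeakSolution γ u ↔ ∀ v ∈ H10 Ω, energyForm hγ u v = 0 := by
  have key : ∀ φ, ∀ hφ : IsTest Ω φ, energyForm hγ u hφ.hasL2Gradient.toH1 =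
      ∫ x in Ω, γ x * inner ℝ (grad u x) (gradient φ x) := by
    intro φ hφ
    rw [energyForm_apply]
    refine integral_congr_ae ?_
    filter_upwards [(hφ.hasL2Gradient (U := Ω)).grad_toH1] with x hx
    rw [hx]
  constructor
  · intro h v hv
    refine h10_induction (p := fun v => energyForm hγ u v = 0)
      (isClosed_eq (continuous_energyForm hγ u) continuous_const) (fun φ hφ => ?_) hv
    exact (key φ hφ).trans (h φ hφ)
  · intro h φ hφ
    rw [← key φ hφ, h _ hφ.toH1_mem_h10]

theorem norm_grad_sq_le_energyForm (hγ : MemLp γ ∞ (volume.restrict Ω)) {c : ℝ}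
    (hc : ∀ᵐ x ∂(volume.restrict Ω), c ≤ γ x) (u : H1 Ω) :
    c * ‖grad u‖ ^ 2 ≤ energyForm hγ u u := by
  rw [norm_sq_lp_eq_integral, ← integral_const_mul, energyForm_apply]
  refine integral_mono_ae ((Lp.memLp (grad u)).integrable_norm_sq.const_mul c)
    (integrable_energy hγ u u) ?_
  filter_upwards [hc] with x hx
  rw [real_inner_self_eq_norm_sq]
  gcongr

/-- The lower bound on `γ` controls the gradient, and Friedrichs' inequality makes the gradient
control the full norm at the cost of the factor `1 + 4 * R ^ 2`. -/
theorem exists_norm_sq_le_energyForm (hn : n ≠ 0) (hb : Bornology.IsBounded Ω)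
    (hγ : IsConductivity Ω γ) :
    ∃ c : ℝ, 0 < c ∧ ∀ u ∈ H10 Ω, c * ‖u‖ ^ 2 ≤ energyForm hγ.memLp_top u u := by
  obtain ⟨c, hc, hcγ⟩ := hγ.pos
  obtain ⟨R, hR⟩ := hb.subset_closedBall 0
  refine ⟨c / (1 + 4 * R ^ 2), by positivity, fun u hu => ?_⟩
  have h1 := norm_fn_sq_le_of_mem_h10 hn hR hu
  refine le_trans ?_ (norm_grad_sq_le_energyForm hγ.memLp_top hcγ u)
  rw [h1_norm_sq, div_mul_eq_mul_div, div_le_iff₀ (by positivity), mul_assoc]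
  gcongr
  linarith

/-- Solvability of the Dirichlet problem with boundary values given by an `H¹` function. -/
theorem exists_isWeakSolution (hn : n ≠ 0) (hb : Bornology.IsBounded Ω) (hγ : IsConductivity Ω γ) :
    ∃ C : ℝ, 0 ≤ C ∧ ∀ v : H1 Ω, ∃ u : H1 Ω, IsWeakSolution γ u ∧ v - u ∈ H10 Ω ∧
      ‖u‖ ≤ C * ‖v‖ := by
  obtain ⟨c, hc, hco⟩ := exists_norm_sq_le_energyForm hn hb hγ
  obtain ⟨M, hM0, hM⟩ := exists_abs_energyForm_le hγ.memLp_top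
  simp only [isWeakSolution_iff hγ.memLp_top]
  exact exists_orthogonal_decomposition _ hM0 hM (isClosed_h10 Ω) hc hco

/-- The difference of the solutions is both orthogonal to `H10 Ω` and contained in it, so coercivity
makes it zero. -/
theorem eq_of_isWeakSolution (hn : n ≠ 0) (hb : Bornology.IsBounded Ω) (hγ : IsConductivity Ω γ)
    {u v : H1 Ω} (hu : IsWeakSolution γ u) (hv : IsWeakSolution γ v) (huv : u - v ∈ H10 Ω) :
    u = v := by
  obtain ⟨c, hc, hco⟩ := exists_norm_sq_le_energyForm hn hb hγ
  have h1 := hco _ huv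
  have h2 : energyForm hγ.memLp_top (u - v) (u - v) = 0 := by
    rw [map_sub (energyForm hγ.memLp_top), LinearMap.sub_apply,
      (isWeakSolution_iff hγ.memLp_top).1 hu _ huv,
      (isWeakSolution_iff hγ.memLp_top).1 hv _ huv, sub_self]
  rw [h2] at h1
  have h3 : ‖u - v‖ ^ 2 ≤ 0 := by
    by_contra hlt
    have := mul_pos hc (not_le.1 hlt)
    linarith
  exact sub_eq_zero.1 (norm_eq_zero.1 (pow_eq_zero_iff two_ne_zero |>.1
    (le_antisymm h3 (sq_nonneg _))))

end Energy

/-! ### The Poincaré–Steklov operator -/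

section PoincareSteklov

variable {Ω : Set (Eu n)} {T : H1 Ω →L[ℝ] H1 (univ : Set (Eu n))} {γ : Eu n → ℝ}

/-- Bounds against every preimage pass to the infimum. The existence of a preimage matters because
the infimum of the empty set is `0` by convention; `C = 0` is separate because the proof divides by
`C`. -/
theorem le_mul_traceNorm {f : TraceSpace Ω} (hf : ∃ v, trace T v = f) {a C : ℝ} (hC : 0 ≤ C)
    (h : ∀ v, trace T v = f → a ≤ C * ‖v‖) : a ≤ C * traceNorm T f := by
  obtain ⟨v₀, hv₀⟩ := hf
  rcases hC.eq_or_lt with rfl | hC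
  · simpa using h v₀ hv₀
  · rw [← div_le_iff₀' hC]
    refine le_csInf ⟨_, v₀, hv₀, rfl⟩ ?_
    rintro _ ⟨v, hv, rfl⟩
    rw [div_le_iff₀' hC]
    exact h v hv

theorem traceDualNorm_le {ψ : TraceDual T} {C : ℝ} (hC : 0 ≤ C)
    (h : ∀ f, |pairing ψ f| ≤ C * traceNorm T f) : traceDualNorm ψ ≤ C :=
  csInf_le ⟨0, fun _ h => h.1⟩ ⟨hC, h⟩

theorem traceDual_ext {ψ χ : TraceDual T} (h : ∀ f, pairing ψ f = pairing χ f) : ψ = χ :=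
  Subtype.ext (LinearMap.ext h)

theorem sub_mem_h10_of_trace_eq (hn : n ≠ 0) (hΩ : IsOpen Ω) (hb : Bornology.IsBounded Ω)
    (hT : IsExtensionOperator T) {u v : H1 Ω} (h : trace T u = trace T v) : u - v ∈ H10 Ω := by
  refine mem_h10_of_trace_eq_zero hn hΩ hb hT ?_
  have h1 := map_sub (traceLinear hn hΩ hT) u v
  change trace T (u - v) = trace T u - trace T v at h1
  rw [h1, h, sub_self]

theorem trace_eq_of_sub_mem_h10 (hn : n ≠ 0) (hΩ : IsOpen Ω)
    (hT : IsExtensionOperator T) {u v : H1 Ω} (h : u - v ∈ H10 Ω) : trace T u = trace T v := by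
  have h1 := map_sub (traceLinear hn hΩ hT) u v
  change trace T (u - v) = trace T u - trace T v at h1
  rw [trace_eq_zero_of_mem_h10 hn hΩ hT h] at h1
  exact (sub_eq_zero.1 h1.symm)

theorem energyForm_eq_of_trace_eq (hn : n ≠ 0) (hΩ : IsOpen Ω) (hb : Bornology.IsBounded Ω)
    (hT : IsExtensionOperator T) (hγ : MemLp γ ∞ (volume.restrict Ω)) {u : H1 Ω}
    (hu : IsWeakSolution γ u) {v w : H1 Ω} (h : trace T v = trace T w) :
    energyForm hγ u v = energyForm hγ u w := by
  have h1 := (isWeakSolution_iff hγ).1 hu _ (sub_mem_h10_of_trace_eq hn hΩ hb hT h)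
  rwa [map_sub, sub_eq_zero] at h1

/-- For a solution `u` the functional `E(u, ·)` vanishes on the kernel of the trace, so it descends
to the trace space. A right inverse of the trace chosen pointwise suffices: linearity comes from
independence of the preimage. -/
theorem exists_isConormalDerivative (hn : n ≠ 0) (hΩ : IsOpen Ω) (hb : Bornology.IsBounded Ω)
    (hT : IsExtensionOperator T) (hγ : MemLp γ ∞ (volume.restrict Ω)) {u : H1 Ω}
    (hu : IsWeakSolution γ u) : ∃ ψ : TraceDual T, IsConormalDerivative T γ u ψ := by
  have hs := trace_surjective hn hΩ hT
  have hadd : ∀ v w, trace T (v + w) = trace T v + trace T w := map_add (traceLinear hn hΩ hT)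
  have hsmul : ∀ (c : ℝ) v, trace T (c • v) = c • trace T v := map_smul (traceLinear hn hΩ hT)
  set σ := Function.surjInv hs with hσ
  have hσ' : ∀ f, trace T (σ f) = f := Function.surjInv_eq hs
  let ψ : Module.Dual ℝ (TraceSpace Ω) :=
    { toFun := fun f => energyForm hγ u (σ f)
      map_add' := fun f g => by
        rw [← map_add]
        refine energyForm_eq_of_trace_eq hn hΩ hb hT hγ hu ?_
        rw [hadd, hσ', hσ', hσ']
      map_smul' := fun c f => by
        rw [RingHom.id_apply, ← map_smul]
        refine energyForm_eq_of_trace_eq hn hΩ hb hT hγ hu ?_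
        rw [hsmul, hσ', hσ'] }
  obtain ⟨M, hM0, hM⟩ := exists_abs_energyForm_le hγ
  have hψ : ∀ v, ψ (trace T v) = energyForm hγ u v := fun v =>
    energyForm_eq_of_trace_eq hn hΩ hb hT hγ hu (hσ' _)
  refine ⟨⟨ψ, M * ‖u‖, fun f => le_mul_traceNorm (hs f) (by positivity) ?_⟩, hψ⟩
  rintro v rfl
  rw [hψ]
  exact hM u v

theorem isConormalDerivative_unique (hn : n ≠ 0) (hΩ : IsOpen Ω)
    (hT : IsExtensionOperator T) {u : H1 Ω} {ψ χ : TraceDual T} (hψ : IsConormalDerivative T γ u ψ)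
    (hχ : IsConormalDerivative T γ u χ) : ψ = χ := by
  refine traceDual_ext fun f => ?_
  obtain ⟨v, rfl⟩ := trace_surjective hn hΩ hT f
  rw [hψ v, hχ v]

theorem existsUnique_isWeakSolution (hn : n ≠ 0) (hΩ : IsOpen Ω) (hb : Bornology.IsBounded Ω)
    (hT : IsExtensionOperator T) (hγ : IsConductivity Ω γ) (f : TraceSpace Ω) :
    ∃! u : H1 Ω, IsWeakSolution γ u ∧ trace T u = f := by
  obtain ⟨v, rfl⟩ := trace_surjective hn hΩ hT f
  obtain ⟨C, -, hC⟩ := exists_isWeakSolution hn hb hγ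
  obtain ⟨u, hu, huv, -⟩ := hC v
  refine ⟨u, ⟨hu, (trace_eq_of_sub_mem_h10 hn hΩ hT huv).symm⟩, ?_⟩
  rintro w ⟨hw, hwv⟩
  refine eq_of_isWeakSolution hn hb hγ hw hu (sub_mem_h10_of_trace_eq hn hΩ hb hT ?_)
  rw [hwv, trace_eq_of_sub_mem_h10 hn hΩ hT huv]

/-- The definition of the operator chooses some functional attached to some solution; uniqueness of
the solution with a given trace makes the choice harmless. -/
theorem isConormalDerivative_poincareSteklov (hn : n ≠ 0) (hΩ : IsOpen Ω)
    (hb : Bornology.IsBounded Ω) (hT : IsExtensionOperator T) (hγ : IsConductivity Ω γ) {u : H1 Ω}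
    (hu : IsWeakSolution γ u) :
    IsConormalDerivative T γ u (poincareSteklov T γ (trace T u)) := by
  have hex : ∃ ψ : TraceDual T, ∃ v : H1 Ω,
      IsWeakSolution γ v ∧ trace T v = trace T u ∧ IsConormalDerivative T γ v ψ := by
    obtain ⟨ψ, hψ⟩ := exists_isConormalDerivative hn hΩ hb hT hγ.memLp_top hu
    exact ⟨ψ, u, hu, rfl, hψ⟩
  rw [poincareSteklov, dif_pos hex]
  obtain ⟨v, hv, hvu, hψ⟩ := hex.choose_spec
  have h : v = u := eq_of_isWeakSolution hn hb hγ hv hu (sub_mem_h10_of_trace_eq hn hΩ hb hT hvu)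
  rw [h] at hψ
  exact hψ

/-- The formula from which symmetry, linearity, boundedness and the identity for two conductivities
are all read off; `v` need not be a solution. -/
theorem pairing_poincareSteklov (hn : n ≠ 0) (hΩ : IsOpen Ω)
    (hb : Bornology.IsBounded Ω) (hT : IsExtensionOperator T) (hγ : IsConductivity Ω γ) {u : H1 Ω}
    (hu : IsWeakSolution γ u) (v : H1 Ω) :
    pairing (poincareSteklov T γ (trace T u)) (trace T v) = energyForm hγ.memLp_top u v :=
  isConormalDerivative_poincareSteklov hn hΩ hb hT hγ hu v

theorem pairing_poincareSteklov_comm (hn : n ≠ 0) (hΩ : IsOpen Ω)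
    (hb : Bornology.IsBounded Ω) (hT : IsExtensionOperator T) (hγ : IsConductivity Ω γ)
    (f g : TraceSpace Ω) :
    pairing (poincareSteklov T γ f) g = pairing (poincareSteklov T γ g) f := by
  obtain ⟨u, ⟨hu, rfl⟩, -⟩ := existsUnique_isWeakSolution hn hΩ hb hT hγ f
  obtain ⟨v, ⟨hv, rfl⟩, -⟩ := existsUnique_isWeakSolution hn hΩ hb hT hγ g
  rw [pairing_poincareSteklov hn hΩ hb hT hγ hu, pairing_poincareSteklov hn hΩ hb hT hγ hv,
    energyForm_comm]

/-- Symmetry moves the argument of the operator into the second slot of the pairing, where linearity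
is built in. -/
theorem isLinearMap_poincareSteklov (hn : n ≠ 0) (hΩ : IsOpen Ω)
    (hb : Bornology.IsBounded Ω) (hT : IsExtensionOperator T) (hγ : IsConductivity Ω γ) :
    IsLinearMap ℝ (poincareSteklov T γ) := by
  refine ⟨fun f g => traceDual_ext fun k => ?_, fun c f => traceDual_ext fun k => ?_⟩
  · change _ = pairing (poincareSteklov T γ f) k + pairing (poincareSteklov T γ g) k
    rw [pairing_poincareSteklov_comm hn hΩ hb hT hγ _ k,
      pairing_poincareSteklov_comm hn hΩ hb hT hγ _ k,
      pairing_poincareSteklov_comm hn hΩ hb hT hγ _ k]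
    exact map_add _ f g
  · change _ = c • pairing (poincareSteklov T γ f) k
    rw [pairing_poincareSteklov_comm hn hΩ hb hT hγ _ k,
      pairing_poincareSteklov_comm hn hΩ hb hT hγ _ k]
    exact map_smul _ c f

/-- The energy is bounded by `M ‖u‖ ‖w‖`, and the solution by `C` times the norm of any function
with the same trace. Taking infima over the preimages of both traces yields the constant `M * C`. -/
theorem exists_traceDualNorm_poincareSteklov_le (hn : n ≠ 0) (hΩ : IsOpen Ω)
    (hb : Bornology.IsBounded Ω) (hT : IsExtensionOperator T) (hγ : IsConductivity Ω γ) :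
    ∃ C : ℝ, ∀ f : TraceSpace Ω,
      traceDualNorm (poincareSteklov T γ f) ≤ C * traceNorm T f := by
  obtain ⟨C, hC0, hC⟩ := exists_isWeakSolution hn hb hγ
  obtain ⟨M, hM0, hM⟩ := exists_abs_energyForm_le hγ.memLp_top
  refine ⟨M * C, fun f => le_mul_traceNorm (trace_surjective hn hΩ hT f) (by positivity) ?_⟩
  rintro v rfl
  obtain ⟨u, hu, huv, hle⟩ := hC v
  rw [trace_eq_of_sub_mem_h10 hn hΩ hT huv]
  refine traceDualNorm_le (by positivity) fun g =>
    le_mul_traceNorm (trace_surjective hn hΩ hT g) (by positivity) ?_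
  rintro w rfl
  rw [pairing_poincareSteklov hn hΩ hb hT hγ hu]
  refine (hM u w).trans ?_
  rw [mul_assoc M C]
  gcongr

end PoincareSteklov

end Steklov

end

open Steklov

/-! ### The main theorem. -/

theorem proposition2 {n : ℕ} (hn : 2 ≤ n) {Ω : Set (Eu n)} (hΩ : IsAdmissible Ω)
    (T : H1 Ω →L[ℝ] H1 (univ : Set (Eu n))) (hT : IsExtensionOperator T) :
    (∀ γ : Eu n → ℝ, IsConductivity Ω γ →
      -- well-definedness of the operator
      ((∀ f : TraceSpace Ω, ∃! u : H1 Ω, IsWeakSolution γ u ∧ trace T u = f) ∧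
        (∀ u : H1 Ω, IsWeakSolution γ u →
          ∀ ψ : TraceDual T, IsConormalDerivative T γ u ψ ↔
            ψ = poincareSteklov T γ (trace T u))) ∧
      -- linearity, boundedness, self-adjointness
      IsLinearMap ℝ (poincareSteklov T γ) ∧
      (∃ C : ℝ, ∀ f : TraceSpace Ω,
        traceDualNorm (poincareSteklov T γ f) ≤ C * traceNorm T f) ∧
      (∀ f g : TraceSpace Ω,
        pairing (poincareSteklov T γ f) g = pairing (poincareSteklov T γ g) f)) ∧
    (∀ γ₁ γ₂ : Eu n → ℝ, IsConductivity Ω γ₁ → IsConductivity Ω γ₂ →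
      ∀ u₁ u₂ : H1 Ω, IsWeakSolution γ₁ u₁ → IsWeakSolution γ₂ u₂ →
        pairing (poincareSteklov T γ₁ (trace T u₁) - poincareSteklov T γ₂ (trace T u₁))
            (trace T u₂) =
          ∫ x in Ω, (γ₁ x - γ₂ x) * inner ℝ (grad u₁ x) (grad u₂ x)) := by

  have hn0 : n ≠ 0 := by omega
  have hΩo := hΩ.isOpen
  have hb := hΩ.isBounded
  refine ⟨fun γ hγ => ⟨⟨existsUnique_isWeakSolution hn0 hΩo hb hT hγ, fun u hu ψ => ?_⟩,
    isLinearMap_poincareSteklov hn0 hΩo hb hT hγ,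
    exists_traceDualNorm_poincareSteklov_le hn0 hΩo hb hT hγ,
    pairing_poincareSteklov_comm hn0 hΩo hb hT hγ⟩, fun γ₁ γ₂ h₁ h₂ u₁ u₂ hu₁ hu₂ => ?_⟩
  · have h := isConormalDerivative_poincareSteklov hn0 hΩo hb hT hγ hu
    refine ⟨fun hψ => isConormalDerivative_unique hn0 hΩo hT hψ h, ?_⟩
    rintro rfl
    exact h
  · change pairing (poincareSteklov T γ₁ (trace T u₁)) (trace T u₂) -
      pairing (poincareSteklov T γ₂ (trace T u₁)) (trace T u₂) = _
    -- The function `u₁` need not solve the equation for `γ₂`. Self-adjointness turns the second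
    -- pairing into one with the solution `u₂` in the first slot, where the energy formula applies
    -- with `u₁` as an arbitrary second argument.
    rw [pairing_poincareSteklov hn0 hΩo hb hT h₁ hu₁,
      pairing_poincareSteklov_comm hn0 hΩo hb hT h₂,
      pairing_poincareSteklov hn0 hΩo hb hT h₂ hu₂, energyForm_comm h₂.memLp_top, energyForm_apply,
      energyForm_apply, ← integral_sub (integrable_energy h₁.memLp_top u₁ u₂)
        (integrable_energy h₂.memLp_top u₁ u₂)]
    simp only [sub_mul]
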